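/- Let $k$ be an algebraically closed field, let $n\ge 2$, and let $\mathrm{Cr}_n(k)=\mathrm{Bir}(\mathbb{P}^n_k)$ be the Cremona group, the group (under composition) of birational transformations of $\mathbb{P}^n_k$. An algebraic family of elements of $\mathrm{Bir}(\mathbb{P}^n_k)$ parametrized by a $k$-variety $A$ is a rational map $f\colon A\times\mathbb{P}^n_k\dashrightarrow\mathbb{P}^n_k$, defined on a dense open subset $U$, such that for every $a\in A$ the slice $U_a=U\cap(\{a\}\times\mathbb{P}^n_k)$ is a dense open subset of $\{a\}\times \mathbb{P}^n_k$ and $f$ restricts to an isomorphism of $U_a$ onto a dense open subset of $\mathbb{P}^n_k$. It defines a map $A\to\mathrm{Bir}(\mathbb{P}^n_k)$, $a\mapsto f_a=f(a,\cdot)$; the maps obtained in this way are called morphisms. A subset of $\mathrm{Cr}_n(k)$ is closed for the Zariski topology if its preimage under every morphism $A\to\mathrm{Cr}_n(k)$, for every $k$-variety $A$, is closed in $A$. Let $K=k(x_1,\dots,x_{n-1})$, and let $J^0_n\subset\mathrm{Cr}_n(k)$ be the group of the transformations that preserve a general fibre of the projection $(x_0:\dots:x_n)\dashrightarrow(x_1:\dots:x_n)$.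 In the chart $x_n=1$, with $y=(x_1,\dots,x_{n-1})$, its elements are the transformations $(x_0,y)\dashrightarrow\left(\frac{a(y)x_0+b(y)}{c(y)x_0+d(y)},\,y\right)$ with $\begin{pmatrix}a&b\\c&d\end{pmatrix}\in\mathrm{GL}(2,K)$, so that $J^0_n\simeq\mathrm{PGL}(2,K)$. Let $J^1_n\subset J^0_n$ be the kernel of the determinant $\det\colon J^0_n\to K^*/(K^*)^2$. Then every non-trivial normal subgroup $N$ of $\mathrm{Cr}_n(k)$ that is closed for the Zariski topology contains $\mathrm{Aut}(\mathbb{P}^n_k)$ and $J^1_n$. Here $\mathrm{Aut}(\mathbb{P}^n_k)\simeq\mathrm{PGL}(n+1,k)$, the class of a matrix $M$ corresponding to $[v]\mapsto[Mv]$, and $J^1_n\simeq\mathrm{PSL}(2,K)$, the class of $\begin{pmatrix}a&b\\c&d\end{pmatrix}\in\mathrm{SL}(2,K)$ corresponding to the transformation above. -/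

import Mathlib

open Set Filter Topology
open scoped LinearAlgebra.Projectivization

universe u

noncomputable section

namespace Cremona

/-! ## Spaces with functions

Varieties over an algebraically closed field are taken in the classical language: a topological
space together with a sheaf of `k`-valued functions. The sheaf is given through its germs:
`RegularAt f x` says that the function `f` is regular at `x`, and a function is regular on an open
set when it is regular at each of its points, so that the gluing axiom is automatic. -/

/-- A space with functions over `k`: a topological space with a sheaf of `k`-algebras of `k`-valued
functions such that, for a regular function `f`, the locus `f ≠ 0` is open and `1 / f` is regular
on it. Only the values of `f` near `x` matter for `RegularAt f x`. -/
structure KSpace (k : Type u) [Field k] where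
  carrier : Type u
  top : TopologicalSpace carrier
  RegularAt : (carrier → k) → carrier → Prop
  congr : ∀ {f g : carrier → k} {x : carrier},
    RegularAt f x → f =ᶠ[𝓝 x] g → RegularAt g x
  eventually : ∀ {f : carrier → k} {x : carrier},
    RegularAt f x → ∀ᶠ y in 𝓝 x, RegularAt f y
  const : ∀ (c : k) (x : carrier), RegularAt (fun _ => c) x
  add : ∀ {f g : carrier → k} {x : carrier},
    RegularAt f x → RegularAt g x → RegularAt (f + g) x
  mul : ∀ {f g : carrier → k} {x : carrier},
    RegularAt f x → RegularAt g x → RegularAt (f * g) x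
  ne_zero : ∀ {f : carrier → k} {x : carrier},
    RegularAt f x → f x ≠ 0 → ∀ᶠ y in 𝓝 x, f y ≠ 0
  inv : ∀ {f : carrier → k} {x : carrier},
    RegularAt f x → f x ≠ 0 → RegularAt f⁻¹ x

variable {k : Type u} [Field k]

instance : CoeSort (KSpace k) (Type u) := ⟨KSpace.carrier⟩

instance (X : KSpace k) : TopologicalSpace X := X.top

/-- `φ` is a morphism of spaces with functions near `x` (used at all points of an open set, on
which `φ` is then a morphism; the values of `φ` elsewhere are irrelevant). -/
def IsMorphismAt {X Y : KSpace k} (φ : X → Y) (x : X) : Prop :=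
  ContinuousAt φ x ∧ ∀ g : Y → k, Y.RegularAt g (φ x) → X.RegularAt (g ∘ φ) x

theorem IsMorphismAt.id {X : KSpace k} (x : X) : IsMorphismAt (fun y : X => y) x :=
  ⟨continuousAt_id, fun _ hg => hg⟩

theorem IsMorphismAt.comp {X Y Z : KSpace k} {ψ : Y → Z} {φ : X → Y} {x : X}
    (hψ : IsMorphismAt ψ (φ x)) (hφ : IsMorphismAt φ x) : IsMorphismAt (ψ ∘ φ) x :=
  ⟨hψ.1.comp hφ.1, fun g hg => hφ.2 _ (hψ.2 g hg)⟩

/-- Isomorphism of spaces with functions. -/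
def Isomorphic (X Y : KSpace k) : Prop :=
  ∃ e : X ≃ₜ Y, (∀ x, IsMorphismAt (e : X → Y) x) ∧ ∀ y, IsMorphismAt (e.symm : Y → X) y

/-- The space with functions induced on a subset: the topology is the induced one and a function is
regular when it is locally the restriction of a regular function. -/
def KSpace.sub (X : KSpace k) (Z : Set X) : KSpace k where
  carrier := Z
  top := inferInstance
  RegularAt f x := ∃ g : X → k, X.RegularAt g x ∧ f =ᶠ[𝓝 x] g ∘ Subtype.val
  congr := fun ⟨g, hg, h⟩ hfg => ⟨g, hg, hfg.symm.trans h⟩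
  eventually := by
    rintro f x ⟨g, hg, h⟩
    have h1 : ∀ᶠ y : Z in 𝓝 x, X.RegularAt g y :=
      continuous_subtype_val.continuousAt.eventually (X.eventually hg)
    filter_upwards [h1, h.eventually_nhds] with y hy hy' using ⟨g, hy, hy'⟩
  const c x := ⟨fun _ => c, X.const c x, .rfl⟩
  add := fun ⟨g, hg, h⟩ ⟨g', hg', h'⟩ => ⟨g + g', X.add hg hg', h.add h'⟩
  mul := fun ⟨g, hg, h⟩ ⟨g', hg', h'⟩ => ⟨g * g', X.mul hg hg', h.mul h'⟩
  ne_zero := by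
    rintro f x ⟨g, hg, h⟩ hx
    rw [h.eq_of_nhds] at hx
    have h1 : ∀ᶠ y : Z in 𝓝 x, g y ≠ 0 :=
      continuous_subtype_val.continuousAt.eventually (X.ne_zero hg hx)
    filter_upwards [h1, h] with y hy hy'
    rw [hy']
    exact hy
  inv := by
    rintro f x ⟨g, hg, h⟩ hx
    rw [h.eq_of_nhds] at hx
    exact ⟨g⁻¹, X.inv hg hx, h.inv⟩

/-! ### Affine space -/

/-- The Zariski topology on `k ^ m`, with the basis of the sets `P ≠ 0`. -/
abbrev affineTop (k : Type u) [Field k] (m : ℕ) : TopologicalSpace (Fin m → k) :=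
  TopologicalSpace.generateFrom
    {U | ∃ P : MvPolynomial (Fin m) k, U = {x | MvPolynomial.eval x P ≠ 0}}

theorem affine_ne_zero {m : ℕ} {x : Fin m → k} {Q : MvPolynomial (Fin m) k}
    (h : MvPolynomial.eval x Q ≠ 0) :
    ∀ᶠ y in @nhds _ (affineTop k m) x, MvPolynomial.eval y Q ≠ 0 :=
  letI := affineTop k m
  IsOpen.mem_nhds (TopologicalSpace.isOpen_generateFrom_of_mem ⟨Q, rfl⟩) h

/-- Affine space of dimension `m`: regular functions are locally quotients of polynomials. -/
def affineSpace (k : Type u) [Field k] (m : ℕ) : KSpace k where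
  carrier := Fin m → k
  top := affineTop k m
  RegularAt f x := ∃ P Q : MvPolynomial (Fin m) k, MvPolynomial.eval x Q ≠ 0 ∧
    ∀ᶠ y in @nhds _ (affineTop k m) x, f y = MvPolynomial.eval y P / MvPolynomial.eval y Q
  congr := by
    rintro f g x ⟨P, Q, hQ, h⟩ hfg
    refine ⟨P, Q, hQ, ?_⟩
    filter_upwards [h, hfg] with y h1 h2
    rw [← h2, h1]
  eventually := by
    rintro f x ⟨P, Q, hQ, h⟩
    filter_upwards [(@eventually_eventually_nhds _ (affineTop k m) _ _).2 h, affine_ne_zero hQ]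
      with y h1 h2 using ⟨P, Q, h2, h1⟩
  const c x := ⟨MvPolynomial.C c, 1, by simp, by simp⟩
  add := by
    rintro f g x ⟨P, Q, hQ, h⟩ ⟨P', Q', hQ', h'⟩
    refine ⟨P * Q' + Q * P', Q * Q', by simp [hQ, hQ'], ?_⟩
    filter_upwards [h, h', affine_ne_zero hQ, affine_ne_zero hQ'] with y h1 h2 h3 h4
    simp [h1, h2, div_add_div _ _ h3 h4]
  mul := by
    rintro f g x ⟨P, Q, hQ, h⟩ ⟨P', Q', hQ', h'⟩
    refine ⟨P * P', Q * Q', by simp [hQ, hQ'], ?_⟩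
    filter_upwards [h, h'] with y h1 h2
    simp [h1, h2, div_mul_div_comm]
  ne_zero := by
    rintro f x ⟨P, Q, hQ, h⟩ hx
    have hP : MvPolynomial.eval x P ≠ 0 := by
      rw [@Eventually.self_of_nhds _ (affineTop k m) _ _ h] at hx
      exact (div_ne_zero_iff.1 hx).1
    filter_upwards [h, affine_ne_zero hQ, affine_ne_zero hP] with y h1 h2 h3
    rw [h1]
    exact div_ne_zero h3 h2
  inv := by
    rintro f x ⟨P, Q, hQ, h⟩ hx
    have hP : MvPolynomial.eval x P ≠ 0 := by
      rw [@Eventually.self_of_nhds _ (affineTop k m) _ _ h] at hx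
      exact (div_ne_zero_iff.1 hx).1
    refine ⟨Q, P, hP, ?_⟩
    filter_upwards [h] with y h1
    simp [h1]

/-! ### Projective space

A homogeneous polynomial is evaluated at the representative `p.rep` of a point `p`; neither its
vanishing nor a quotient of two such values of the same degree depends on the representative. -/

/-- The Zariski topology on the projective space, with the basis of the sets `F ≠ 0` for `F`
homogeneous. -/
abbrev projTop (k : Type u) [Field k] (n : ℕ) : TopologicalSpace (ℙ k (Fin (n + 1) → k)) :=
  TopologicalSpace.generateFrom
    {U | ∃ (d : ℕ) (F : MvPolynomial (Fin (n + 1)) k), F.IsHomogeneous d ∧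
      U = {p | MvPolynomial.eval p.rep F ≠ 0}}

theorem proj_ne_zero {n d : ℕ} {p : ℙ k (Fin (n + 1) → k)} {Q : MvPolynomial (Fin (n + 1)) k}
    (hd : Q.IsHomogeneous d) (h : MvPolynomial.eval p.rep Q ≠ 0) :
    ∀ᶠ q in @nhds _ (projTop k n) p, MvPolynomial.eval q.rep Q ≠ 0 :=
  letI := projTop k n
  IsOpen.mem_nhds (TopologicalSpace.isOpen_generateFrom_of_mem ⟨d, Q, hd, rfl⟩) h

/-- Projective space of dimension `n`: regular functions are locally quotients of homogeneous
polynomials of the same degree. -/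
def projectiveSpace (k : Type u) [Field k] (n : ℕ) : KSpace k where
  carrier := ℙ k (Fin (n + 1) → k)
  top := projTop k n
  RegularAt f p := ∃ (d : ℕ) (P Q : MvPolynomial (Fin (n + 1)) k),
    P.IsHomogeneous d ∧ Q.IsHomogeneous d ∧ MvPolynomial.eval p.rep Q ≠ 0 ∧
    ∀ᶠ q in @nhds _ (projTop k n) p,
      f q = MvPolynomial.eval q.rep P / MvPolynomial.eval q.rep Q
  congr := by
    rintro f g x ⟨d, P, Q, dP, dQ, hQ, h⟩ hfg
    refine ⟨d, P, Q, dP, dQ, hQ, ?_⟩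
    filter_upwards [h, hfg] with y h1 h2
    rw [← h2, h1]
  eventually := by
    rintro f x ⟨d, P, Q, dP, dQ, hQ, h⟩
    filter_upwards [(@eventually_eventually_nhds _ (projTop k n) _ _).2 h, proj_ne_zero dQ hQ]
      with y h1 h2 using ⟨d, P, Q, dP, dQ, h2, h1⟩
  const c x := ⟨0, MvPolynomial.C c, 1, MvPolynomial.isHomogeneous_C _ _,
    MvPolynomial.isHomogeneous_one _ _, by simp, by simp⟩
  add := by
    rintro f g x ⟨d, P, Q, dP, dQ, hQ, h⟩ ⟨d', P', Q', dP', dQ', hQ', h'⟩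
    refine ⟨d + d', P * Q' + Q * P', Q * Q', (dP.mul dQ').add (dQ.mul dP'), dQ.mul dQ',
      by simp [hQ, hQ'], ?_⟩
    filter_upwards [h, h', proj_ne_zero dQ hQ, proj_ne_zero dQ' hQ'] with y h1 h2 h3 h4
    simp [h1, h2, div_add_div _ _ h3 h4]
  mul := by
    rintro f g x ⟨d, P, Q, dP, dQ, hQ, h⟩ ⟨d', P', Q', dP', dQ', hQ', h'⟩
    refine ⟨d + d', P * P', Q * Q', dP.mul dP', dQ.mul dQ', by simp [hQ, hQ'], ?_⟩
    filter_upwards [h, h'] with y h1 h2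
    simp [h1, h2, div_mul_div_comm]
  ne_zero := by
    rintro f x ⟨d, P, Q, dP, dQ, hQ, h⟩ hx
    have hP : MvPolynomial.eval x.rep P ≠ 0 := by
      rw [@Eventually.self_of_nhds _ (projTop k n) _ _ h] at hx
      exact (div_ne_zero_iff.1 hx).1
    filter_upwards [h, proj_ne_zero dQ hQ, proj_ne_zero dP hP] with y h1 h2 h3
    rw [h1]
    exact div_ne_zero h3 h2
  inv := by
    rintro f x ⟨d, P, Q, dP, dQ, hQ, h⟩ hx
    have hP : MvPolynomial.eval x.rep P ≠ 0 := by
      rw [@Eventually.self_of_nhds _ (projTop k n) _ _ h] at hx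
      exact (div_ne_zero_iff.1 hx).1
    refine ⟨d, Q, P, dQ, dP, hP, ?_⟩
    filter_upwards [h] with y h1
    simp [h1]

/-! ### Products -/

/-- The functions on `X × Y` that are, on `U × V`, finite sums of products `f(x) g(y)` with `f`
regular on `U` and `g` regular on `V`. -/
def tensorFun (X Y : KSpace k) (U : Set X) (V : Set Y) : Subalgebra k (X × Y → k) :=
  Algebra.adjoin k
    ({h | ∃ f : X → k, (∀ x ∈ U, X.RegularAt f x) ∧ h = fun p => f p.1} ∪
      {h | ∃ g : Y → k, (∀ y ∈ V, Y.RegularAt g y) ∧ h = fun p => g p.2})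

theorem tensorFun_mono (X Y : KSpace k) {U U' : Set X} {V V' : Set Y} (hU : U' ⊆ U)
    (hV : V' ⊆ V) : tensorFun X Y U V ≤ tensorFun X Y U' V' :=
  Algebra.adjoin_mono (union_subset_union
    (fun _ ⟨f, hf, h⟩ => ⟨f, fun x hx => hf x (hU hx), h⟩)
    (fun _ ⟨g, hg, h⟩ => ⟨g, fun y hy => hg y (hV hy), h⟩))

/-- The Zariski topology on a product (finer than the product topology), with the basis of the sets
`{(x, y) ∈ U × V | h(x, y) ≠ 0}`, for `U`, `V` open and `h` a sum of products of regular
functions. -/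
abbrev prodTop (X Y : KSpace k) : TopologicalSpace (X × Y) :=
  TopologicalSpace.generateFrom
    {W | ∃ (U : Set X) (V : Set Y) (h : X × Y → k), IsOpen U ∧ IsOpen V ∧
      h ∈ tensorFun X Y U V ∧ W = {p | p.1 ∈ U ∧ p.2 ∈ V ∧ h p ≠ 0}}

theorem prod_ne_zero {X Y : KSpace k} {U : Set X} {V : Set Y} {h : X × Y → k} {p : X × Y}
    (hU : IsOpen U) (hV : IsOpen V) (pU : p.1 ∈ U) (pV : p.2 ∈ V)
    (hh : h ∈ tensorFun X Y U V) (hp : h p ≠ 0) :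
    ∀ᶠ q in @nhds _ (prodTop X Y) p, q.1 ∈ U ∧ q.2 ∈ V ∧ h q ≠ 0 :=
  letI := prodTop X Y
  IsOpen.mem_nhds
    (TopologicalSpace.isOpen_generateFrom_of_mem ⟨U, V, h, hU, hV, hh, rfl⟩) ⟨pU, pV, hp⟩

/-- The product of two spaces with functions: regular functions are locally quotients of sums of
products of regular functions on the factors. -/
def KSpace.prod (X Y : KSpace k) : KSpace k where
  carrier := X × Y
  top := prodTop X Y
  RegularAt f p := ∃ (U : Set X) (V : Set Y) (P Q : X × Y → k), IsOpen U ∧ IsOpen V ∧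
    p.1 ∈ U ∧ p.2 ∈ V ∧ P ∈ tensorFun X Y U V ∧ Q ∈ tensorFun X Y U V ∧ Q p ≠ 0 ∧
    ∀ᶠ q in @nhds _ (prodTop X Y) p, f q = P q / Q q
  congr := by
    rintro f g x ⟨U, V, P, Q, hU, hV, xU, xV, hP, hQ, hx, h⟩ hfg
    refine ⟨U, V, P, Q, hU, hV, xU, xV, hP, hQ, hx, ?_⟩
    filter_upwards [h, hfg] with y h1 h2
    rw [← h2, h1]
  eventually := by
    rintro f x ⟨U, V, P, Q, hU, hV, xU, xV, hP, hQ, hx, h⟩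
    filter_upwards [(@eventually_eventually_nhds _ (prodTop X Y) _ _).2 h,
      prod_ne_zero hU hV xU xV hQ hx] with y h1 h2
    exact ⟨U, V, P, Q, hU, hV, h2.1, h2.2.1, hP, hQ, h2.2.2, h1⟩
  const c x := ⟨univ, univ, fun _ => c, 1, isOpen_univ, isOpen_univ, trivial, trivial,
    Subalgebra.algebraMap_mem _ c, one_mem _, by simp, by simp⟩
  add := by
    rintro f g x ⟨U, V, P, Q, hU, hV, xU, xV, hP, hQ, hx, h⟩
      ⟨U', V', P', Q', hU', hV', xU', xV', hP', hQ', hx', h'⟩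
    have m1 := tensorFun_mono X Y (U := U) (V := V) (U' := U ∩ U') (V' := V ∩ V')
      inter_subset_left inter_subset_left
    have m2 := tensorFun_mono X Y (U := U') (V := V') (U' := U ∩ U') (V' := V ∩ V')
      inter_subset_right inter_subset_right
    refine ⟨U ∩ U', V ∩ V', P * Q' + Q * P', Q * Q', hU.inter hU', hV.inter hV', ⟨xU, xU'⟩,
      ⟨xV, xV'⟩, add_mem (mul_mem (m1 hP) (m2 hQ')) (mul_mem (m1 hQ) (m2 hP')),
      mul_mem (m1 hQ) (m2 hQ'), mul_ne_zero hx hx', ?_⟩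
    filter_upwards [h, h', prod_ne_zero hU hV xU xV hQ hx,
      prod_ne_zero hU' hV' xU' xV' hQ' hx'] with y h1 h2 h3 h4
    simp [h1, h2, div_add_div _ _ h3.2.2 h4.2.2]
  mul := by
    rintro f g x ⟨U, V, P, Q, hU, hV, xU, xV, hP, hQ, hx, h⟩
      ⟨U', V', P', Q', hU', hV', xU', xV', hP', hQ', hx', h'⟩
    have m1 := tensorFun_mono X Y (U := U) (V := V) (U' := U ∩ U') (V' := V ∩ V')
      inter_subset_left inter_subset_left
    have m2 := tensorFun_mono X Y (U := U') (V := V') (U' := U ∩ U') (V' := V ∩ V')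
      inter_subset_right inter_subset_right
    refine ⟨U ∩ U', V ∩ V', P * P', Q * Q', hU.inter hU', hV.inter hV', ⟨xU, xU'⟩,
      ⟨xV, xV'⟩, mul_mem (m1 hP) (m2 hP'),
      mul_mem (m1 hQ) (m2 hQ'), mul_ne_zero hx hx', ?_⟩
    filter_upwards [h, h'] with y h1 h2
    simp [h1, h2, div_mul_div_comm]
  ne_zero := by
    rintro f x ⟨U, V, P, Q, hU, hV, xU, xV, hP, hQ, hx, h⟩ hf
    have hPx : P x ≠ 0 := by
      rw [@Eventually.self_of_nhds _ (prodTop X Y) _ _ h] at hf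
      exact (div_ne_zero_iff.1 hf).1
    filter_upwards [h, prod_ne_zero hU hV xU xV hQ hx, prod_ne_zero hU hV xU xV hP hPx]
      with y h1 h2 h3
    rw [h1]
    exact div_ne_zero h3.2.2 h2.2.2
  inv := by
    rintro f x ⟨U, V, P, Q, hU, hV, xU, xV, hP, hQ, hx, h⟩ hf
    have hPx : P x ≠ 0 := by
      rw [@Eventually.self_of_nhds _ (prodTop X Y) _ _ h] at hf
      exact (div_ne_zero_iff.1 hf).1
    refine ⟨U, V, Q, P, hU, hV, xU, xV, hQ, hP, hPx, ?_⟩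
    filter_upwards [h] with y h1
    simp [h1]

/-! ### Varieties -/

/-- An affine variety: isomorphic to a Zariski closed subset of some affine space. -/
def KSpace.IsAffine (X : KSpace k) : Prop :=
  ∃ (m : ℕ) (Z : Set (affineSpace k m)), IsClosed Z ∧ Isomorphic X ((affineSpace k m).sub Z)

/-- An algebraic variety over `k` (not necessarily irreducible): a separated space with functions
with a finite cover by affine open subsets. -/
structure KSpace.IsVariety (X : KSpace k) : Prop where
  exists_cover : ∃ S : Set (Set X), S.Finite ∧ ⋃₀ S = univ ∧
    ∀ U ∈ S, IsOpen U ∧ (X.sub U).IsAffine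
  separated : IsClosed {p : X.prod X | p.1 = p.2}

/-! ## Birational transformations -/

/-- An isomorphism between two dense open subsets of `X`. -/
structure PartialIso (X : KSpace k) extends OpenPartialHomeomorph X X where
  dense_source : Dense source
  dense_target : Dense target
  morphism : ∀ x ∈ source, IsMorphismAt (toFun : X → X) x
  morphism_symm : ∀ x ∈ target, IsMorphismAt (invFun : X → X) x

theorem dense_inter_preimage {X : Type*} [TopologicalSpace X] (e : OpenPartialHomeomorph X X)
    (he : Dense e.source) {T : Set X} (hT : Dense T) : Dense (e.source ∩ e ⁻¹' T) := by
  rw [dense_iff_inter_open]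
  intro O hO hne
  obtain ⟨x, hxO, hxe⟩ := he.inter_open_nonempty O hO hne
  obtain ⟨y, ⟨z, hz, rfl⟩, hy⟩ := hT.inter_open_nonempty (e '' (O ∩ e.source))
    (e.isOpen_image_of_subset_source (hO.inter e.open_source) inter_subset_right)
    ⟨e x, x, ⟨hxO, hxe⟩, rfl⟩
  exact ⟨z, hz.1, hz.2, hy⟩

namespace PartialIso

variable {X : KSpace k}

/-- The identity. -/
def refl (X : KSpace k) : PartialIso X where
  toOpenPartialHomeomorph := OpenPartialHomeomorph.refl X
  dense_source := dense_univ
  dense_target := dense_univ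
  morphism x _ := IsMorphismAt.id x
  morphism_symm x _ := IsMorphismAt.id x

/-- The inverse. -/
def symm (e : PartialIso X) : PartialIso X where
  toOpenPartialHomeomorph := e.toOpenPartialHomeomorph.symm
  dense_source := e.dense_target
  dense_target := e.dense_source
  morphism := e.morphism_symm
  morphism_symm := e.morphism

/-- The composition `e'` after `e`, defined where it makes sense. -/
def trans (e e' : PartialIso X) : PartialIso X where
  toOpenPartialHomeomorph := e.toOpenPartialHomeomorph.trans e'.toOpenPartialHomeomorph
  dense_source := dense_inter_preimage e.toOpenPartialHomeomorph e.dense_source e'.dense_source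
  dense_target :=
    dense_inter_preimage e'.toOpenPartialHomeomorph.symm e'.dense_target e.dense_target
  morphism x hx := (e'.morphism _ hx.2).comp (e.morphism x hx.1)
  morphism_symm x hx := (e.morphism_symm _ hx.2).comp (e'.morphism_symm x hx.1)

/-- Two isomorphisms between dense open subsets define the same birational transformation when they
agree on a dense open subset. -/
def Equiv (e e' : PartialIso X) : Prop :=
  ∃ W : Set X, IsOpen W ∧ Dense W ∧ W ⊆ e.source ∧ W ⊆ e'.source ∧ EqOn e.toFun e'.toFun W

theorem equiv_refl (e : PartialIso X) : e.Equiv e :=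
  ⟨e.source, e.open_source, e.dense_source, subset_rfl, subset_rfl, fun _ _ => rfl⟩

theorem equiv_equivalence : Equivalence (Equiv (X := X)) where
  refl := equiv_refl
  symm := fun ⟨W, h1, h2, h3, h4, h5⟩ => ⟨W, h1, h2, h4, h3, h5.symm⟩
  trans := fun ⟨W, h1, h2, h3, _, h5⟩ ⟨W', h1', h2', _, h4', h5'⟩ =>
    ⟨W ∩ W', h1.inter h1', h2.inter_of_isOpen_left h2' h1, inter_subset_left.trans h3,
      inter_subset_right.trans h4', fun _ hx => (h5 hx.1).trans (h5' hx.2)⟩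

instance setoid (X : KSpace k) : Setoid (PartialIso X) := ⟨Equiv, equiv_equivalence⟩

theorem equiv_symm {e e' : PartialIso X} (h : e.Equiv e') : e.symm.Equiv e'.symm := by
  obtain ⟨W, h1, h2, h3, h4, h5⟩ := h
  refine ⟨e.target ∩ e.invFun ⁻¹' W, e.toOpenPartialHomeomorph.symm.isOpen_inter_preimage h1,
    dense_inter_preimage e.toOpenPartialHomeomorph.symm e.dense_target h2, inter_subset_left,
    ?_, ?_⟩
  · rintro y ⟨hy, hyW⟩
    have h6 := h5 hyW
    rw [e.right_inv' hy] at h6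
    rw [h6]
    exact e'.map_source' (h4 hyW)
  · rintro y ⟨hy, hyW⟩
    have h6 := h5 hyW
    rw [e.right_inv' hy] at h6
    change e.invFun y = e'.invFun y
    conv_rhs => rw [h6]
    exact (e'.left_inv' (h4 hyW)).symm

theorem equiv_trans {e₁ e₁' e₂ e₂' : PartialIso X} (h : e₁.Equiv e₁') (h' : e₂.Equiv e₂') :
    (e₁.trans e₂).Equiv (e₁'.trans e₂') := by
  obtain ⟨W, h1, h2, h3, h4, h5⟩ := h
  obtain ⟨W', h1', h2', h3', h4', h5'⟩ := h'
  refine ⟨W ∩ (e₁.source ∩ e₁.toFun ⁻¹' W'),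
    h1.inter (e₁.toOpenPartialHomeomorph.isOpen_inter_preimage h1'),
    h2.inter_of_isOpen_left
      (dense_inter_preimage e₁.toOpenPartialHomeomorph e₁.dense_source h2') h1, ?_, ?_, ?_⟩
  · rintro x ⟨_, hx2, hx3⟩
    exact ⟨hx2, h3' hx3⟩
  · rintro x ⟨hx1, _, hx3⟩
    refine ⟨h4 hx1, ?_⟩
    have h6 := h5 hx1
    change e₁'.toFun x ∈ e₂'.source
    rw [← h6]
    exact h4' hx3
  · rintro x ⟨hx1, _, hx3⟩
    change e₂.toFun (e₁.toFun x) = e₂'.toFun (e₁'.toFun x)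
    rw [← h5 hx1]
    exact h5' hx3

end PartialIso

/-- The set `Bir(X)` of birational transformations of `X`. -/
def Bir (X : KSpace k) : Type u := Quotient (PartialIso.setoid X)

/-- The birational transformation defined by an isomorphism between dense open subsets. -/
def Bir.mk {X : KSpace k} (e : PartialIso X) : Bir X := Quotient.mk _ e

/-- The group law of `Bir(X)` is the composition: `(f * g)(x) = f (g x)` for general `x`. -/
instance (X : KSpace k) : Group (Bir X) where
  mul := Quotient.map₂ (fun f g => g.trans f) (fun _ _ h _ _ h' => PartialIso.equiv_trans h' h)
  one := Bir.mk (PartialIso.refl X)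
  inv := Quotient.map PartialIso.symm (fun _ _ h => PartialIso.equiv_symm h)
  mul_assoc := by
    rintro ⟨a⟩ ⟨b⟩ ⟨c⟩
    refine Quotient.sound ⟨(c.trans (b.trans a)).source, (c.trans (b.trans a)).open_source,
      (c.trans (b.trans a)).dense_source, subset_rfl, ?_, fun _ _ => rfl⟩
    rintro x ⟨h1, h2, h3⟩
    exact ⟨⟨h1, h2⟩, h3⟩
  one_mul := by
    rintro ⟨a⟩
    exact Quotient.sound ⟨a.source, a.open_source, a.dense_source, fun x hx => ⟨hx, trivial⟩,
      subset_rfl, fun _ _ => rfl⟩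
  mul_one := by
    rintro ⟨a⟩
    exact Quotient.sound ⟨a.source, a.open_source, a.dense_source, fun x hx => ⟨trivial, hx⟩,
      subset_rfl, fun _ _ => rfl⟩
  inv_mul_cancel := by
    rintro ⟨a⟩
    exact Quotient.sound ⟨a.source, a.open_source, a.dense_source,
      fun x hx => ⟨hx, a.map_source' hx⟩, subset_univ _, fun x hx => a.left_inv' hx⟩

/-- `Aut(X)` inside `Bir(X)`: the transformations defined by an isomorphism from `X` onto `X`. -/
def aut (X : KSpace k) : Subgroup (Bir X) where
  carrier := {θ | ∃ e : PartialIso X, Bir.mk e = θ ∧ e.source = univ ∧ e.target = univ}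
  one_mem' := ⟨PartialIso.refl X, rfl, rfl, rfl⟩
  mul_mem' := by
    rintro _ _ ⟨e, rfl, h1, h2⟩ ⟨e', rfl, h1', h2'⟩
    refine ⟨e'.trans e, rfl, ?_, ?_⟩
    · change e'.source ∩ e'.toFun ⁻¹' e.source = univ
      rw [h1, h1', preimage_univ, inter_univ]
    · change e.target ∩ e.invFun ⁻¹' e'.target = univ
      rw [h2, h2', preimage_univ, inter_univ]
  inv_mem' := by
    rintro _ ⟨e, rfl, h1, h2⟩
    exact ⟨e.symm, rfl, h2, h1⟩

/-! ## The Zariski topology of `Bir(X)` -/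

/-- A map `θ : A → Bir(X)` is a morphism when it comes from an algebraic family: a rational map
`f` from `A × X` to `X`, defined on a dense open subset `U`, such that for all `a` the slice `U_a`
is a dense open subset of `X` and `x ↦ f (a, x)` is an isomorphism from `U_a` onto a dense open
subset of `X`, which represents `θ a`. -/
def IsFamily {A X : KSpace k} (θ : A → Bir X) : Prop :=
  ∃ (f : A.prod X → X) (U : Set (A.prod X)), IsOpen U ∧ Dense U ∧
    (∀ p ∈ U, IsMorphismAt f p) ∧
    ∀ a : A, ∃ e : PartialIso X, e.source = {x : X | ((a, x) : A × X) ∈ U} ∧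
      (∀ x ∈ e.source, e.toFun x = f ((a, x) : A × X)) ∧ Bir.mk e = θ a

/-- The Zariski topology on `Bir(X)`: a subset is closed when its preimage under each morphism from
a variety `A` to `Bir(X)` is closed in `A`. -/
instance zariski (X : KSpace k) : TopologicalSpace (Bir X) :=
  TopologicalSpace.ofClosed
    {R | ∀ (A : KSpace k), A.IsVariety → ∀ θ : A → Bir X, IsFamily θ → IsClosed (θ ⁻¹' R)}
    (fun _ _ _ _ => by simp)
    (fun S hS A hA θ hθ => by
      rw [preimage_sInter]
      exact isClosed_biInter fun R hR => hS hR A hA θ hθ)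
    (fun R hR R' hR' A hA θ hθ => (hR A hA θ hθ).union (hR' A hA θ hθ))

theorem isClosed_iff {X : KSpace k} {R : Set (Bir X)} : IsClosed R ↔
    ∀ (A : KSpace k), A.IsVariety → ∀ θ : A → Bir X, IsFamily θ → IsClosed (θ ⁻¹' R) := by
  rw [← isOpen_compl_iff]
  change Rᶜᶜ ∈ _ ↔ _
  rw [compl_compl]
  rfl

/-! ## The Cremona group -/

/-- The Cremona group of birational transformations of the projective space of dimension `n`. -/
abbrev Cr (n : ℕ) (k : Type u) [Field k] : Type u := Bir (projectiveSpace k n)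

/-- The point of the projective space with homogeneous coordinates `v`. -/
def pt {n : ℕ} (v : Fin (n + 1) → k) (hv : v ≠ 0) : projectiveSpace k n :=
  Projectivization.mk k v hv

/-- `θ` is the automorphism `[v] ↦ [M v]`. -/
def IsLinear {n : ℕ} (M : Matrix (Fin (n + 1)) (Fin (n + 1)) k) (θ : Cr n k) : Prop :=
  ∃ e : PartialIso (projectiveSpace k n), Bir.mk e = θ ∧ e.source = univ ∧
    ∀ v (hv : v ≠ 0), ∃ hw : M.mulVec v ≠ 0, e.toFun (pt v hv) = pt (M.mulVec v) hw

/-- The group `J_n^0` of the transformations that preserve a general fibre of the projection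
`φ : (x_0 : … : x_n) ⇢ (x_1 : … : x_n)`, that is, of the `θ` with `φ ∘ θ = φ` on a dense open
subset: general points `[v]` are sent to points `[w]` with the same last `n` coordinates. -/
def J0 (n : ℕ) (k : Type u) [Field k] : Set (Cr n k) :=
  {θ | ∃ (e : PartialIso (projectiveSpace k n)) (W : Set (projectiveSpace k n)),
    Bir.mk e = θ ∧ IsOpen W ∧ Dense W ∧ W ⊆ e.source ∧
    ∀ v (hv : v ≠ 0), pt v hv ∈ W →
      ∃ (w : Fin (n + 1) → k) (hw : w ≠ 0), (∀ i, i ≠ 0 → w i = v i) ∧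
        e.toFun (pt v hv) = pt w hw}

/-- The field of rational functions `K = k(x_1, …, x_{n-1})`. -/
abbrev RatFun (n : ℕ) (k : Type u) [Field k] : Type u :=
  FractionRing (MvPolynomial (Fin (n - 1)) k)

/-- In the chart `x_n = 1`, with `y = (x_1, …, x_{n-1})`, and for a matrix `P` of polynomials
`a, b, c, d` in `y`: homogeneous coordinates of the point
`((a(y) x_0 + b(y)) / (c(y) x_0 + d(y)), y)`. -/
def moebiusVec {n : ℕ} (P : Matrix (Fin 2) (Fin 2) (MvPolynomial (Fin (n - 1)) k))
    (v : Fin (n + 1) → k) : Fin (n + 1) → k :=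
  let y : Fin (n - 1) → k := fun j => v ⟨j + 1, by omega⟩
  fun i => if i = 0 then MvPolynomial.eval y (P 0 0) * v 0 + MvPolynomial.eval y (P 0 1)
    else (MvPolynomial.eval y (P 1 0) * v 0 + MvPolynomial.eval y (P 1 1)) * v i

/-- For an invertible matrix `M` with entries `a, b, c, d` in `K = k(x_1, …, x_{n-1})`: in the
chart `x_n = 1`, `θ` is the transformation
`(x_0, y) ⇢ ((a(y) x_0 + b(y)) / (c(y) x_0 + d(y)), y)`, with `y = (x_1, …, x_{n-1})`.
Since `M` only matters up to a scalar, the denominators of its entries are cleared. -/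
def IsMoebius {n : ℕ} (M : Matrix (Fin 2) (Fin 2) (RatFun n k)) (θ : Cr n k) : Prop :=
  ∃ (P : Matrix (Fin 2) (Fin 2) (MvPolynomial (Fin (n - 1)) k)) (r : RatFun n k)
    (e : PartialIso (projectiveSpace k n)) (W : Set (projectiveSpace k n)),
    r ≠ 0 ∧ P.map (algebraMap _ (RatFun n k)) = r • M ∧
    Bir.mk e = θ ∧ IsOpen W ∧ Dense W ∧ W ⊆ e.source ∧
    ∀ v (hv : v ≠ 0), v (Fin.last n) = 1 → pt v hv ∈ W →
      ∃ hw : moebiusVec P v ≠ 0, e.toFun (pt v hv) = pt (moebiusVec P v) hw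

/-- The subgroup `J_n^1` of `J_n^0`, the kernel of the determinant
`J_n^0 ≃ PGL(2, K) → K^* / (K^*)^2`. -/
def J1 (n : ℕ) (k : Type u) [Field k] : Set (Cr n k) :=
  {θ | θ ∈ J0 n k ∧ ∃ M : Matrix.GeneralLinearGroup (Fin 2) (RatFun n k),
    IsMoebius (n := n) M.1 θ ∧ IsSquare M.1.det}

end Cremona

end

noncomputable section

namespace Cremona

/-! ## Vectors of polynomials -/

open MvPolynomial

/-! Take `θ ≠ 1` in the closed normal subgroup `N`. After a linear conjugation, `θ⁻¹` is defined at
`e_0`, is a local isomorphism there, and sends `e_0` to another coordinate point `e_a`. Let `α_t = 1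
+ t E_{0a}` and `h_t = diag(1, t, …, t)`. The map `θ α_t θ⁻¹` moves `e_0` to first order in `t`, and
conjugating by `h_t` magnifies a neighbourhood of `e_0` at the same rate. Hence `h_t⁻¹ θ α_t θ⁻¹
h_t` extends to `t = 0`, where it becomes the linear translation `v ↦ v + v_0 w`. The vector `w` is
the derivative of `θ` at `e_a` in the direction `e_0`, up to a scalar and modulo `e_0`, so it is
nonzero (`tangent_ne_zero`).

The factor `h_t⁻¹ α_t⁻¹ h_t = 1 - t² E_{0a}` tends to the identity. The conjugated commutators
`h_t⁻¹ (θ α_t θ⁻¹ α_t⁻¹) h_t`, which lie in `N` for `t ≠ 0`, therefore have the same limit. Since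
`N` is closed, it contains the translation (`exists_shear_mem`). A commutator with an elementary
matrix turns the translation into an elementary matrix; this needs a third index, hence `n ≥ 2`. A
normal subgroup of `GL` containing a nontrivial elementary matrix contains `SL`
(`toGL_mem_of_elem_mem`). Over an algebraically closed field `SL` maps onto `PGL`, and `PGL` is all
of `Aut(ℙ^n)` (`exists_lin_eq`).

For `J^1`, the translation `x_0 ↦ x_0 + x_n` is both linear and the image of an elementary matrix of
`GL(2, K)` (`moebius_elem`). The preimage of `N` in `GL(2, K)` is thus a normal subgroup containing
an elementary matrix, and it contains `SL(2, K)` by the same lemma.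

All of this is carried out with vectors of homogeneous polynomials. A transformation is handled
through vectors giving it at general points (`Represents`), and equality of transformations becomes
the vanishing of `2 × 2` minors. A vector with coefficients in `k[t]` defines a morphism from the
affine line as soon as the inverses are given in the same way (`isFamily_of_represents`). -/

/-- Vectors of `n + 1` polynomials in `n + 1` variables. -/
abbrev PolyVec (n : ℕ) (R : Type*) [CommRing R] := Fin (n + 1) → MvPolynomial (Fin (n + 1)) R

namespace PolyVec

variable {n : ℕ} {R : Type*} [CommRing R]

/-- The map of `R ^ (n + 1)` defined by a vector of polynomials. -/
def ev (G : PolyVec n R) (v : Fin (n + 1) → R) : Fin (n + 1) → R := fun i => eval v (G i)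

theorem ev_apply (G : PolyVec n R) (v : Fin (n + 1) → R) (i : Fin (n + 1)) :
    G.ev v i = eval v (G i) := rfl

/-- Substitution: `comp G H` is `G ∘ H`. -/
def comp (G H : PolyVec n R) : PolyVec n R := fun i => bind₁ H (G i)

theorem eval_bind₁ (P : MvPolynomial (Fin (n + 1)) R) (H : PolyVec n R) (v : Fin (n + 1) → R) :
    eval v (bind₁ H P) = eval (H.ev v) P := by
  rw [← MvPolynomial.coe_aeval_eq_eval, ← MvPolynomial.coe_aeval_eq_eval]
  change aeval v (bind₁ H P) = aeval (H.ev v) P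
  rw [aeval_bind₁]
  rfl

theorem ev_comp (G H : PolyVec n R) (v : Fin (n + 1) → R) : (G.comp H).ev v = G.ev (H.ev v) := by
  funext i
  exact eval_bind₁ _ _ _

/-- All components are homogeneous of degree `d`. -/
def Homog (G : PolyVec n R) (d : ℕ) : Prop := ∀ i, (G i).IsHomogeneous d

theorem Homog.comp {G H : PolyVec n R} {d d' : ℕ} (hG : G.Homog d) (hH : H.Homog d') :
    (G.comp H).Homog (d' * d) := fun i => (hG i).aeval _ hH

end PolyVec

theorem aeval_smul_of_isHomogeneous {σ R A : Type*} [CommRing R] [CommRing A] [Algebra R A]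
    {F : MvPolynomial σ R} {d : ℕ} (hF : F.IsHomogeneous d) (a : A) (v : σ → A) :
    aeval (a • v) F = a ^ d * aeval v F := by
  rw [aeval_def, aeval_def, eval₂_eq, eval₂_eq, Finset.mul_sum]
  refine Finset.sum_congr rfl fun m hm => ?_
  have hd : ∑ i ∈ m.support, m i = d := (hF.degree_eq_sum_deg_support hm).symm
  simp only [Pi.smul_apply, smul_eq_mul, mul_pow, Finset.prod_mul_distrib, Finset.prod_pow_eq_pow_sum,
    hd]
  ring

theorem eval_smul_of_isHomogeneous {σ R : Type*} [CommRing R]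
    {F : MvPolynomial σ R} {d : ℕ} (hF : F.IsHomogeneous d) (a : R) (v : σ → R) :
    eval (a • v) F = a ^ d * eval v F := aeval_smul_of_isHomogeneous hF a v

theorem PolyVec.Homog.ev_smul {n : ℕ} {R : Type*} [CommRing R] {G : PolyVec n R} {d : ℕ}
    (hG : G.Homog d) (a : R) (v : Fin (n + 1) → R) : G.ev (a • v) = a ^ d • G.ev v := by
  funext i
  exact eval_smul_of_isHomogeneous (hG i) a v

/-- A vector of polynomials proportional to the vector of the variables is a multiple of it. -/
theorem exists_eq_mul_X {n : ℕ} {R : Type*} [CommRing R] [IsDomain R] (hn : 1 ≤ n)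
    {P : PolyVec n R} (h : ∀ i j, X i * P j = X j * P i) : ∃ c, ∀ i, P i = c * X i := by
  -- `X i` divides `X j * P i` by the proportionality, with `X i` prime and not dividing `X j`. At
  -- least two variables are needed here.
  have hdvd : ∀ i, (X i : MvPolynomial (Fin (n + 1)) R) ∣ P i := by
    intro i
    obtain ⟨j, hj⟩ : ∃ j : Fin (n + 1), j ≠ i := by
      have : Nontrivial (Fin (n + 1)) := Fin.nontrivial_iff_two_le.2 (by omega)
      exact exists_ne i
    have h1 : (X i : MvPolynomial (Fin (n + 1)) R) ∣ X j * P i := ⟨P j, (h i j).symm⟩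
    refine ((X_prime (R := R)).dvd_or_dvd h1).resolve_left fun h2 => ?_
    rw [X_dvd_X] at h2
    exact hj h2.symm
  choose c hc using hdvd
  refine ⟨c 0, fun i => ?_⟩
  have h1 := h 0 i
  rw [hc i, hc 0] at h1
  have h2 : (X 0 * X i : MvPolynomial (Fin (n + 1)) R) * (c i - c 0) = 0 := by linear_combination h1
  have h3 := (mul_eq_zero.1 h2).resolve_left
    (mul_ne_zero (X_prime (R := R)).ne_zero (X_prime (R := R)).ne_zero)
  rw [hc i, sub_eq_zero.1 h3, mul_comm]

theorem isHomogeneous_of_mul_X {σ R : Type*} [CommRing R] {c : MvPolynomial σ R} {i : σ} {d : ℕ}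
    (h : (c * X i).IsHomogeneous (d + 1)) : c.IsHomogeneous d := by
  intro m hm
  have h1 := @h (m + Finsupp.single i 1) (by rwa [coeff_mul_X])
  rw [map_add] at h1
  simp only [Finsupp.weight_single, Pi.one_apply, smul_eq_mul, mul_one] at h1
  omega

theorem isHomogeneous_of_C_mul {σ R : Type*} [CommRing R] [IsDomain R] {c : MvPolynomial σ R}
    {a : R} (ha : a ≠ 0) {d : ℕ} (h : (C a * c).IsHomogeneous d) : c.IsHomogeneous d := by
  intro m hm
  exact h (by rw [coeff_C_mul]; exact mul_ne_zero ha hm)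

theorem exists_eval_ne_zero_of_ne_zero {σ k : Type*} [Field k] [Infinite k]
    {F : MvPolynomial σ k} (hF : F ≠ 0) : ∃ v, eval v F ≠ 0 := by
  by_contra! h
  exact hF (MvPolynomial.funext fun v => by simp [h v])

end Cremona
end

noncomputable section

namespace Cremona

open MvPolynomial

variable {k : Type u} [Field k]

/-! ## The Zariski topology of the projective space -/

section Projective

variable {n : ℕ}

/-- Homogeneous coordinates of a point. -/
def rep (p : projectiveSpace k n) : Fin (n + 1) → k := Projectivization.rep p

theorem rep_ne_zero (p : projectiveSpace k n) : rep p ≠ 0 := Projectivization.rep_nonzero p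

/-- The locus where a homogeneous polynomial does not vanish. -/
def nonvanishing (F : MvPolynomial (Fin (n + 1)) k) : Set (projectiveSpace k n) :=
  {p | eval (rep p) F ≠ 0}

theorem pt_rep (p : projectiveSpace k n) :
    pt (rep p) (rep_ne_zero p) = p :=
  Projectivization.mk_rep p

theorem exists_eq_pt (p : projectiveSpace k n) : ∃ v, ∃ hv : v ≠ 0, p = pt v hv :=
  ⟨_, _, (pt_rep p).symm⟩

theorem exists_rep_pt_eq_smul (v : Fin (n + 1) → k) (hv : v ≠ 0) :
    ∃ a : k, a ≠ 0 ∧ rep (pt v hv) = a • v := by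
  obtain ⟨a, ha⟩ := Projectivization.exists_smul_eq_mk_rep k v hv
  exact ⟨a, a.ne_zero, ha.symm⟩

theorem pt_eq_pt_iff {v w : Fin (n + 1) → k} {hv : v ≠ 0} {hw : w ≠ 0} :
    pt v hv = pt w hw ↔ ∃ a : k, a ≠ 0 ∧ v = a • w := by
  refine (Projectivization.mk_eq_mk_iff' k v w hv hw).trans
    ⟨fun ⟨a, ha⟩ => ⟨a, ?_, ha.symm⟩, fun ⟨a, _, ha⟩ => ⟨a, ha.symm⟩⟩
  rintro rfl
  exact hv (by rw [← ha, zero_smul])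

/-- The `2 × 2` minors are polynomial in the coordinates, so this criterion reduces equality of
transformations to polynomial identities. -/
theorem pt_eq_pt_of_cross {v w : Fin (n + 1) → k} {hv : v ≠ 0} {hw : w ≠ 0}
    (h : ∀ i j, v i * w j = v j * w i) : pt v hv = pt w hw := by
  obtain ⟨i, hi⟩ := Function.ne_iff.1 hw
  simp only [Pi.zero_apply] at hi
  have hvw : v = (v i / w i) • w := by
    funext j
    have h1 := h i j
    simp only [Pi.smul_apply, smul_eq_mul]
    field_simp
    linear_combination -h1
  refine pt_eq_pt_iff.2 ⟨v i / w i, ?_, hvw⟩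
  intro h0
  exact hv (by rw [hvw, h0, zero_smul])

theorem cross_of_pt_eq_pt {v w : Fin (n + 1) → k} {hv : v ≠ 0} {hw : w ≠ 0}
    (h : pt v hv = pt w hw) (i j : Fin (n + 1)) : v i * w j = v j * w i := by
  obtain ⟨a, _, rfl⟩ := pt_eq_pt_iff.1 h
  simp only [Pi.smul_apply, smul_eq_mul]
  ring

theorem pt_congr {v w : Fin (n + 1) → k} (hv : v ≠ 0) (h : v = w) : pt v hv = pt w (h ▸ hv) := by
  subst h
  rfl

theorem pt_mem_nonvanishing {F : MvPolynomial (Fin (n + 1)) k} {d : ℕ} (hF : F.IsHomogeneous d)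
    {v : Fin (n + 1) → k} {hv : v ≠ 0} : pt v hv ∈ nonvanishing F ↔ eval v F ≠ 0 := by
  obtain ⟨a, ha, h⟩ := exists_rep_pt_eq_smul v hv
  change eval (rep (pt v hv)) F ≠ 0 ↔ _
  rw [h, eval_smul_of_isHomogeneous hF]
  simp [ha]

theorem isOpen_nonvanishing {F : MvPolynomial (Fin (n + 1)) k} {d : ℕ} (hF : F.IsHomogeneous d) :
    IsOpen (nonvanishing F) :=
  TopologicalSpace.isOpen_generateFrom_of_mem ⟨d, F, hF, rfl⟩

/-- Products of homogeneous polynomials are homogeneous, so the generating sets are stable under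
finite intersections and form a basis. -/
theorem exists_nonvanishing_subset {U : Set (projectiveSpace k n)} (hU : IsOpen U)
    {p : projectiveSpace k n} (hp : p ∈ U) :
    ∃ (d : ℕ) (F : MvPolynomial (Fin (n + 1)) k), F.IsHomogeneous d ∧ p ∈ nonvanishing F ∧
      nonvanishing F ⊆ U := by
  induction hU with
  | basic s hs =>
    obtain ⟨d, F, hF, rfl⟩ := hs
    exact ⟨d, F, hF, hp, subset_rfl⟩
  | univ => exact ⟨0, 1, isHomogeneous_one _ _, by simp [nonvanishing], subset_univ _⟩
  | inter s t _ _ hs ht =>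
    obtain ⟨d, F, hF, hpF, hFs⟩ := hs hp.1
    obtain ⟨d', F', hF', hpF', hFs'⟩ := ht hp.2
    refine ⟨d + d', F * F', hF.mul hF', ?_, fun q hq => ?_⟩
    · simp only [nonvanishing, mem_ofPred_eq, map_mul] at hpF hpF' ⊢
      exact mul_ne_zero hpF hpF'
    · simp only [nonvanishing, mem_ofPred_eq, map_mul, mul_ne_zero_iff] at hq
      exact ⟨hFs hq.1, hFs' hq.2⟩
  | sUnion S _ ih =>
    obtain ⟨s, hs, hps⟩ := hp
    obtain ⟨d, F, hF, hpF, hFs⟩ := ih s hs hps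
    exact ⟨d, F, hF, hpF, hFs.trans (subset_sUnion_of_mem hs)⟩

theorem ne_zero_of_mem_nonvanishing {F : MvPolynomial (Fin (n + 1)) k} {p : projectiveSpace k n}
    (h : p ∈ nonvanishing F) : F ≠ 0 := by
  rintro rfl
  simp [nonvanishing] at h

theorem nonvanishing_nonempty [Infinite k] {F : MvPolynomial (Fin (n + 1)) k} {d : ℕ}
    (hF : F.IsHomogeneous d) (h0 : F ≠ 0) : (nonvanishing F).Nonempty := by
  -- The factor `X 0` forces the vector `v` to be nonzero, so that it defines a point.
  obtain ⟨v, hv⟩ := exists_eval_ne_zero_of_ne_zero (mul_ne_zero h0 (X_ne_zero (R := k) 0))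
  simp only [map_mul, eval_X, mul_ne_zero_iff] at hv
  exact ⟨pt v fun h => hv.2 (by simp [h]), (pt_mem_nonvanishing hF).2 hv.1⟩

/-- This is the irreducibility of the projective space: a product of nonzero polynomials is nonzero,
so two nonempty basic open sets meet. -/
theorem dense_nonvanishing [Infinite k] {F : MvPolynomial (Fin (n + 1)) k} {d : ℕ}
    (hF : F.IsHomogeneous d) (h0 : F ≠ 0) : Dense (nonvanishing F) := by
  rw [dense_iff_inter_open]
  rintro U hU ⟨p, hp⟩
  obtain ⟨d', F', hF', hpF', hFU⟩ := exists_nonvanishing_subset hU hp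
  obtain ⟨q, hq⟩ := nonvanishing_nonempty (hF'.mul hF)
    (mul_ne_zero (ne_zero_of_mem_nonvanishing hpF') h0)
  simp only [nonvanishing, mem_ofPred_eq, map_mul, mul_ne_zero_iff] at hq
  exact ⟨q, hFU hq.1, hq.2⟩

theorem exists_nonvanishing_subset_of_dense {U : Set (projectiveSpace k n)} (hU : IsOpen U)
    (hd : Dense U) : ∃ (d : ℕ) (F : MvPolynomial (Fin (n + 1)) k), F.IsHomogeneous d ∧ F ≠ 0 ∧
      nonvanishing F ⊆ U := by
  have : Nonempty (projectiveSpace k n) := ⟨pt (fun _ => 1) fun h => one_ne_zero (congrFun h 0)⟩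
  obtain ⟨p, hp⟩ := hd.nonempty
  obtain ⟨d, F, hF, hpF, hFU⟩ := exists_nonvanishing_subset hU hp
  exact ⟨d, F, hF, ne_zero_of_mem_nonvanishing hpF, hFU⟩

theorem exists_rep_ne_zero (p : projectiveSpace k n) :
    ∃ i, rep p i ≠ 0 :=
  Function.ne_iff.1 (rep_ne_zero p)

theorem regularAt_iff {f : projectiveSpace k n → k} {p : projectiveSpace k n} :
    (projectiveSpace k n).RegularAt f p ↔ ∃ (d : ℕ) (P Q : MvPolynomial (Fin (n + 1)) k),
      P.IsHomogeneous d ∧ Q.IsHomogeneous d ∧ p ∈ nonvanishing Q ∧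
      ∀ᶠ q in 𝓝 p, f q = eval (rep q) P / eval (rep q) Q := Iff.rfl

theorem regularAt_div {P Q : MvPolynomial (Fin (n + 1)) k} {d : ℕ} (hP : P.IsHomogeneous d)
    (hQ : Q.IsHomogeneous d) {p : projectiveSpace k n} (hp : p ∈ nonvanishing Q) :
    (projectiveSpace k n).RegularAt
      (fun q => eval (rep q) P / eval (rep q) Q) p :=
  ⟨d, P, Q, hP, hQ, hp, Eventually.of_forall fun _ => rfl⟩

/-- The map of the projective space defined by a vector of polynomials (the identity at the points
where it vanishes). -/
def mapOf (G : PolyVec n k) (p : projectiveSpace k n) : projectiveSpace k n :=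
  open Classical in
  if h : G.ev (rep p) ≠ 0 then pt (G.ev (rep p)) h else p

theorem mapOf_eq {G : PolyVec n k} {p : projectiveSpace k n}
    (h : G.ev (rep p) ≠ 0) : mapOf G p = pt _ h := dif_pos h

theorem PolyVec.Homog.ev_ne_zero {G : PolyVec n k} {d : ℕ} (hG : G.Homog d)
    {a : k} (ha : a ≠ 0) {v : Fin (n + 1) → k} (h : G.ev v ≠ 0) : G.ev (a • v) ≠ 0 := by
  rw [hG.ev_smul]
  exact smul_ne_zero (pow_ne_zero _ ha) h

theorem mapOf_pt {G : PolyVec n k} {d : ℕ} (hG : G.Homog d) {v : Fin (n + 1) → k} (hv : v ≠ 0)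
    (h : G.ev v ≠ 0) : mapOf G (pt v hv) = pt (G.ev v) h := by
  obtain ⟨a, ha, hr⟩ := exists_rep_pt_eq_smul v hv
  have h1 : G.ev (rep (pt v hv)) ≠ 0 := by
    rw [hr]
    exact hG.ev_ne_zero ha h
  rw [mapOf_eq h1]
  refine pt_eq_pt_iff.2 ⟨a ^ d, pow_ne_zero _ ha, ?_⟩
  rw [hr, hG.ev_smul]

theorem mapOf_mem_nonvanishing {G : PolyVec n k} {F : MvPolynomial (Fin (n + 1)) k} {d : ℕ}
    (hF : F.IsHomogeneous d) {p : projectiveSpace k n} (h : G.ev (rep p) ≠ 0) :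
    mapOf G p ∈ nonvanishing F ↔ p ∈ nonvanishing (bind₁ G F) := by
  rw [mapOf_eq h, pt_mem_nonvanishing hF]
  change _ ↔ eval _ _ ≠ 0
  rw [PolyVec.eval_bind₁]

theorem eventually_ev_ne_zero {G : PolyVec n k} {d : ℕ} (hG : G.Homog d)
    {p : projectiveSpace k n} (h : G.ev (rep p) ≠ 0) :
    ∀ᶠ q in 𝓝 p, G.ev (rep q) ≠ 0 := by
  obtain ⟨i, hi⟩ := Function.ne_iff.1 h
  filter_upwards [(isOpen_nonvanishing (hG i)).mem_nhds hi] with q hq h0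
  exact hq (congrFun h0 i)

/-- Substituting `G` pulls a quotient of homogeneous polynomials of the same degree back to such a
quotient. -/
theorem isMorphismAt_mapOf {G : PolyVec n k} {d : ℕ} (hG : G.Homog d)
    {p : projectiveSpace k n} (h : G.ev (rep p) ≠ 0) :
    IsMorphismAt (mapOf G) p := by
  have hcont : ContinuousAt (mapOf G) p := by
    refine tendsto_nhds.2 fun V hV hpV => ?_
    obtain ⟨d', F, hF, hpF, hFV⟩ := exists_nonvanishing_subset hV hpV
    have h1 : p ∈ nonvanishing (bind₁ G F) := (mapOf_mem_nonvanishing hF h).1 hpF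
    have h2 : (bind₁ G F).IsHomogeneous (d * d') := hF.aeval _ hG
    filter_upwards [eventually_ev_ne_zero hG h, (isOpen_nonvanishing h2).mem_nhds h1] with q hq hq'
    exact hFV ((mapOf_mem_nonvanishing hF hq).2 hq')
  refine ⟨hcont, fun g hg => ?_⟩
  obtain ⟨d', P, Q, hP, hQ, hpQ, hg⟩ := regularAt_iff.1 hg
  refine regularAt_iff.2 ⟨d * d', bind₁ G P, bind₁ G Q, hP.aeval _ hG, hQ.aeval _ hG,
    (mapOf_mem_nonvanishing hQ h).1 hpQ, ?_⟩
  filter_upwards [hcont.eventually hg, eventually_ev_ne_zero hG h] with q hq hq'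
  -- The chosen coordinates of the image differ from `G(rep q)` by a scalar `a`; the factor `a ^ d'`
  -- cancels in the quotient.
  obtain ⟨a, ha, hr⟩ := exists_rep_pt_eq_smul _ hq'
  rw [Function.comp_apply, hq, mapOf_eq hq', hr, eval_smul_of_isHomogeneous hP,
    eval_smul_of_isHomogeneous hQ, PolyVec.eval_bind₁, PolyVec.eval_bind₁,
    mul_div_mul_left _ _ (pow_ne_zero _ ha)]

end Projective

end Cremona
end

noncomputable section

namespace Cremona

open MvPolynomial

variable {k : Type u} [Field k]

/-! ## Polynomial representatives of birational transformations -/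

section Represents

variable {n : ℕ}

/-- `θ` is given, at a general point, by the vector of polynomials `G`. -/
def Represents (G : PolyVec n k) (θ : Cr n k) : Prop :=
  ∃ e : PartialIso (projectiveSpace k n), Bir.mk e = θ ∧
    ∃ (d : ℕ) (F : MvPolynomial (Fin (n + 1)) k), F.IsHomogeneous d ∧ F ≠ 0 ∧
      ∀ v (hv : v ≠ 0), eval v F ≠ 0 → pt v hv ∈ e.source ∧
        ∃ hw : G.ev v ≠ 0, e.toFun (pt v hv) = pt (G.ev v) hw

theorem exists_mk_eq (θ : Cr n k) : ∃ e, Bir.mk e = θ := Quotient.exists_rep θ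

theorem mk_eq_mk_iff {e e' : PartialIso (projectiveSpace k n)} :
    Bir.mk e = Bir.mk e' ↔ e.Equiv e' := Quotient.eq

theorem mk_mul_mk (e e' : PartialIso (projectiveSpace k n)) :
    Bir.mk e * Bir.mk e' = Bir.mk (e'.trans e) := rfl

theorem Represents.of_isOpen {G : PolyVec n k} {e : PartialIso (projectiveSpace k n)}
    {W : Set (projectiveSpace k n)} (hW : IsOpen W) (hne : W.Nonempty) (hWs : W ⊆ e.source)
    (h : ∀ v hv, pt v hv ∈ W → ∃ hw : G.ev v ≠ 0, e.toFun (pt v hv) = pt (G.ev v) hw) :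
    Represents G (Bir.mk e) := by
  obtain ⟨p, hp⟩ := hne
  obtain ⟨d, F, hF, hpF, hFW⟩ := exists_nonvanishing_subset hW hp
  refine ⟨e, rfl, d, F, hF, ne_zero_of_mem_nonvanishing hpF, fun v hv hvF => ?_⟩
  have h1 : pt v hv ∈ W := hFW ((pt_mem_nonvanishing hF).2 hvF)
  exact ⟨hWs h1, h v hv h1⟩

/-- Every general point has coordinates with `v i = 1`, and homogeneity of `G` carries the
conclusion to its other coordinate vectors. -/
theorem Represents.of_chart [Infinite k] {G : PolyVec n k} {d : ℕ} (hG : G.Homog d)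
    (i : Fin (n + 1)) {e : PartialIso (projectiveSpace k n)}
    {W : Set (projectiveSpace k n)} (hW : IsOpen W) (hne : W.Nonempty) (hWs : W ⊆ e.source)
    (h : ∀ v hv, v i = 1 → pt v hv ∈ W → ∃ hw : G.ev v ≠ 0, e.toFun (pt v hv) = pt (G.ev v) hw) :
    Represents G (Bir.mk e) := by
  have hX := isHomogeneous_X k i
  refine Represents.of_isOpen (W := W ∩ nonvanishing (X i)) (hW.inter (isOpen_nonvanishing hX))
    ((dense_nonvanishing hX (X_ne_zero i)).inter_open_nonempty _ hW hne)
    (inter_subset_left.trans hWs) ?_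
  rintro v hv ⟨hvW, hvi⟩
  rw [pt_mem_nonvanishing hX, eval_X] at hvi
  have hv' : (v i)⁻¹ • v ≠ 0 := smul_ne_zero (inv_ne_zero hvi) hv
  have h1 : pt v hv = pt _ hv' := pt_eq_pt_iff.2 ⟨v i, hvi, by rw [smul_inv_smul₀ hvi]⟩
  obtain ⟨hw, hw'⟩ := h _ hv' (by simp [hvi]) (h1 ▸ hvW)
  have h2 : G.ev v ≠ 0 := by
    have h3 := hG.ev_ne_zero hvi hw
    rwa [smul_inv_smul₀ hvi] at h3
  refine ⟨h2, ?_⟩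
  rw [h1, hw']
  refine pt_eq_pt_iff.2 ⟨(v i)⁻¹ ^ d, pow_ne_zero _ (inv_ne_zero hvi), ?_⟩
  rw [hG.ev_smul]

/-- The definition provides some partial isomorphism in the class of `θ`; here the description is
transferred to a prescribed one, at the cost of shrinking the open set. -/
theorem Represents.mk {G : PolyVec n k} {e : PartialIso (projectiveSpace k n)}
    (h : Represents G (Bir.mk e)) : ∃ (d : ℕ) (F : MvPolynomial (Fin (n + 1)) k),
      F.IsHomogeneous d ∧ F ≠ 0 ∧ ∀ v (hv : v ≠ 0), eval v F ≠ 0 → pt v hv ∈ e.source ∧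
        ∃ hw : G.ev v ≠ 0, e.toFun (pt v hv) = pt (G.ev v) hw := by
  obtain ⟨e', he, d, F, hF, hF0, h⟩ := h
  obtain ⟨W, hW, hWd, hWe', hWe, hEq⟩ := mk_eq_mk_iff.1 he
  obtain ⟨d', F', hF', hF'0, hFW⟩ := exists_nonvanishing_subset_of_dense hW hWd
  refine ⟨d + d', F * F', hF.mul hF', mul_ne_zero hF0 hF'0, fun v hv hvF => ?_⟩
  rw [map_mul, mul_ne_zero_iff] at hvF
  have h1 : pt v hv ∈ W := hFW ((pt_mem_nonvanishing hF').2 hvF.2)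
  obtain ⟨_, hw, h2⟩ := h v hv hvF.1
  exact ⟨hWe h1, hw, (hEq h1).symm.trans h2⟩

/-- Two polynomials are equal when they agree at the nonzero vectors where a given nonzero
polynomial does not vanish. -/
theorem eq_of_generic [Infinite k] {A B F : MvPolynomial (Fin (n + 1)) k} (hF : F ≠ 0)
    (h : ∀ v, v ≠ 0 → eval v F ≠ 0 → eval v A = eval v B) : A = B := by
  by_contra hne
  -- Besides `A - B` and `F`, the factor `X 0` guarantees that `v ≠ 0`.
  obtain ⟨v, hv⟩ := exists_eval_ne_zero_of_ne_zero
    (mul_ne_zero (mul_ne_zero (sub_ne_zero.2 hne) hF) (X_ne_zero (R := k) 0))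
  simp only [map_mul, map_sub, eval_X, mul_ne_zero_iff] at hv
  exact hv.1.1 (sub_eq_zero.2 (h v (fun h0 => hv.2 (by simp [h0])) hv.1.2))

/-- The minors vanish at general points, hence identically because `k` is infinite.
`Represents.unique` is the converse. -/
theorem Represents.cross [Infinite k] {G G' : PolyVec n k} {θ : Cr n k} (h : Represents G θ)
    (h' : Represents G' θ) (i j : Fin (n + 1)) : G i * G' j = G j * G' i := by
  obtain ⟨e, rfl⟩ := exists_mk_eq θ
  obtain ⟨d, F, hF, hF0, h⟩ := h.mk
  obtain ⟨d', F', hF', hF'0, h'⟩ := h'.mk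
  refine eq_of_generic (mul_ne_zero hF0 hF'0) fun v hv hvF => ?_
  rw [map_mul, mul_ne_zero_iff] at hvF
  obtain ⟨_, hw, h1⟩ := h v hv hvF.1
  obtain ⟨_, hw', h1'⟩ := h' v hv hvF.2
  rw [map_mul, map_mul]
  exact cross_of_pt_eq_pt (h1.symm.trans h1') i j

theorem Represents.unique [Infinite k] {G G' : PolyVec n k} {θ θ' : Cr n k} (h : Represents G θ)
    (h' : Represents G' θ') (hc : ∀ i j, G i * G' j = G j * G' i) : θ = θ' := by
  obtain ⟨e, rfl⟩ := exists_mk_eq θ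
  obtain ⟨e', rfl⟩ := exists_mk_eq θ'
  obtain ⟨d, F, hF, hF0, h⟩ := h.mk
  obtain ⟨d', F', hF', hF'0, h'⟩ := h'.mk
  have key : ∀ p ∈ nonvanishing (F * F'), p ∈ e.source ∧ p ∈ e'.source ∧
      e.toFun p = e'.toFun p := by
    intro p hp
    obtain ⟨v, hv, rfl⟩ := exists_eq_pt p
    rw [pt_mem_nonvanishing (hF.mul hF'), map_mul, mul_ne_zero_iff] at hp
    obtain ⟨hs, hw, h1⟩ := h v hv hp.1
    obtain ⟨hs', hw', h1'⟩ := h' v hv hp.2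
    refine ⟨hs, hs', ?_⟩
    rw [h1, h1']
    refine pt_eq_pt_of_cross fun i j => ?_
    simp only [PolyVec.ev_apply, ← map_mul, hc]
  exact mk_eq_mk_iff.2 ⟨nonvanishing (F * F'), isOpen_nonvanishing (hF.mul hF'),
    dense_nonvanishing (hF.mul hF') (mul_ne_zero hF0 hF'0), fun p hp => (key p hp).1,
    fun p hp => (key p hp).2.1, fun p hp => (key p hp).2.2⟩

theorem Represents.eq [Infinite k] {G : PolyVec n k} {θ θ' : Cr n k} (h : Represents G θ)
    (h' : Represents G θ') : θ = θ' := h.unique h' fun _ _ => mul_comm _ _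

/-- A nonzero homogeneous vector proportional to a representative is a representative. -/
theorem Represents.of_cross [Infinite k] {G G' : PolyVec n k} {θ : Cr n k} (h : Represents G θ)
    {d : ℕ} (hd : G'.Homog d) (h0 : G' ≠ 0) (hc : ∀ i j, G i * G' j = G j * G' i) :
    Represents G' θ := by
  obtain ⟨e, rfl, d', F, hF, hF0, h⟩ := h
  obtain ⟨i, hi⟩ := Function.ne_iff.1 h0
  refine ⟨e, rfl, d' + d, F * G' i, hF.mul (hd i), mul_ne_zero hF0 hi, fun v hv hvF => ?_⟩
  rw [map_mul, mul_ne_zero_iff] at hvF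
  obtain ⟨hs, hw, h1⟩ := h v hv hvF.1
  have hw' : G'.ev v ≠ 0 := fun h2 => hvF.2 (congrFun h2 i)
  refine ⟨hs, hw', h1.trans (pt_eq_pt_of_cross fun i j => ?_)⟩
  simp only [PolyVec.ev_apply, ← map_mul, hc]

theorem Represents.ne_zero [Infinite k] {G : PolyVec n k} {θ : Cr n k} (h : Represents G θ) :
    G ≠ 0 := by
  obtain ⟨e, rfl, d, F, hF, hF0, h⟩ := h
  obtain ⟨p, hp⟩ := nonvanishing_nonempty hF hF0
  obtain ⟨_, hw, _⟩ := h (rep p) (rep_ne_zero p) hp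
  rintro rfl
  exact hw (by ext i; simp [PolyVec.ev])

theorem Represents.one : Represents (n := n) (k := k) X 1 := by
  refine ⟨PartialIso.refl _, rfl, 0, 1, isHomogeneous_one _ _, one_ne_zero,
    fun v hv _ => ⟨trivial, ?_⟩⟩
  have h : PolyVec.ev X v = v := by ext i; simp [PolyVec.ev]
  exact ⟨h.symm ▸ hv, by
    change pt v hv = _
    exact (pt_congr _ h).symm⟩

theorem Represents.mul [Infinite k] {G G' : PolyVec n k} {θ θ' : Cr n k} (h : Represents G θ)
    (h' : Represents G' θ') : Represents (G.comp G') (θ * θ') := by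
  obtain ⟨e, rfl, d, F, hF, hF0, h⟩ := h
  obtain ⟨e', rfl, d', F', hF', hF'0, h'⟩ := h'
  rw [mk_mul_mk]
  refine Represents.of_isOpen
    (W := nonvanishing F' ∩ (e'.source ∩ e'.toOpenPartialHomeomorph ⁻¹' nonvanishing F))
    ((isOpen_nonvanishing hF').inter
      (e'.toOpenPartialHomeomorph.isOpen_inter_preimage (isOpen_nonvanishing hF)))
    ((dense_inter_preimage e'.toOpenPartialHomeomorph e'.dense_source
      (dense_nonvanishing hF hF0)).inter_open_nonempty _ (isOpen_nonvanishing hF')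
      (nonvanishing_nonempty hF' hF'0)) ?_ ?_
  · rintro p ⟨_, hp, hpF⟩
    refine ⟨hp, ?_⟩
    obtain ⟨v, hv, hpv⟩ := exists_eq_pt (e'.toOpenPartialHomeomorph p)
    have h1 : pt v hv ∈ nonvanishing F := hpv ▸ hpF
    change e'.toOpenPartialHomeomorph p ∈ e.source
    rw [hpv]
    exact (h v hv ((pt_mem_nonvanishing hF).1 h1)).1
  · rintro v hv ⟨hp', _, hpF⟩
    obtain ⟨_, hw', h1'⟩ := h' v hv ((pt_mem_nonvanishing hF').1 hp')
    have h2 : pt _ hw' ∈ nonvanishing F := h1' ▸ hpF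
    obtain ⟨_, hw, h1⟩ := h _ hw' ((pt_mem_nonvanishing hF).1 h2)
    refine ⟨by rwa [PolyVec.ev_comp], ?_⟩
    change e.toFun (e'.toFun (pt v hv)) = _
    rw [h1', h1]
    exact pt_congr _ (PolyVec.ev_comp _ _ _).symm

/-- Near each point of its source, an isomorphism between open subsets is given by homogeneous
polynomials of the same degree. -/
theorem PartialIso.exists_local_homog (e : PartialIso (projectiveSpace k n))
    {p : projectiveSpace k n} (hp : p ∈ e.source) : ∃ (d : ℕ) (G : PolyVec n k), G.Homog d ∧
      ∀ᶠ q in 𝓝 p, q ∈ e.source ∧ ∃ hw : G.ev (rep q) ≠ 0, e.toFun q = pt (G.ev (rep q)) hw := by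
  obtain ⟨i, hi⟩ := exists_rep_ne_zero (e.toFun p)
  have hX : ∀ j, (X j : MvPolynomial (Fin (n + 1)) k).IsHomogeneous 1 := isHomogeneous_X k
  have hi' : e.toFun p ∈ nonvanishing (X i) := by
    change eval _ _ ≠ 0
    rwa [eval_X]
  have hreg : ∀ j, (projectiveSpace k n).RegularAt
      ((fun q => eval (rep q) (X j) / eval (rep q) (X i)) ∘ e.toFun) p := fun j =>
    (e.morphism p hp).2 _ (regularAt_div (hX j) (hX i) hi')
  choose d P Q hP hQ hpQ hev using fun j => regularAt_iff.1 (hreg j)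
  -- The functions `x_j / x_i` pull back to `P j / Q j`. Clearing the denominators gives components
  -- of the common degree `∑ d j`.
  refine ⟨∑ j, d j, fun j => P j * ∏ l ∈ Finset.univ.erase j, Q l, fun j => ?_, ?_⟩
  · rw [← Finset.add_sum_erase _ _ (Finset.mem_univ j)]
    exact (hP j).mul (IsHomogeneous.prod _ _ _ fun l _ => hQ l)
  have hQn : ∀ᶠ q in 𝓝 p, ∀ j, q ∈ nonvanishing (Q j) :=
    eventually_all.2 fun j => (isOpen_nonvanishing (hQ j)).mem_nhds (hpQ j)
  have hin : ∀ᶠ q in 𝓝 p, e.toFun q ∈ nonvanishing (X i) :=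
    (e.morphism p hp).1.eventually ((isOpen_nonvanishing (hX i)).mem_nhds hi')
  filter_upwards [eventually_all.2 hev, hQn, hin, e.open_source.mem_nhds hp] with q h1 h2 h3 h4
  refine ⟨h4, ?_⟩
  have h3' : rep (e.toFun q) i ≠ 0 := by
    have h5 : eval (rep (e.toFun q)) (X i) ≠ 0 := h3
    rwa [eval_X] at h5
  -- This is the factor of proportionality between the new vector at `rep q` and the coordinates of
  -- `e q`.
  set a : k := (∏ l, eval (rep q) (Q l)) / rep (e.toFun q) i with ha
  have ha0 : a ≠ 0 := div_ne_zero (Finset.prod_ne_zero_iff.2 fun l _ => h2 l) h3'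
  have hG : PolyVec.ev (fun j => P j * ∏ l ∈ Finset.univ.erase j, Q l) (rep q) =
      a • rep (e.toFun q) := by
    ext j
    have h5 := h1 j
    have h6 : eval (rep q) (Q j) ≠ 0 := h2 j
    simp only [Function.comp_apply, eval_X] at h5
    rw [div_eq_div_iff h3' h6] at h5
    simp only [PolyVec.ev_apply, map_mul, map_prod, Pi.smul_apply, smul_eq_mul, ha]
    rw [← Finset.mul_prod_erase _ _ (Finset.mem_univ j)]
    field_simp
    linear_combination -(∏ x ∈ Finset.univ.erase j, (eval (rep q)) (Q x)) * h5
  refine ⟨by rw [hG]; exact smul_ne_zero ha0 (rep_ne_zero _), ?_⟩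
  conv_lhs => rw [← pt_rep (e.toFun q)]
  exact pt_eq_pt_iff.2 ⟨a⁻¹, inv_ne_zero ha0, by rw [hG, inv_smul_smul₀ ha0]⟩

/-- Polynomial representatives given near a point represent the birational transformation. -/
theorem represents_of_eventually {e : PartialIso (projectiveSpace k n)}
    {p : projectiveSpace k n} {d : ℕ} {G : PolyVec n k} (hG : G.Homog d)
    (h : ∀ᶠ q in 𝓝 p, q ∈ e.source ∧ ∃ hw : G.ev (rep q) ≠ 0, e.toFun q = pt (G.ev (rep q)) hw) :
    Represents G (Bir.mk e) := by
  obtain ⟨W, hW, hWo, hpW⟩ := eventually_nhds_iff.1 h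
  refine Represents.of_isOpen hWo ⟨p, hpW⟩ (fun q hq => (hW q hq).1) fun v hv hvW => ?_
  obtain ⟨_, hw, h1⟩ := hW _ hvW
  obtain ⟨a, ha, hr⟩ := exists_rep_pt_eq_smul v hv
  have hw' : G.ev v ≠ 0 := by
    intro h0
    exact hw (by rw [hr, hG.ev_smul, h0, smul_zero])
  refine ⟨hw', h1.trans (pt_eq_pt_iff.2 ⟨a ^ d, pow_ne_zero _ ha, ?_⟩)⟩
  rw [hr, hG.ev_smul]

theorem PartialIso.source_nonempty (e : PartialIso (projectiveSpace k n)) : e.source.Nonempty :=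
  have : Nonempty (projectiveSpace k n) := ⟨pt (fun _ => 1) fun h => one_ne_zero (congrFun h 0)⟩
  e.dense_source.nonempty

theorem exists_represents (θ : Cr n k) : ∃ (d : ℕ) (G : PolyVec n k), G.Homog d ∧
    Represents G θ := by
  obtain ⟨e, rfl⟩ := exists_mk_eq θ
  obtain ⟨p, hp⟩ := e.source_nonempty
  obtain ⟨d, G, hG, h⟩ := e.exists_local_homog hp
  exact ⟨d, G, hG, represents_of_eventually hG h⟩

/-- The composition of mutually inverse representatives. -/
theorem Represents.exists_comp_eq [Infinite k] (hn : 1 ≤ n) {G H : PolyVec n k} {d d' : ℕ}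
    {θ : Cr n k} (hG : Represents G θ) (hH : Represents H θ⁻¹) (dG : G.Homog d) (dH : H.Homog d') :
    ∃ (m : ℕ) (c : MvPolynomial (Fin (n + 1)) k), c ≠ 0 ∧ c.IsHomogeneous m ∧
      d * d' = m + 1 ∧ ∀ i, H.comp G i = c * X i := by
  have h1 : Represents (H.comp G) 1 := by simpa using hH.mul hG
  obtain ⟨c, hc⟩ := exists_eq_mul_X hn fun i j => (Represents.one.cross h1 i j)
  have hc0 : c ≠ 0 := by
    rintro rfl
    exact h1.ne_zero (funext fun i => by simp [hc])
  have hcomp := dH.comp dG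
  have h2 : (c * X 0).IsHomogeneous (d * d') := hc 0 ▸ hcomp 0
  have hpos : d * d' ≠ 0 := by
    intro h0
    rw [h0, ← totalDegree_zero_iff_isHomogeneous,
      totalDegree_mul_of_isDomain hc0 (X_ne_zero 0), totalDegree_X] at h2
    omega
  obtain ⟨m, hm⟩ := Nat.exists_eq_succ_of_ne_zero hpos
  exact ⟨m, c, hc0, isHomogeneous_of_mul_X (hm ▸ h2), hm, hc⟩

end Represents

end Cremona
end

noncomputable section

namespace Cremona

open MvPolynomial

variable {k : Type u} [Field k]

/-! ### Pairs of mutually inverse homogeneous vectors -/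

section Datum

variable {n : ℕ}

theorem PolyVec.ev_eq_smul {P : PolyVec n k} {c : MvPolynomial (Fin (n + 1)) k}
    (h : ∀ i, P i = c * X i) (v : Fin (n + 1) → k) : P.ev v = eval v c • v := by
  ext i
  simp [PolyVec.ev, h]

/-- Homogeneous vectors `G` and `H` with `H ∘ G = c x` and `G ∘ H = d x`. -/
structure InversePair (n : ℕ) (k : Type u) [Field k] where
  G : PolyVec n k
  H : PolyVec n k
  c : MvPolynomial (Fin (n + 1)) k
  d : MvPolynomial (Fin (n + 1)) k
  degG : ℕ
  degH : ℕ
  degc : ℕ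
  degd : ℕ
  homogG : G.Homog degG
  homogH : H.Homog degH
  homogc : c.IsHomogeneous degc
  homogd : d.IsHomogeneous degd
  c_ne_zero : c ≠ 0
  d_ne_zero : d ≠ 0
  degG_pos : degG ≠ 0
  degH_pos : degH ≠ 0
  HG : ∀ i, H.comp G i = c * X i
  GH : ∀ i, G.comp H i = d * X i

namespace InversePair

/-- Exchange the roles of the two vectors. -/
def symm (D : InversePair n k) : InversePair n k where
  G := D.H
  H := D.G
  c := D.d
  d := D.c
  degG := D.degH
  degH := D.degG
  degc := D.degd
  degd := D.degc
  homogG := D.homogH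
  homogH := D.homogG
  homogc := D.homogd
  homogd := D.homogc
  c_ne_zero := D.d_ne_zero
  d_ne_zero := D.c_ne_zero
  degG_pos := D.degH_pos
  degH_pos := D.degG_pos
  HG := D.GH
  GH := D.HG

variable (D : InversePair n k)

theorem H_ev_G (v : Fin (n + 1) → k) : D.H.ev (D.G.ev v) = eval v D.c • v := by
  rw [← PolyVec.ev_comp, PolyVec.ev_eq_smul D.HG]

theorem _root_.Cremona.PolyVec.Homog.ev_zero {G : PolyVec n k} {d : ℕ} (hG : G.Homog d)
    (hd : d ≠ 0) : G.ev 0 = 0 := by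
  have h := hG.ev_smul 0 0
  rwa [zero_pow hd, zero_smul, zero_smul] at h

/-- If `G v` were `0`, then `H(G v)` would be `0` because `H` has positive degree, whereas it is
`c(v) v`. -/
theorem ev_ne_zero {v : Fin (n + 1) → k} (hv : v ≠ 0) (h : eval v D.c ≠ 0) : D.G.ev v ≠ 0 := by
  intro h0
  have h1 := D.H_ev_G v
  rw [h0, D.homogH.ev_zero D.degH_pos] at h1
  exact smul_ne_zero h hv h1.symm

/-- Computing `G(H(G v))` in two ways gives `d(G v) G v` and `c(v) ^ degG G v`. In particular `G`
maps the locus `c ≠ 0` into the locus `d ≠ 0`. -/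
theorem eval_d_ev {v : Fin (n + 1) → k} (hv : v ≠ 0) (h : eval v D.c ≠ 0) :
    eval (D.G.ev v) D.d = eval v D.c ^ D.degG := by
  have h1 := D.symm.H_ev_G (D.G.ev v)
  change D.G.ev (D.H.ev (D.G.ev v)) = eval (D.G.ev v) D.d • D.G.ev v at h1
  rw [D.H_ev_G, D.homogG.ev_smul] at h1
  exact (smul_left_injective k (D.ev_ne_zero hv h) h1).symm

theorem mapOf_mem {p : projectiveSpace k n} (hp : p ∈ nonvanishing D.c) :
    mapOf D.G p ∈ nonvanishing D.d := by
  have h := D.ev_ne_zero (rep_ne_zero p) hp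
  rw [mapOf_eq h, pt_mem_nonvanishing D.homogd, D.eval_d_ev (rep_ne_zero p) hp]
  exact pow_ne_zero _ hp

theorem mapOf_mapOf {p : projectiveSpace k n} (hp : p ∈ nonvanishing D.c) :
    mapOf D.H (mapOf D.G p) = p := by
  have h := D.ev_ne_zero (rep_ne_zero p) hp
  have h1 : D.H.ev (D.G.ev (rep p)) ≠ 0 := by
    rw [D.H_ev_G]
    exact smul_ne_zero hp (rep_ne_zero p)
  rw [mapOf_eq h, mapOf_pt D.homogH _ h1]
  conv_rhs => rw [← pt_rep p]
  exact pt_eq_pt_iff.2 ⟨_, hp, D.H_ev_G _⟩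

theorem continuousOn_mapOf : ContinuousOn (mapOf D.G) (nonvanishing D.c) := fun p hp =>
  (isMorphismAt_mapOf D.homogG (D.ev_ne_zero (rep_ne_zero p) hp)).1.continuousWithinAt

/-- The isomorphism between the open subsets `c ≠ 0` and `d ≠ 0`. -/
def toPartialIso [Infinite k] : PartialIso (projectiveSpace k n) where
  toFun := mapOf D.G
  invFun := mapOf D.H
  source := nonvanishing D.c
  target := nonvanishing D.d
  map_source' _ hp := D.mapOf_mem hp
  map_target' _ hp := D.symm.mapOf_mem hp
  left_inv' _ hp := D.mapOf_mapOf hp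
  right_inv' _ hp := D.symm.mapOf_mapOf hp
  open_source := isOpen_nonvanishing D.homogc
  open_target := isOpen_nonvanishing D.homogd
  continuousOn_toFun := D.continuousOn_mapOf
  continuousOn_invFun := D.symm.continuousOn_mapOf
  dense_source := dense_nonvanishing D.homogc D.c_ne_zero
  dense_target := dense_nonvanishing D.homogd D.d_ne_zero
  morphism p hp := isMorphismAt_mapOf D.homogG (D.ev_ne_zero (rep_ne_zero p) hp)
  morphism_symm p hp := isMorphismAt_mapOf D.homogH (D.symm.ev_ne_zero (rep_ne_zero p) hp)

theorem represents [Infinite k] : Represents D.G (Bir.mk D.toPartialIso) := by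
  refine ⟨_, rfl, D.degc, D.c, D.homogc, D.c_ne_zero, fun v hv hvc => ?_⟩
  exact ⟨(pt_mem_nonvanishing D.homogc).2 hvc, D.ev_ne_zero hv hvc,
    mapOf_pt D.homogG hv (D.ev_ne_zero hv hvc)⟩

end InversePair

/-- Two birationally inverse representatives form an inverse pair. -/
theorem Represents.exists_inversePair [Infinite k] (hn : 1 ≤ n) {G H : PolyVec n k} {d d' : ℕ}
    {θ : Cr n k} (hG : Represents G θ) (hH : Represents H θ⁻¹) (dG : G.Homog d)
    (dH : H.Homog d') : ∃ D : InversePair n k, D.G = G ∧ D.H = H ∧ D.degG = d ∧ D.degH = d' := by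
  obtain ⟨m, c, hc0, hc, hm, hcX⟩ := hG.exists_comp_eq hn hH dG dH
  obtain ⟨m', c', hc0', hc', hm', hcX'⟩ := hH.exists_comp_eq hn (by simpa using hG) dH dG
  refine ⟨⟨G, H, c, c', d, d', m, m', dG, dH, hc, hc', hc0, hc0', ?_, ?_, hcX, hcX'⟩,
    rfl, rfl, rfl, rfl⟩
  · rintro rfl
    simp at hm
  · rintro rfl
    simp at hm

end Datum

/-! ## Linear transformations -/

section Linear

variable {n : ℕ}

/-- The vector of linear forms defined by a matrix. -/
def linVec {R : Type*} [CommRing R] (M : Matrix (Fin (n + 1)) (Fin (n + 1)) R) : PolyVec n R :=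
  fun i => ∑ j, C (M i j) * X j

theorem linVec_homog {R : Type*} [CommRing R] (M : Matrix (Fin (n + 1)) (Fin (n + 1)) R) :
    (linVec M).Homog 1 := fun _ =>
  IsHomogeneous.sum _ _ _ fun _ _ => isHomogeneous_C_mul_X _ _

theorem ev_linVec {R : Type*} [CommRing R] (M : Matrix (Fin (n + 1)) (Fin (n + 1)) R)
    (v : Fin (n + 1) → R) : (linVec M).ev v = M.mulVec v := by
  ext i
  simp [PolyVec.ev, linVec, Matrix.mulVec, dotProduct]

theorem linVec_comp_linVec {R : Type*} [CommRing R]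
    (M M' : Matrix (Fin (n + 1)) (Fin (n + 1)) R) :
    (linVec M).comp (linVec M') = linVec (M * M') := by
  funext i
  simp only [PolyVec.comp, linVec, map_sum, map_mul, bind₁_C_right, bind₁_X_right, Matrix.mul_apply,
    Finset.mul_sum, Finset.sum_mul]
  rw [Finset.sum_comm]
  simp only [mul_assoc]

theorem linVec_one {R : Type*} [CommRing R] :
    linVec (1 : Matrix (Fin (n + 1)) (Fin (n + 1)) R) = X := by
  funext i
  simp [linVec, Matrix.one_apply, ite_mul]

/-- The inverse pair of an invertible matrix. -/
def linPair (M : Matrix.GeneralLinearGroup (Fin (n + 1)) k) : InversePair n k where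
  G := linVec M.1
  H := linVec M⁻¹.1
  c := 1
  d := 1
  degG := 1
  degH := 1
  degc := 0
  degd := 0
  homogG := linVec_homog _
  homogH := linVec_homog _
  homogc := isHomogeneous_one _ _
  homogd := isHomogeneous_one _ _
  c_ne_zero := one_ne_zero
  d_ne_zero := one_ne_zero
  degG_pos := one_ne_zero
  degH_pos := one_ne_zero
  HG i := by rw [linVec_comp_linVec, ← Units.val_mul, inv_mul_cancel, Units.val_one, linVec_one,
    one_mul]
  GH i := by rw [linVec_comp_linVec, ← Units.val_mul, mul_inv_cancel, Units.val_one, linVec_one,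
    one_mul]

variable [Infinite k]

theorem represents_linPair (M : Matrix.GeneralLinearGroup (Fin (n + 1)) k) :
    Represents (linVec M.1) (Bir.mk (linPair M).toPartialIso) := (linPair M).represents

/-- The group homomorphism from `GL_{n+1}(k)` to the Cremona group. -/
def lin (n : ℕ) (k : Type u) [Field k] [Infinite k] :
    Matrix.GeneralLinearGroup (Fin (n + 1)) k →* Cr n k where
  toFun M := Bir.mk (linPair M).toPartialIso
  map_one' := (represents_linPair 1).eq (by rw [Units.val_one, linVec_one]; exact Represents.one)
  map_mul' M M' := (represents_linPair _).eq (by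
    rw [Units.val_mul, ← linVec_comp_linVec]
    exact (represents_linPair M).mul (represents_linPair M'))

theorem represents_lin (M : Matrix.GeneralLinearGroup (Fin (n + 1)) k) :
    Represents (linVec M.1) (lin n k M) := represents_linPair M

theorem linPair_source (M : Matrix.GeneralLinearGroup (Fin (n + 1)) k) :
    (linPair M).toPartialIso.source = univ :=
  eq_univ_of_forall fun p => by
    change eval (rep p) 1 ≠ 0
    simp

theorem linPair_target (M : Matrix.GeneralLinearGroup (Fin (n + 1)) k) :
    (linPair M).toPartialIso.target = univ :=
  eq_univ_of_forall fun p => by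
    change eval (rep p) 1 ≠ 0
    simp

theorem lin_mem_aut (M : Matrix.GeneralLinearGroup (Fin (n + 1)) k) :
    lin n k M ∈ aut (projectiveSpace k n) :=
  ⟨_, rfl, linPair_source M, linPair_target M⟩

theorem isLinear_lin (M : Matrix.GeneralLinearGroup (Fin (n + 1)) k) :
    IsLinear M.1 (lin n k M) := by
  refine ⟨_, rfl, linPair_source M, fun v hv => ?_⟩
  have h : (linVec M.1).ev v ≠ 0 := (linPair M).ev_ne_zero hv (by
    change eval v 1 ≠ 0
    simp)
  refine ⟨by rwa [ev_linVec] at h, ?_⟩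
  refine (mapOf_pt (linVec_homog M.1) hv h).trans (pt_congr _ (ev_linVec _ _))

theorem lin_eq_one_iff {M : Matrix.GeneralLinearGroup (Fin (n + 1)) k} :
    lin n k M = 1 ↔ ∃ a : kˣ, M = Matrix.GeneralLinearGroup.scalar (Fin (n + 1)) a := by
  constructor
  · intro h
    have h1 : ∀ i j, linVec M.1 i * X j = linVec M.1 j * X i := fun i j =>
      (represents_lin M).cross (h ▸ Represents.one) i j
    have hv : ∀ (v : Fin (n + 1) → k) i j,
        M.1.mulVec v i * v j = M.1.mulVec v j * v i := by
      intro v i j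
      simpa [← ev_linVec, PolyVec.ev] using congrArg (eval v) (h1 i j)
    -- Every vector is an eigenvector. Testing on `e_j` kills the off-diagonal entries, and testing
    -- on `e_0 + e_i` equates the diagonal ones.
    have hoff : ∀ i j, i ≠ j → M.1 i j = 0 := by
      intro i j hij
      simpa [hij] using hv (Pi.single j 1) i j
    have hdiag : ∀ i, M.1 i i = M.1 0 0 := by
      intro i
      rcases eq_or_ne i 0 with rfl | hi
      · rfl
      · have h2 := hv (Pi.single 0 1 + Pi.single i 1) i 0
        simpa [Matrix.mulVec_add, hi, hi.symm, hoff i 0 hi, hoff 0 i hi.symm] using h2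
    have hM : M.1 = Matrix.scalar (Fin (n + 1)) (M.1 0 0) := by
      ext i j
      rw [Matrix.scalar_apply, Matrix.diagonal_apply]
      split_ifs with hij
      · rw [← hij, hdiag]
      · exact hoff i j hij
    have h0 : M.1 0 0 ≠ 0 := by
      intro h0
      rw [h0, map_zero] at hM
      exact M.ne_zero hM
    exact ⟨Units.mk0 _ h0, Units.ext hM⟩
  · rintro ⟨a, rfl⟩
    refine (represents_lin _).unique Represents.one fun i j => ?_
    simp [linVec, Matrix.diagonal_apply, apply_ite C, ite_mul]
    ring

end Linear

end Cremona
end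

noncomputable section

namespace Cremona

open MvPolynomial

variable {k : Type u} [Field k]

/-! ## The affine line -/

section AffineLine

theorem affineSpace_regularAt_of_eval {m : ℕ} {f : affineSpace k m → k} (P : MvPolynomial (Fin m) k)
    (h : ∀ b : Fin m → k, f b = eval b P) (a : affineSpace k m) :
    (affineSpace k m).RegularAt f a :=
  ⟨P, 1, by simp, Eventually.of_forall fun b => by rw [map_one, div_one, h]⟩

theorem affineSpace_isAffine (m : ℕ) {U : Set (affineSpace k m)} (hU : U = univ) :
    ((affineSpace k m).sub U).IsAffine := by
  subst hU
  refine ⟨m, univ, isClosed_univ, Homeomorph.refl _, fun x => ?_, fun x => ?_⟩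
  · exact IsMorphismAt.id x
  · exact IsMorphismAt.id x

theorem affineSpace_isVariety (m : ℕ) : (affineSpace k m).IsVariety where
  exists_cover := ⟨{univ}, finite_singleton _, by simp, by
    rintro U rfl
    exact ⟨isOpen_univ, affineSpace_isAffine m rfl⟩⟩
  separated := by
    let A := affineSpace k m
    have h : {p : A.prod A | p.1 = p.2}ᶜ = ⋃ i : Fin m,
        {p : A.prod A | p.1 ∈ (univ : Set A) ∧ p.2 ∈ (univ : Set A) ∧
          (p.1 : Fin m → k) i - (p.2 : Fin m → k) i ≠ 0} := by
      ext p
      simp only [mem_compl_iff, mem_ofPred_eq, mem_iUnion, mem_univ, true_and, sub_ne_zero]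
      exact Function.ne_iff
    rw [← isOpen_compl_iff, h]
    refine isOpen_iUnion fun i => TopologicalSpace.isOpen_generateFrom_of_mem
      ⟨univ, univ, fun p => (p.1 : Fin m → k) i - (p.2 : Fin m → k) i, isOpen_univ, isOpen_univ,
        ?_, rfl⟩
    have h1 : ∀ x ∈ (univ : Set A), A.RegularAt (fun b => (b : Fin m → k) i) x := fun x _ =>
      affineSpace_regularAt_of_eval (X i) (fun _ => (eval_X _).symm) x
    exact sub_mem (Algebra.subset_adjoin (Or.inl ⟨_, h1, rfl⟩))
      (Algebra.subset_adjoin (Or.inr ⟨_, h1, rfl⟩))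

theorem exists_eval_subset {m : ℕ} {U : Set (affineSpace k m)} (hU : IsOpen U)
    {a : affineSpace k m} (ha : a ∈ U) : ∃ P : MvPolynomial (Fin m) k,
      eval (a : Fin m → k) P ≠ 0 ∧ ∀ b : affineSpace k m, eval (b : Fin m → k) P ≠ 0 → b ∈ U := by
  induction hU with
  | basic s hs =>
    obtain ⟨P, rfl⟩ := hs
    exact ⟨P, ha, fun b hb => hb⟩
  | univ => exact ⟨1, by simp, fun _ _ => trivial⟩
  | inter s t _ _ hs ht =>
    obtain ⟨P, haP, hP⟩ := hs ha.1
    obtain ⟨Q, haQ, hQ⟩ := ht ha.2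
    refine ⟨P * Q, ?_, fun b hb => ?_⟩
    · rw [map_mul]
      exact mul_ne_zero haP haQ
    · rw [map_mul, mul_ne_zero_iff] at hb
      exact ⟨hP b hb.1, hQ b hb.2⟩
  | sUnion S _ ih =>
    obtain ⟨s, hs, has⟩ := ha
    obtain ⟨P, haP, hP⟩ := ih s hs has
    exact ⟨P, haP, fun b hb => ⟨s, hs, hP b hb⟩⟩

/-- A closed subset of the affine line containing all the points `t ≠ 0` contains `0`. -/
theorem zero_mem_of_isClosed [Infinite k] {Z : Set (affineSpace k 1)} (hZ : IsClosed Z)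
    (h : ∀ t : k, t ≠ 0 → ((fun _ => t : Fin 1 → k) : affineSpace k 1) ∈ Z) :
    ((fun _ => 0 : Fin 1 → k) : affineSpace k 1) ∈ Z := by
  by_contra h0
  obtain ⟨P, hP0, hP⟩ := exists_eval_subset hZ.isOpen_compl h0
  have hP0' : P ≠ 0 := by
    rintro rfl
    simp at hP0
  -- The factor `X 0` makes the parameter nonzero, so a point outside `Z` appears among the points
  -- `t ≠ 0`.
  obtain ⟨v, hv⟩ := exists_eval_ne_zero_of_ne_zero (mul_ne_zero hP0' (X_ne_zero (R := k) 0))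
  simp only [map_mul, eval_X, mul_ne_zero_iff] at hv
  refine hP v hv.1 ?_
  have h1 : v = fun _ => v 0 := by
    ext i
    rw [Subsingleton.elim i 0]
  rw [h1]
  exact h _ hv.2

end AffineLine

/-! ## Families over the affine line given by polynomials -/

section Family

variable {n : ℕ}

/-- Specialization of the coefficients. -/
def spec (t : k) : MvPolynomial (Fin (n + 1)) (Polynomial k) →+* MvPolynomial (Fin (n + 1)) k :=
  MvPolynomial.map (Polynomial.evalRingHom t)

/-- Specialization of the coefficients of a vector. -/
def specVec (t : k) (G : PolyVec n (Polynomial k)) : PolyVec n k := fun i => spec t (G i)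

theorem specVec_homog {G : PolyVec n (Polynomial k)} {d : ℕ} (hG : G.Homog d) (t : k) :
    (specVec t G).Homog d := fun i => (hG i).map _

theorem spec_bind₁ (t : k) (G : PolyVec n (Polynomial k))
    (F : MvPolynomial (Fin (n + 1)) (Polynomial k)) :
    spec t (bind₁ G F) = bind₁ (specVec t G) (spec t F) := map_bind₁ _ _ _

theorem specVec_comp (t : k) (G H : PolyVec n (Polynomial k)) :
    specVec t (G.comp H) = (specVec t G).comp (specVec t H) := funext fun _ => spec_bind₁ _ _ _

theorem eq_of_spec [Infinite k] {F F' : MvPolynomial (Fin (n + 1)) (Polynomial k)}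
    (h : ∀ t, spec t F = spec t F') : F = F' := by
  ext1 m
  refine Polynomial.funext fun t => ?_
  have h1 := congrArg (coeff m) (h t)
  rwa [spec, coeff_map, coeff_map] at h1

variable (k n) in
/-- The product of the affine line with the projective space. -/
abbrev lineProd : KSpace k := (affineSpace k 1).prod (projectiveSpace k n)

/-- The parameter of a point. -/
def param (a : affineSpace k 1) : k := (a : Fin 1 → k) 0

/-- The function `F(t, x) / x_i ^ d`. -/
def quot (F : MvPolynomial (Fin (n + 1)) (Polynomial k)) (d : ℕ) (i : Fin (n + 1))
    (p : affineSpace k 1 × projectiveSpace k n) : k :=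
  eval (rep p.2) (spec (param p.1) F) / rep p.2 i ^ d

/-- Expanding `F` in monomials writes the quotient as a finite sum of a coefficient, polynomial in
`t`, times a monomial divided by `x_i ^ d`. -/
theorem quot_mem_tensorFun {F : MvPolynomial (Fin (n + 1)) (Polynomial k)} {d : ℕ}
    (hF : F.IsHomogeneous d) (i : Fin (n + 1)) :
    quot F d i ∈ tensorFun (affineSpace k 1) (projectiveSpace k n) univ (nonvanishing (X i)) := by
  have h : quot F d i = ∑ m ∈ F.support,
      (fun p : affineSpace k 1 × projectiveSpace k n => (coeff m F).eval (param p.1)) *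
      (fun p : affineSpace k 1 × projectiveSpace k n =>
        eval (rep p.2) (monomial m 1) / eval (rep p.2) (X i ^ d)) := by
    funext p
    simp only [quot, spec, eval_map, Finset.sum_apply, Pi.mul_apply, eval_monomial, one_mul,
      map_pow, eval_X]
    rw [eval₂_eq, Finset.sum_div]
    refine Finset.sum_congr rfl fun m _ => ?_
    rw [Polynomial.coe_evalRingHom, Finsupp.prod, mul_div_assoc]
  rw [h]
  refine sum_mem fun m hm => mul_mem
    (Algebra.subset_adjoin (Or.inl ⟨fun a => (coeff m F).eval (param a), ?_, rfl⟩))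
    (Algebra.subset_adjoin (Or.inr ⟨fun q => eval (rep q) (monomial m 1) / eval (rep q) (X i ^ d),
      ?_, rfl⟩))
  · intro a _
    refine affineSpace_regularAt_of_eval
      (Polynomial.aeval (X 0 : MvPolynomial (Fin 1) k) (coeff m F)) (fun b => ?_) a
    rw [← Polynomial.eval₂_id, Polynomial.aeval_def, Polynomial.hom_eval₂]
    simp [param, Polynomial.eval₂_eq_sum_range]
  · intro q hq
    refine regularAt_div (d := d) (isHomogeneous_monomial _ ?_) (isHomogeneous_X_pow i d) ?_
    · rw [Finsupp.degree]
      exact (hF.degree_eq_sum_deg_support hm).symm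
    · change eval (rep q) _ ≠ 0
      rw [map_pow]
      exact pow_ne_zero _ hq

/-- The locus `F(t, x) ≠ 0`. -/
def prodNonvanishing (F : MvPolynomial (Fin (n + 1)) (Polynomial k)) : Set (lineProd k n) :=
  {p | eval (rep p.2) (spec (param p.1) F) ≠ 0}

theorem isOpen_prodNonvanishing {F : MvPolynomial (Fin (n + 1)) (Polynomial k)} {d : ℕ}
    (hF : F.IsHomogeneous d) : IsOpen (prodNonvanishing F) := by
  have h : prodNonvanishing F = ⋃ i : Fin (n + 1), {p : lineProd k n |
      p.1 ∈ (univ : Set (affineSpace k 1)) ∧ p.2 ∈ nonvanishing (X i) ∧ quot F d i p ≠ 0} := by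
    ext p
    simp only [prodNonvanishing, mem_ofPred_eq, mem_iUnion, mem_univ, true_and, quot, nonvanishing,
      eval_X, div_ne_zero_iff]
    constructor
    · intro hp
      obtain ⟨i, hi⟩ := exists_rep_ne_zero p.2
      exact ⟨i, hi, hp, pow_ne_zero _ hi⟩
    · rintro ⟨i, _, hp, _⟩
      exact hp
  rw [h]
  exact isOpen_iUnion fun i => TopologicalSpace.isOpen_generateFrom_of_mem
    ⟨univ, nonvanishing (X i), quot F d i, isOpen_univ, isOpen_nonvanishing (isHomogeneous_X k i),
      quot_mem_tensorFun hF i, rfl⟩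

/-- Numerator and denominator are both divided by `x_i ^ d` for a coordinate `x_i` not vanishing at
the point, which makes them sums of products of regular functions. -/
theorem regularAt_prod_div {P Q : MvPolynomial (Fin (n + 1)) (Polynomial k)} {d : ℕ}
    (hP : P.IsHomogeneous d) (hQ : Q.IsHomogeneous d) {p : lineProd k n}
    (hp : p ∈ prodNonvanishing Q) {f : lineProd k n → k}
    (hf : ∀ᶠ q in 𝓝 p, f q =
      eval (rep q.2) (spec (param q.1) P) / eval (rep q.2) (spec (param q.1) Q)) :
    (lineProd k n).RegularAt f p := by
  obtain ⟨i, hi⟩ := exists_rep_ne_zero p.2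
  have hX : (X i : MvPolynomial (Fin (n + 1)) (Polynomial k)).IsHomogeneous 1 :=
    isHomogeneous_X _ i
  have hXs : ∀ q : lineProd k n, q ∈ prodNonvanishing (X i) ↔ rep q.2 i ≠ 0 := by
    intro q
    simp [prodNonvanishing, spec]
  refine ⟨univ, nonvanishing (X i), quot P d i, quot Q d i, isOpen_univ,
    isOpen_nonvanishing (isHomogeneous_X k i), trivial, ?_, quot_mem_tensorFun hP i,
    quot_mem_tensorFun hQ i, div_ne_zero hp (pow_ne_zero _ hi), ?_⟩
  · change eval (rep p.2) (X i) ≠ 0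
    rwa [eval_X]
  have h1 : ∀ᶠ q in 𝓝 p, q ∈ prodNonvanishing (X i) :=
    (isOpen_prodNonvanishing hX).mem_nhds ((hXs p).2 hi)
  have h2 : ∀ᶠ q in 𝓝 p, f q = quot P d i q / quot Q d i q := by
    filter_upwards [hf, h1] with q hq hq'
    rw [hq]
    exact (div_div_div_cancel_right₀ (pow_ne_zero _ ((hXs q).1 hq')) _ _).symm
  exact h2

theorem specVec_ev_mem_iff {G : PolyVec n (Polynomial k)} (p : lineProd k n) :
    (specVec (param p.1) G).ev (rep p.2) ≠ 0 ↔ ∃ i, p ∈ prodNonvanishing (G i) :=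
  Function.ne_iff

/-- The map of the family defined by a vector of polynomials with coefficients in `k[t]`. -/
def familyMap (G : PolyVec n (Polynomial k)) (p : lineProd k n) : projectiveSpace k n :=
  mapOf (specVec (param p.1) G) p.2

theorem familyMap_mem_nonvanishing {G : PolyVec n (Polynomial k)}
    {F : MvPolynomial (Fin (n + 1)) k} {d : ℕ} (hF : F.IsHomogeneous d) {p : lineProd k n}
    (h : (specVec (param p.1) G).ev (rep p.2) ≠ 0) :
    familyMap G p ∈ nonvanishing F ↔
      p ∈ prodNonvanishing (bind₁ G (MvPolynomial.map Polynomial.C F)) := by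
  rw [familyMap, mapOf_mem_nonvanishing hF h]
  change eval _ _ ≠ 0 ↔ eval _ _ ≠ 0
  rw [spec_bind₁, spec, MvPolynomial.map_map]
  have h1 : (Polynomial.evalRingHom (param p.1)).comp Polynomial.C = RingHom.id k := by
    ext
    simp
  rw [h1, MvPolynomial.map_id]

theorem isMorphismAt_familyMap {G : PolyVec n (Polynomial k)} {d : ℕ} (hG : G.Homog d)
    {p : lineProd k n} (h : (specVec (param p.1) G).ev (rep p.2) ≠ 0) :
    IsMorphismAt (familyMap G) p := by
  have hev : ∀ᶠ q in 𝓝 p, (specVec (param q.1) G).ev (rep q.2) ≠ 0 := by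
    obtain ⟨i, hi⟩ := (specVec_ev_mem_iff p).1 h
    filter_upwards [(isOpen_prodNonvanishing (hG i)).mem_nhds hi] with q hq
    exact (specVec_ev_mem_iff q).2 ⟨i, hq⟩
  have hom : ∀ {F : MvPolynomial (Fin (n + 1)) k} {d' : ℕ}, F.IsHomogeneous d' →
      (bind₁ G (MvPolynomial.map Polynomial.C F)).IsHomogeneous (d * d') := fun hF =>
    (hF.map _).aeval _ hG
  have hcont : ContinuousAt (familyMap G) p := by
    refine tendsto_nhds.2 fun V hV hpV => ?_
    obtain ⟨d', F, hF, hpF, hFV⟩ := exists_nonvanishing_subset hV hpV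
    filter_upwards [hev, (isOpen_prodNonvanishing (hom hF)).mem_nhds
      ((familyMap_mem_nonvanishing hF h).1 hpF)] with q hq hq'
    exact hFV ((familyMap_mem_nonvanishing hF hq).2 hq')
  refine ⟨hcont, fun g hg => ?_⟩
  obtain ⟨d', P, Q, hP, hQ, hpQ, hg⟩ := regularAt_iff.1 hg
  refine regularAt_prod_div (hom hP) (hom hQ) ((familyMap_mem_nonvanishing hQ h).1 hpQ) ?_
  filter_upwards [hcont.eventually hg, hev] with q hq hq'
  obtain ⟨a, ha, hr⟩ := exists_rep_pt_eq_smul _ hq'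
  have h1 : (Polynomial.evalRingHom (param q.1)).comp Polynomial.C = RingHom.id k := by
    ext
    simp
  have h2 : ∀ F : MvPolynomial (Fin (n + 1)) k,
      spec (param q.1) (MvPolynomial.map Polynomial.C F) = F := fun F => by
    rw [spec, MvPolynomial.map_map, h1, MvPolynomial.map_id]
  rw [Function.comp_apply, hq, familyMap, mapOf_eq hq', hr, eval_smul_of_isHomogeneous hP,
    eval_smul_of_isHomogeneous hQ, spec_bind₁, spec_bind₁, h2, h2, PolyVec.eval_bind₁,
    PolyVec.eval_bind₁, mul_div_mul_left _ _ (pow_ne_zero _ ha)]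

/-- The slices of an open subset of a product are open. -/
theorem isOpen_slice {A X : KSpace k} {U : Set (A.prod X)} (hU : IsOpen U) (a : A) :
    IsOpen {x : X | ((a, x) : A × X) ∈ U} := by
  induction hU with
  | basic s hs =>
    obtain ⟨V, W, h, hV, hW, hh, rfl⟩ := hs
    -- With `a` fixed, the factors coming from `A` become constants, so a sum of products becomes a
    -- regular function on `X`.
    have hreg : ∀ x ∈ W, a ∈ V → X.RegularAt (fun y => h (a, y)) x := by
      intro x hx ha
      induction hh using Algebra.adjoin_induction with
      | mem f hf =>
        rcases hf with ⟨g, hg, rfl⟩ | ⟨g, hg, rfl⟩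
        · exact X.const (g a) x
        · exact hg x hx
      | algebraMap r => exact X.const r x
      | add f g _ _ hf hg => exact X.add hf hg
      | mul f g _ _ hf hg => exact X.mul hf hg
    refine isOpen_iff_mem_nhds.2 ?_
    rintro x ⟨ha, hx, hne⟩
    filter_upwards [hW.mem_nhds hx, X.ne_zero (hreg x hx ha) hne] with y hy hy'
    exact ⟨ha, hy, hy'⟩
  | univ => exact isOpen_univ
  | inter s t _ _ hs ht => exact hs.inter ht
  | sUnion S _ ih =>
    have : {x : X | ((a, x) : A × X) ∈ ⋃₀ S} = ⋃ s ∈ S, {x : X | ((a, x) : A × X) ∈ s} := by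
      ext x
      simp only [mem_iUnion]
      exact ⟨fun ⟨s, hs, h⟩ => ⟨s, hs, h⟩, fun ⟨s, hs, h⟩ => ⟨s, hs, h⟩⟩
    rw [this]
    exact isOpen_biUnion ih

theorem dense_of_slices {A X : KSpace k} {U : Set (A.prod X)}
    (h : ∀ a : A, Dense {x : X | ((a, x) : A × X) ∈ U}) : Dense U := by
  rw [dense_iff_inter_open]
  rintro O hO ⟨⟨a, x⟩, hx⟩
  obtain ⟨y, hy, hyU⟩ := (h a).inter_open_nonempty _ (isOpen_slice hO a) ⟨x, hx⟩
  exact ⟨(a, y), hy, hyU⟩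

/-- A map from the affine line to the Cremona group is a morphism when it and its inverse are
represented by homogeneous polynomials in `x` with coefficients in `k[t]`. -/
theorem isFamily_of_represents [Infinite k] (hn : 1 ≤ n) {G H : PolyVec n (Polynomial k)}
    {d d' : ℕ} (hG : G.Homog d) (hH : H.Homog d') {θ : k → Cr n k}
    (rG : ∀ t, Represents (specVec t G) (θ t)) (rH : ∀ t, Represents (specVec t H) (θ t)⁻¹) :
    IsFamily (A := affineSpace k 1) (fun a => θ (param a)) := by
  have hX : ∀ t : k, specVec (n := n) t X = X := fun t => by
    funext i
    simp [specVec, spec]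
  have h1 : ∀ t, Represents (specVec t (H.comp G)) 1 := fun t => by
    rw [specVec_comp]
    simpa using (rH t).mul (rG t)
  -- The relation `H ∘ G = c x` holds over `k[t]`, since the minors vanish after each specialization
  -- and `k` is infinite. The locus `c ≠ 0` will be the domain of the family.
  obtain ⟨c, hc⟩ := exists_eq_mul_X (P := H.comp G) hn fun i j => eq_of_spec fun t => by
    rw [map_mul, map_mul]
    have h2 := Represents.one.cross (h1 t) i j
    rw [← hX t] at h2
    exact h2
  have hct : ∀ t i, (specVec t H).comp (specVec t G) i = spec t c * X i := fun t i => by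
    rw [← specVec_comp]
    simp [specVec, hc, spec]
  choose D hDG hDH hdG hdH using fun t =>
    (rG t).exists_inversePair hn (rH t) (specVec_homog hG t) (specVec_homog hH t)
  -- The factor attached to the member `t` is the specialization of `c`, so the slices of `c ≠ 0`
  -- are the sources of the members.
  have hDc : ∀ t, (D t).c = spec t c := fun t => by
    have h2 := (D t).HG 0
    rw [hDG, hDH, hct] at h2
    exact (mul_right_cancel₀ (X_ne_zero 0) h2).symm
  -- The member `t = 0` serves only to write `d * d'` as `m + 1`; homogeneity of `c` then follows
  -- over `k[t]`.
  have hdeg : ∃ m, c.IsHomogeneous m := by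
    obtain ⟨m, _, _, _, hm, _⟩ :=
      (rG 0).exists_comp_eq hn (rH 0) (specVec_homog hG 0) (specVec_homog hH 0)
    exact ⟨m, isHomogeneous_of_mul_X (i := 0) (hm ▸ hc 0 ▸ hH.comp hG 0)⟩
  obtain ⟨m, hm⟩ := hdeg
  have hslice : ∀ a : affineSpace k 1,
      {x | ((a, x) : affineSpace k 1 × projectiveSpace k n) ∈ prodNonvanishing c} =
        (D (param a)).toPartialIso.source := by
    intro a
    change {x | eval (rep x) (spec (param a) c) ≠ 0} = nonvanishing (D (param a)).c
    rw [hDc]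
    rfl
  refine ⟨familyMap G, prodNonvanishing c, isOpen_prodNonvanishing hm, dense_of_slices fun a => ?_,
    ?_, fun a => ⟨(D (param a)).toPartialIso, (hslice a).symm, fun x _ => ?_, ?_⟩⟩
  · rw [hslice]
    exact (D (param a)).toPartialIso.dense_source
  · intro p hp
    refine isMorphismAt_familyMap hG ?_
    rw [← hDG]
    refine (D (param p.1)).ev_ne_zero (rep_ne_zero _) ?_
    rw [hDc]
    exact hp
  · change mapOf (D (param a)).G x = mapOf (specVec (param a) G) x
    rw [hDG]
  · have h2 := (D (param a)).represents
    rw [hDG] at h2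
    exact h2.eq (rG _)

/-- A closed set of the Cremona group containing the general members of a family given by
polynomials contains the special member. -/
theorem mem_of_isClosed_of_represents [Infinite k] (hn : 1 ≤ n) {Z : Set (Cr n k)}
    (hZ : IsClosed Z) {G H : PolyVec n (Polynomial k)} {d d' : ℕ} (hG : G.Homog d)
    (hH : H.Homog d') {θ : k → Cr n k} (rG : ∀ t, Represents (specVec t G) (θ t))
    (rH : ∀ t, Represents (specVec t H) (θ t)⁻¹) (h : ∀ t, t ≠ 0 → θ t ∈ Z) : θ 0 ∈ Z :=
  zero_mem_of_isClosed (isClosed_iff.1 hZ _ (affineSpace_isVariety 1) _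
    (isFamily_of_represents hn hG hH rG rH)) h

end Family

end Cremona
end

noncomputable section

namespace Cremona

open MvPolynomial

variable {k : Type u} [Field k]

/-! ## Linearization of a commutator -/

section Limit

/-- First order Taylor expansion in one variable. -/
theorem exists_aeval_add_single {σ A : Type*} [DecidableEq σ] [CommRing A] [Algebra k A]
    (F : MvPolynomial σ k) (y : σ → A) (i : σ) (u : A) :
    ∃ r, aeval (y + Pi.single i u) F = aeval y F + u * aeval y (pderiv i F) + u ^ 2 * r := by
  induction F using MvPolynomial.induction_on with
  | C a => exact ⟨0, by simp⟩
  | add p q hp hq =>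
    obtain ⟨r, hr⟩ := hp
    obtain ⟨r', hr'⟩ := hq
    refine ⟨r + r', ?_⟩
    simp only [map_add, hr, hr']
    ring
  | mul_X p j hp =>
    obtain ⟨r, hr⟩ := hp
    rcases eq_or_ne j i with rfl | hj
    · refine ⟨r * (y j + u) + aeval y (pderiv j p), ?_⟩
      simp only [map_mul, map_add, hr, aeval_X, Pi.add_apply, Pi.single_eq_same, Derivation.leibniz,
        pderiv_X_self, smul_eq_mul, mul_one]
      ring
    · refine ⟨r * y j, ?_⟩
      simp only [map_mul, hr, aeval_X, Pi.add_apply, Pi.single_eq_of_ne hj, add_zero,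
        Derivation.leibniz, pderiv_X_of_ne hj, smul_eq_mul, mul_zero, zero_add]
      ring

variable {n : ℕ}

theorem eval_spec_aeval (t : k) (v : Fin (n + 1) → k)
    (w : Fin (n + 1) → MvPolynomial (Fin (n + 1)) (Polynomial k)) (F : MvPolynomial (Fin (n + 1)) k) :
    eval v (spec t (aeval w F)) = eval (fun i => eval v (spec t (w i))) F := by
  induction F using MvPolynomial.induction_on with
  | C a => simp [spec, MvPolynomial.algebraMap_apply]
  | add p q hp hq => simp only [map_add, hp, hq]
  | mul_X p j hp => simp only [map_mul, hp, aeval_X, eval_X]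

/-- The vector `(x_0, t x_1, …, t x_n)`. -/
def dilation (n : ℕ) (k : Type u) [Field k] : PolyVec n (Polynomial k) := fun i =>
  if i = 0 then X 0 else C Polynomial.X * X i

theorem dilation_homog : (dilation n k).Homog 1 := fun i => by
  unfold dilation
  split_ifs
  · exact isHomogeneous_X _ _
  · exact (isHomogeneous_X _ _).C_mul _

namespace InversePair

variable (D : InversePair n k) (a : Fin (n + 1)) (s : k)

/-- The vector `H(x_0, t x_1, …, t x_n)`. -/
def dilatedH : PolyVec n (Polynomial k) := fun i => aeval (dilation n k) (D.H i)

theorem dilatedH_homog : D.dilatedH.Homog D.degH := fun i => by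
  have h := (D.homogH i).aeval _ (dilation_homog (n := n) (k := k))
  rwa [one_mul] at h

/-- The increment `s t H_a(x_0, t x_1, …, t x_n)` of the coordinate `0`. -/
def increment : MvPolynomial (Fin (n + 1)) (Polynomial k) :=
  C (Polynomial.C s * Polynomial.X) * D.dilatedH a

/-- The vector `G(H(x_0, t x_1, …, t x_n) + s t H_a(x_0, t x_1, …, t x_n) e_0)`. -/
def conjVec : PolyVec n (Polynomial k) := fun j =>
  aeval (D.dilatedH + Pi.single 0 (D.increment a s)) (D.G j)

theorem conjVec_homog : (D.conjVec a s).Homog (D.degH * D.degG) := fun j => by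
  refine (D.homogG j).aeval _ fun i => (D.dilatedH_homog i).add ?_
  rcases eq_or_ne i 0 with rfl | hi
  · rw [Pi.single_eq_same]
    exact (D.dilatedH_homog a).C_mul _
  · rw [Pi.single_eq_of_ne hi]
    exact isHomogeneous_zero _ _ _

/-- The derivative of `G` at `e_a` in the direction `e_0`, modulo `e_0`. -/
def tangent (j : Fin (n + 1)) : k :=
  if j = 0 then 0 else eval (Pi.single a 1) (pderiv 0 (D.G j))

theorem tangent_zero : D.tangent a 0 = 0 := if_pos rfl

variable {a} in
-- As `e_a = H(e_0)`, this is `G ∘ H = d x` evaluated at `e_0`.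
theorem G_ev_single (hH : D.H.ev (Pi.single 0 1) = Pi.single a 1) :
    D.G.ev (Pi.single a 1) = eval (Pi.single 0 1) D.d • Pi.single 0 1 := by
  rw [← hH]
  exact D.symm.H_ev_G _

/-- The vector of the family obtained by dividing by `t` the components of `conjVec` different
from the first one. -/
theorem exists_limit (hH : D.H.ev (Pi.single 0 1) = Pi.single a 1) :
    ∃ W : PolyVec n (Polynomial k), W.Homog (D.degH * D.degG) ∧ W 0 = D.conjVec a s 0 ∧
      (∀ j, j ≠ 0 → C Polynomial.X * W j = D.conjVec a s j) ∧
      ∀ v : Fin (n + 1) → k, v 0 = 1 →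
        (specVec 0 W).ev v = eval (Pi.single 0 1) D.d • v + s • D.tangent a := by
  -- Taylor expansion of `G` at `H(h_t x)` along `e_0`, with increment `s t H_a(h_t x)`, where `h_t
  -- x = (x_0, t x_1, …, t x_n)`.
  choose r hr using fun j => exists_aeval_add_single (D.G j) D.dilatedH 0 (D.increment a s)
  -- The constant term is `G(H(h_t x)) = d(h_t x) h_t x`, whose components other than the first are
  -- multiples of `t`.
  have hGH : ∀ j, aeval D.dilatedH (D.G j) = aeval (dilation n k) D.d * dilation n k j := by
    intro j
    have h1 : aeval (dilation n k) (bind₁ D.H (D.G j)) = aeval D.dilatedH (D.G j) := by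
      rw [aeval_bind₁]
      rfl
    have h2 : bind₁ D.H (D.G j) = D.d * X j := D.GH j
    rw [← h1, h2, map_mul, aeval_X]
  -- For `j ≠ 0` all three Taylor terms contain a factor `t`: the first through `t x_j`, the others
  -- through the increment. The quotient is written out explicitly.
  let W : PolyVec n (Polynomial k) := fun j => if j = 0 then D.conjVec a s 0 else
    aeval (dilation n k) D.d * X j +
      C (Polynomial.C s) * D.dilatedH a * aeval D.dilatedH (pderiv 0 (D.G j)) +
      C (Polynomial.C s) * D.dilatedH a * D.increment a s * r j
  have hW0 : W 0 = D.conjVec a s 0 := if_pos rfl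
  have hWj : ∀ j, j ≠ 0 → C Polynomial.X * W j = D.conjVec a s j := by
    intro j hj
    rw [conjVec, hr, hGH]
    simp only [W, if_neg hj, dilation, increment, map_mul]
    ring
  have hX0 : (Polynomial.X : Polynomial k) ≠ 0 := Polynomial.X_ne_zero
  refine ⟨W, fun j => ?_, hW0, hWj, fun v hv => ?_⟩
  · rcases eq_or_ne j 0 with rfl | hj
    · rw [hW0]
      exact D.conjVec_homog a s 0
    · exact isHomogeneous_of_C_mul hX0 (hWj j hj ▸ D.conjVec_homog a s j)
  -- At `t = 0` the dilation collapses every `v` with `v 0 = 1` to `e_0`. Hence `H` takes the value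
  -- `e_a`, the increment vanishes, and only the constant and linear terms survive.
  · have hz : (fun i => eval v (spec 0 (dilation n k i))) = Pi.single 0 1 := by
      funext i
      rcases eq_or_ne i 0 with rfl | hi
      · simp [dilation, spec, hv]
      · simp [dilation, spec, hi]
    have hy : (fun i => eval v (spec 0 (D.dilatedH i))) = Pi.single a 1 := by
      rw [← hH]
      funext i
      rw [dilatedH, eval_spec_aeval, hz]
      rfl
    have hu : eval v (spec 0 (D.increment a s)) = 0 := by
      simp [increment, spec]
    have hya : eval v (spec 0 (D.dilatedH a)) = 1 := by
      have h1 := congrFun hy a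
      rwa [Pi.single_eq_same] at h1
    funext j
    change eval v (spec 0 (W j)) = _
    rcases eq_or_ne j 0 with rfl | hj
    · rw [hW0, conjVec, hr, map_add, map_add, map_add, map_add, map_mul, map_mul, map_mul, map_mul,
        map_pow, map_pow, hu, hGH, map_mul, map_mul, eval_spec_aeval, hz]
      simp [dilation, spec, hv, tangent]
    · simp only [W, if_neg hj, map_add, map_mul, eval_spec_aeval, hz, hy, hya, hu]
      simp [tangent, hj, spec]

/-- The derivative of `G` at `e_a` in the direction `e_0` is not proportional to `e_0`. -/
theorem tangent_ne_zero (ha : a ≠ 0) (hH : D.H.ev (Pi.single 0 1) = Pi.single a 1)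
    (hd : eval (Pi.single 0 1) D.d ≠ 0) : D.tangent a ≠ 0 := by
  intro h0
  -- The first order computation is made exact over the dual numbers, at the point `x = e_a + ε
  -- e_0`.
  let ι : k →+* DualNumber k := algebraMap k (DualNumber k)
  let e : DualNumber k := DualNumber.eps
  have he : e ^ 2 = 0 := by rw [pow_two]; exact DualNumber.eps_mul_eps
  have hsingle : ∀ i : Fin (n + 1),
      (Pi.single i 1 : Fin (n + 1) → DualNumber k) = ι ∘ Pi.single i 1 := by
    intro i
    funext j
    simp only [Function.comp_apply, Pi.single_apply]
    split_ifs <;> simp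
  have hι : ∀ (i : Fin (n + 1)) (F : MvPolynomial (Fin (n + 1)) k),
      aeval (Pi.single i 1 : Fin (n + 1) → DualNumber k) F = ι (eval (Pi.single i 1) F) := by
    intro i F
    rw [hsingle, aeval_algebraMap_apply]
    rfl
  have taylor : ∀ F : MvPolynomial (Fin (n + 1)) k,
      aeval (Pi.single a 1 + Pi.single 0 e : Fin (n + 1) → DualNumber k) F =
        ι (eval (Pi.single a 1) F) + e * ι (eval (Pi.single a 1) (pderiv 0 F)) := by
    intro F
    obtain ⟨r, hr⟩ := exists_aeval_add_single F (Pi.single a 1) 0 e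
    rw [hr, he, zero_mul, add_zero, hι, hι]
  set x : Fin (n + 1) → DualNumber k := Pi.single a 1 + Pi.single 0 e with hx
  have hGa := D.G_ev_single hH
  set u : DualNumber k := ι (eval (Pi.single 0 1) D.d) +
    e * ι (eval (Pi.single a 1) (pderiv 0 (D.G 0))) with hu
  -- If the tangent vector vanished, `G(x)` would remain on the line of `e_0`.
  have hG : (fun j => aeval x (D.G j)) = u • Pi.single 0 1 := by
    funext j
    rw [taylor]
    have h1 : eval (Pi.single a 1) (D.G j) = _ := congrFun hGa j
    rw [h1]
    rcases eq_or_ne j 0 with rfl | hj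
    · simp [hu]
    · have h2 := congrFun h0 j
      simp only [tangent, if_neg hj, Pi.zero_apply] at h2
      simp [hj, h2]
  have hH0 : eval (Pi.single 0 1) (D.H 0) = 0 := by
    have h1 : eval (Pi.single 0 1) (D.H 0) = _ := congrFun hH 0
    rw [h1, Pi.single_eq_of_ne ha.symm]
  -- Then `H_0(G(x))` is a multiple of `H_0(e_0) = (e_a)_0 = 0`.
  have h1 : aeval x (bind₁ D.G (D.H 0)) = 0 := by
    rw [aeval_bind₁, hG, aeval_smul_of_isHomogeneous (D.homogH 0), hι, hH0, map_zero, mul_zero]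
  have h2 : bind₁ D.G (D.H 0) = D.c * X 0 := D.HG 0
  have hx0 : x 0 = e := by simp [hx, ha.symm]
  -- On the other hand `H_0(G(x)) = c(x) x_0 = c(x) ε = c(e_a) ε`, so `c(e_a) = 0`.
  rw [h2, map_mul, aeval_X, hx0, taylor, add_mul, mul_right_comm, ← pow_two, he, zero_mul,
    add_zero] at h1
  have h3 := congrArg TrivSqZeroExt.snd h1
  have h4 : eval (Pi.single a 1) D.c = 0 := by
    simpa [ι, e, TrivSqZeroExt.algebraMap_eq_inl] using h3
  -- This is impossible because `c(e_a) = c(H(e_0)) = d(e_0) ^ degH`.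
  have h5 := D.symm.eval_d_ev (v := Pi.single 0 1) (by simp) hd
  change eval (D.H.ev _) D.c = eval _ D.d ^ D.degH at h5
  rw [hH, h4] at h5
  exact pow_ne_zero _ hd h5.symm

end InversePair

/-! ### Some linear groups -/

/-- The elementary matrix `1 + c E_{ij}`. -/
def elem {ι R : Type*} [Fintype ι] [DecidableEq ι] [CommRing R] {i j : ι} (hij : i ≠ j) (c : R) :
    Matrix.GeneralLinearGroup ι R :=
  Matrix.SpecialLinearGroup.toGL (Matrix.SpecialLinearGroup.transvection hij c)

theorem elem_val {ι R : Type*} [Fintype ι] [DecidableEq ι] [CommRing R] {i j : ι} (hij : i ≠ j)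
    (c : R) : (elem hij c).1 = Matrix.transvection i j c := rfl

theorem transvection_mulVec {ι R : Type*} [Fintype ι] [DecidableEq ι] [CommRing R] (i j : ι)
    (c : R) (v : ι → R) : (Matrix.transvection i j c).mulVec v = v + Pi.single i (c * v j) := by
  rw [Matrix.transvection, Matrix.add_mulVec, Matrix.one_mulVec, Matrix.single_mulVec]
  congr 1

theorem elem_inv {ι R : Type*} [Fintype ι] [DecidableEq ι] [CommRing R] {i j : ι} (hij : i ≠ j)
    (c : R) : (elem hij c)⁻¹ = elem hij (-c) := by
  rw [elem, elem, ← map_inv, Matrix.SpecialLinearGroup.transvection_inv]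

theorem vecMulVec_single_sq {R : Type*} [CommRing R] {w : Fin (n + 1) → R} (hw : w 0 = 0) :
    Matrix.vecMulVec w (Pi.single 0 1 : Fin (n + 1) → R) *
      Matrix.vecMulVec w (Pi.single 0 1 : Fin (n + 1) → R) = 0 := by
  rw [Matrix.vecMulVec_mul_vecMulVec]
  simp [hw, Matrix.vecMulVec_zero]

/-- The matrix of the translation `v ↦ v + v_0 w`, for `w_0 = 0`. -/
def shear {R : Type*} [CommRing R] (w : Fin (n + 1) → R) (hw : w 0 = 0) :
    Matrix.GeneralLinearGroup (Fin (n + 1)) R where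
  val := 1 + Matrix.vecMulVec w (Pi.single 0 1 : Fin (n + 1) → R)
  inv := 1 - Matrix.vecMulVec w (Pi.single 0 1 : Fin (n + 1) → R)
  val_inv := by
    rw [add_mul, mul_sub, mul_sub, vecMulVec_single_sq hw]
    simp
  inv_val := by
    rw [sub_mul, mul_add, mul_add, vecMulVec_single_sq hw]
    simp

theorem shear_mulVec {R : Type*} [CommRing R] (w : Fin (n + 1) → R) (hw : w 0 = 0)
    (v : Fin (n + 1) → R) : (shear w hw).1.mulVec v = v + v 0 • w := by
  funext i
  simp [shear, Matrix.add_mulVec, Matrix.vecMulVec_mulVec]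

/-- The dilation `(x_0, t x_1, …, t x_n)` as a matrix. -/
def dilationGL (n : ℕ) (t : kˣ) : Matrix.GeneralLinearGroup (Fin (n + 1)) k where
  val := Matrix.diagonal fun i => if i = 0 then 1 else (t : k)
  inv := Matrix.diagonal fun i => if i = 0 then 1 else (t⁻¹ : kˣ)
  val_inv := by
    rw [Matrix.diagonal_mul_diagonal, ← Matrix.diagonal_one]
    congr 1
    funext i
    split_ifs <;> simp
  inv_val := by
    rw [Matrix.diagonal_mul_diagonal, ← Matrix.diagonal_one]
    congr 1
    funext i
    split_ifs <;> simp

theorem dilationGL_inv_val (t : kˣ) : (dilationGL n t)⁻¹.1 =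
    Matrix.diagonal fun i => if i = 0 then 1 else ((t⁻¹ : kˣ) : k) := rfl

theorem specVec_linVec (t : k) (M : Matrix (Fin (n + 1)) (Fin (n + 1)) (Polynomial k)) :
    specVec t (linVec M) = linVec (M.map (Polynomial.eval t)) := by
  funext i
  simp [specVec, spec, linVec]

theorem transvection_map_eval {ι : Type*} [DecidableEq ι] (i j : ι) (c : Polynomial k) (t : k) :
    (Matrix.transvection i j c).map (Polynomial.eval t) = Matrix.transvection i j (c.eval t) := by
  ext x y
  simp only [Matrix.transvection, Matrix.map_apply, Matrix.add_apply, Polynomial.eval_add,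
    Matrix.one_apply, Matrix.single_apply]
  split_ifs <;> simp

/-! ### The family -/

variable [Infinite k]

namespace InversePair

variable (D : InversePair n k) {a : Fin (n + 1)} {θ : Cr n k}

/-- The vector `conjVec` computes `θ (1 + s t E_{0a}) θ⁻¹ h_t`. Applying `h_t⁻¹` divides the
components other than the first by `t`, which is how `W` was defined. -/
theorem represents_conj (hG : Represents D.G θ) (hH : Represents D.H θ⁻¹) (ha : (0 : Fin (n + 1)) ≠ a)
    (s : k) {W : PolyVec n (Polynomial k)} (hW0 : W 0 = D.conjVec a s 0)
    (hWj : ∀ j, j ≠ 0 → C Polynomial.X * W j = D.conjVec a s j) (t : kˣ) :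
    Represents (specVec (t : k) W) ((lin n k (dilationGL n t))⁻¹ *
      (θ * lin n k (elem ha (s * t)) * θ⁻¹) * lin n k (dilationGL n t)) := by
  have h := (((represents_lin (dilationGL n t)⁻¹).mul
    ((hG.mul (represents_lin (elem ha (s * t)))).mul hH))).mul (represents_lin (dilationGL n t))
  rw [map_inv] at h
  convert h using 1
  have hV : ∀ v : Fin (n + 1) → k, (specVec (t : k) (D.conjVec a s)).ev v =
      D.G.ev ((elem ha (s * t)).1.mulVec (D.H.ev ((dilationGL n t).1.mulVec v))) := by
    intro v
    funext j
    change eval v (spec (t : k) (aeval _ (D.G j))) = eval _ (D.G j)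
    rw [eval_spec_aeval]
    have hz : (fun i => eval v (spec (t : k) (dilation n k i))) = (dilationGL n t).1.mulVec v := by
      funext i
      rcases eq_or_ne i 0 with rfl | hi
      · simp [dilation, spec, dilationGL, Matrix.mulVec_diagonal]
      · simp [dilation, spec, dilationGL, Matrix.mulVec_diagonal, hi]
    have hy : ∀ i, eval v (spec (t : k) (D.dilatedH i)) =
        D.H.ev ((dilationGL n t).1.mulVec v) i := by
      intro i
      rw [dilatedH, eval_spec_aeval, hz]
      rfl
    congr 2
    funext i
    rw [elem_val, transvection_mulVec, Pi.add_apply, Pi.add_apply, map_add, map_add, hy]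
    congr 1
    rcases eq_or_ne i 0 with rfl | hi
    · rw [Pi.single_eq_same, Pi.single_eq_same, increment, map_mul, map_mul, hy]
      simp [spec]
    · simp [hi]
  funext j
  refine MvPolynomial.funext fun v => ?_
  change _ = PolyVec.ev _ v j
  simp only [PolyVec.ev_comp, ev_linVec, ← hV]
  rw [dilationGL_inv_val, Matrix.mulVec_diagonal]
  change eval v (spec (t : k) (W j)) = _ * eval v (spec (t : k) (D.conjVec a s j))
  rcases eq_or_ne j 0 with rfl | hj
  · rw [hW0, if_pos rfl, one_mul]
  · rw [← hWj j hj, if_neg hj, map_mul, map_mul]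
    simp [spec]

/-- On the chart `v 0 = 1` the specialized vector is `d(e_0) (v + w)`, a nonzero multiple of the
image of `v` under the translation. -/
theorem represents_limit {s : k} (hd : eval (Pi.single 0 1) D.d ≠ 0)
    {W : PolyVec n (Polynomial k)} {m : ℕ} (hW : W.Homog m)
    (hlim : ∀ v : Fin (n + 1) → k, v 0 = 1 →
        (specVec 0 W).ev v = eval (Pi.single 0 1) D.d • v + s • D.tangent a)
    {w : Fin (n + 1) → k} (hw : w 0 = 0) (hws : eval (Pi.single 0 1) D.d • w = s • D.tangent a) :
    Represents (specVec 0 W) (lin n k (shear w hw)) := by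
  refine Represents.of_chart (specVec_homog hW 0) 0 (W := univ) isOpen_univ
    ((linPair (shear w hw)).toPartialIso.source_nonempty.mono (subset_univ _)) (linPair_source _).ge
    fun v hv hv0 _ => ?_
  have h1 : (linVec (shear w hw).1).ev v ≠ 0 := (linPair (shear w hw)).ev_ne_zero hv (by
    change eval v 1 ≠ 0
    simp)
  have h2 : (specVec 0 W).ev v = eval (Pi.single 0 1) D.d • (linVec (shear w hw).1).ev v := by
    rw [hlim v hv0, ev_linVec, shear_mulVec, hv0, one_smul, smul_add, hws]
  refine ⟨by rw [h2]; exact smul_ne_zero hd h1, ?_⟩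
  refine (mapOf_pt (linVec_homog _) hv h1).trans (pt_eq_pt_iff.2
    ⟨(eval (Pi.single 0 1) D.d)⁻¹, inv_ne_zero hd, ?_⟩)
  rw [h2, inv_smul_smul₀ hd]

/-- A normal closed subgroup containing `θ` contains the translations obtained as limits of
conjugates of the commutators of `θ` with elementary matrices. -/
theorem exists_shear_mem (hn : 1 ≤ n) (hG : Represents D.G θ) (hH : Represents D.H θ⁻¹)
    (ha : (0 : Fin (n + 1)) ≠ a) (hHe : D.H.ev (Pi.single 0 1) = Pi.single a 1)
    (hd : eval (Pi.single 0 1) D.d ≠ 0) {N : Subgroup (Cr n k)} (hN : N.Normal)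
    (hcl : IsClosed (N : Set (Cr n k))) (hθ : θ ∈ N) :
    ∃ (w : Fin (n + 1) → k) (hw : w 0 = 0), w ≠ 0 ∧ lin n k (shear w hw) ∈ N := by
  classical
  obtain ⟨W, hW, hW0, hWj, hlim⟩ := D.exists_limit a 1 hHe
  -- The value `s = -1` provides the inverses, as `(1 + t E_{0a})⁻¹ = 1 - t E_{0a}`. A morphism from
  -- the line requires polynomial vectors for the inverses as well.
  obtain ⟨W', hW', hW0', hWj', hlim'⟩ := D.exists_limit a (-1) hHe
  set w := (eval (Pi.single 0 1) D.d)⁻¹ • D.tangent a with hwdef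
  have hw : w 0 = 0 := by
    rw [hwdef, Pi.smul_apply, D.tangent_zero, smul_zero]
  have hwn : (-w) 0 = 0 := by rw [Pi.neg_apply, hw, neg_zero]
  have hwne : w ≠ 0 := smul_ne_zero (inv_ne_zero hd) (D.tangent_ne_zero a ha.symm hHe hd)
  refine ⟨w, hw, hwne, ?_⟩
  have hneg : (lin n k (shear w hw))⁻¹ = lin n k (shear (-w) hwn) := by
    rw [← map_inv]
    congr 1
    ext1
    change 1 - _ = 1 + _
    rw [Matrix.neg_vecMulVec, sub_eq_add_neg]
  have hlimR := D.represents_limit hd hW hlim hw (by rw [hwdef, smul_inv_smul₀ hd, one_smul])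
  have hlimR' := D.represents_limit hd hW' hlim' hwn
    (by rw [hwdef, smul_neg, smul_inv_smul₀ hd, neg_smul, one_smul])
  let P : k → Cr n k := fun t => if ht : t = 0 then lin n k (shear w hw) else
    (lin n k (dilationGL n (Units.mk0 t ht)))⁻¹ *
      (θ * lin n k (elem ha t) * θ⁻¹) * lin n k (dilationGL n (Units.mk0 t ht))
  have hP0 : P 0 = lin n k (shear w hw) := dif_pos rfl
  have hPt : ∀ t (ht : t ≠ 0), P t = (lin n k (dilationGL n (Units.mk0 t ht)))⁻¹ *
      (θ * lin n k (elem ha t) * θ⁻¹) * lin n k (dilationGL n (Units.mk0 t ht)) :=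
    fun t ht => dif_neg ht
  have hR : ∀ t, Represents (specVec t W) (P t) := by
    intro t
    rcases eq_or_ne t 0 with rfl | ht
    · rwa [hP0]
    · rw [hPt t ht]
      simpa using D.represents_conj hG hH ha 1 hW0 hWj (Units.mk0 t ht)
  have hR' : ∀ t, Represents (specVec t W') (P t)⁻¹ := by
    intro t
    rcases eq_or_ne t 0 with rfl | ht
    · rwa [hP0, hneg]
    · rw [hPt t ht]
      have h1 := D.represents_conj hG hH ha (-1) hW0' hWj' (Units.mk0 t ht)
      have h2 : lin n k (elem ha (-1 * ((Units.mk0 t ht : kˣ) : k))) = (lin n k (elem ha t))⁻¹ := by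
        rw [← map_inv, elem_inv, Units.val_mk0, neg_one_mul]
      rw [h2] at h1
      have h3 : Represents (specVec t W') _ := h1
      convert h3 using 1
      group
  let L : ∀ (_ : Polynomial k), Matrix (Fin (n + 1)) (Fin (n + 1)) (Polynomial k) := fun c =>
    Matrix.transvection 0 a c
  -- `P t` is only conjugate to an elementary matrix and need not lie in `N`. The extra factor,
  -- trivial at `t = 0`, replaces it by a conjugate of a commutator involving `θ`.
  let Q : k → Cr n k := fun t => P t * lin n k (elem ha (-t ^ 2))
  have hQ : ∀ t, Represents (specVec t (W.comp (linVec (L (-Polynomial.X ^ 2))))) (Q t) := by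
    intro t
    rw [specVec_comp, specVec_linVec, transvection_map_eval]
    have h1 := (hR t).mul (represents_lin (elem ha (-t ^ 2)))
    simpa [elem_val] using h1
  have hQ' : ∀ t, Represents (specVec t ((linVec (L (Polynomial.X ^ 2))).comp W')) (Q t)⁻¹ := by
    intro t
    rw [specVec_comp, specVec_linVec, transvection_map_eval]
    have h1 := (represents_lin (elem ha (t ^ 2))).mul (hR' t)
    have h2 : (Q t)⁻¹ = lin n k (elem ha (t ^ 2)) * (P t)⁻¹ := by
      rw [mul_inv_rev, ← map_inv, elem_inv, neg_neg]
    rw [h2]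
    simpa [elem_val] using h1
  have h0 := mem_of_isClosed_of_represents hn hcl (hW.comp (linVec_homog _))
    ((linVec_homog _).comp hW') hQ hQ' fun t ht => ?_
  · have h1 : Q 0 = lin n k (shear w hw) := by
      have h2 : elem ha (-(0 : k) ^ 2) = 1 := by
        ext1
        simp [elem_val]
      change P 0 * lin n k (elem ha (-(0 : k) ^ 2)) = _
      rw [h2, map_one, mul_one, hP0]
    rwa [h1] at h0
  · set h := lin n k (dilationGL n (Units.mk0 t ht)) with hh
    set α := lin n k (elem ha t) with hα
    -- The exponent `2` comes from this relation: `h_t (1 - t² E_{0a}) = (1 - t E_{0a}) h_t`,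
    -- because `h_t` multiplies the coordinate `a` by `t` and fixes the coordinate `0`.
    have hL : h * lin n k (elem ha (-t ^ 2)) = α⁻¹ * h := by
      rw [hα, ← map_inv, elem_inv, hh, ← map_mul, ← map_mul]
      congr 1
      ext1
      refine Matrix.ext_of_mulVec_single fun i => ?_
      rw [Units.val_mul, Units.val_mul, ← Matrix.mulVec_mulVec, ← Matrix.mulVec_mulVec, elem_val,
        elem_val, transvection_mulVec, transvection_mulVec]
      funext j
      simp only [dilationGL, Matrix.mulVec_diagonal, Pi.add_apply, Units.val_mk0, if_neg ha.symm]
      rcases eq_or_ne j 0 with rfl | hj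
      · simp only [Pi.single_eq_same, if_pos]
        ring
      · simp only [Pi.single_eq_of_ne hj, add_zero]
    have h1 : Q t = h⁻¹ * (θ * (α * θ⁻¹ * α⁻¹)) * h := by
      have h2 : P t = h⁻¹ * (θ * α * θ⁻¹) * h := hPt t ht
      change P t * _ = _
      rw [h2, mul_assoc _ h, hL]
      group
    change Q t ∈ N
    rw [h1]
    -- The commutator is the product of `θ` and a conjugate of `θ⁻¹`, hence in `N`; so is its
    -- conjugate by `h⁻¹`.
    have h2 := hN.conj_mem _ (N.mul_mem hθ (hN.conj_mem _ (N.inv_mem hθ) α)) h⁻¹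
    rwa [inv_inv] at h2

end InversePair

end Limit

end Cremona
end

noncomputable section

namespace Cremona

open MvPolynomial

/-! ## Normal subgroups of the linear group -/

section LinearGroup

theorem exists_perm_eq {ι : Type*} [DecidableEq ι] {i j l m : ι} (hij : i ≠ j) (hlm : l ≠ m) :
    ∃ σ : Equiv.Perm ι, σ l = i ∧ σ m = j := by
  have h : Equiv.swap l i m ≠ i := fun h => hlm ((Equiv.swap l i).injective
    ((Equiv.swap_apply_left l i).trans h.symm))
  refine ⟨Equiv.swap (Equiv.swap l i m) j * Equiv.swap l i, ?_, ?_⟩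
  · rw [Equiv.Perm.mul_apply, Equiv.swap_apply_left, Equiv.swap_apply_of_ne_of_ne h.symm hij]
  · rw [Equiv.Perm.mul_apply, Equiv.swap_apply_left]

variable {ι F : Type*} [Fintype ι] [DecidableEq ι] [Field F]

/-- Diagonal matrices. -/
def diagGL (d : ι → Fˣ) : Matrix.GeneralLinearGroup ι F where
  val := Matrix.diagonal fun i => (d i : F)
  inv := Matrix.diagonal fun i => ((d i)⁻¹ : Fˣ)
  val_inv := by
    rw [Matrix.diagonal_mul_diagonal, ← Matrix.diagonal_one]
    congr 1
    funext i
    simp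
  inv_val := by
    rw [Matrix.diagonal_mul_diagonal, ← Matrix.diagonal_one]
    congr 1
    funext i
    simp

theorem diagGL_mulVec (d : ι → Fˣ) (v : ι → F) (i : ι) :
    (diagGL d).1.mulVec v i = d i * v i := Matrix.mulVec_diagonal _ _ _

/-- Permutation matrices. -/
def permGL (F : Type*) [Field F] (σ : Equiv.Perm ι) : Matrix.GeneralLinearGroup ι F where
  val := σ.permMatrix F
  inv := σ⁻¹.permMatrix F
  val_inv := by rw [← Matrix.permMatrix_mul, inv_mul_cancel, Matrix.permMatrix_one]
  inv_val := by rw [← Matrix.permMatrix_mul, mul_inv_cancel, Matrix.permMatrix_one]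

theorem permGL_mulVec (σ : Equiv.Perm ι) (v : ι → F) : (permGL F σ).1.mulVec v = v ∘ σ :=
  Matrix.permMatrix_mulVec _

theorem GL_ext_mulVec {A B : Matrix.GeneralLinearGroup ι F}
    (h : ∀ v, A.1.mulVec v = B.1.mulVec v) : A = B :=
  Units.ext (Matrix.ext_of_mulVec_single fun _ => h _)

theorem GL_mul_mulVec (A B : Matrix.GeneralLinearGroup ι F) (v : ι → F) :
    (A * B).1.mulVec v = A.1.mulVec (B.1.mulVec v) := by
  rw [Units.val_mul, Matrix.mulVec_mulVec]

theorem elem_mulVec {i j : ι} (hij : i ≠ j) (c : F) (v : ι → F) :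
    (elem hij c).1.mulVec v = v + Pi.single i (c * v j) := transvection_mulVec _ _ _ _

variable {N : Subgroup (Matrix.GeneralLinearGroup ι F)}

/-- Writing the conjugation `R = A B A⁻¹` in this form avoids computing inverse matrices. -/
theorem mem_of_mul_eq (hN : N.Normal) {A B R : Matrix.GeneralLinearGroup ι F} (hB : B ∈ N)
    (h : R * A = A * B) : R ∈ N := by
  rw [eq_mul_inv_of_mul_eq h]
  exact hN.conj_mem _ hB A

/-- Conjugation by permutation matrices moves the pair of indices, and conjugation by diagonal
matrices rescales the coefficient. Normality under `GL`, and not only under `SL`, makes every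
nonzero coefficient accessible. -/
theorem elem_mem_of_elem_mem (hN : N.Normal) {i j : ι} (hij : i ≠ j) {c : F} (hc : c ≠ 0)
    (h : elem hij c ∈ N) {l m : ι} (hlm : l ≠ m) (b : F) : elem hlm b ∈ N := by
  obtain ⟨σ, rfl, rfl⟩ := exists_perm_eq hij hlm
  have h1 : elem hlm c ∈ N := by
    refine mem_of_mul_eq hN (A := permGL F σ) h (GL_ext_mulVec fun v => ?_)
    rw [GL_mul_mulVec, GL_mul_mulVec, elem_mulVec, elem_mulVec, permGL_mulVec, permGL_mulVec]
    funext x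
    simp only [Pi.add_apply, Function.comp_apply, Pi.single_apply, σ.injective.eq_iff]
  rcases eq_or_ne b 0 with rfl | hb
  · have h2 : elem hlm (0 : F) = 1 := by
      rw [elem, Matrix.SpecialLinearGroup.transvection_coeff_zero, map_one]
    rw [h2]
    exact N.one_mem
  · refine mem_of_mul_eq hN
      (A := diagGL (Function.update 1 l (Units.mk0 (b / c) (div_ne_zero hb hc)))) h1
      (GL_ext_mulVec fun v => ?_)
    rw [GL_mul_mulVec, GL_mul_mulVec, elem_mulVec, elem_mulVec]
    funext x
    simp only [Pi.add_apply, diagGL_mulVec, Function.update_of_ne hlm.symm, Pi.one_apply,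
      Units.val_one, one_mul]
    rcases eq_or_ne x l with rfl | hx
    · simp only [Function.update_self, Pi.single_eq_same, Units.val_mk0]
      field_simp
    · simp only [Pi.single_eq_of_ne hx, add_zero]

/-- A normal subgroup of the linear group containing a nontrivial elementary matrix contains the
special linear group. -/
theorem toGL_mem_of_elem_mem (hN : N.Normal) {i j : ι} (hij : i ≠ j) {c : F} (hc : c ≠ 0)
    (h : elem hij c ∈ N) (M : Matrix.SpecialLinearGroup ι F) :
    Matrix.SpecialLinearGroup.toGL M ∈ N := by
  have hel : ∀ {l m : ι} (hlm : l ≠ m) (b : F), elem hlm b ∈ N := fun hlm b =>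
    elem_mem_of_elem_mem hN hij hc h hlm b
  have : Nontrivial ι := ⟨i, j, hij⟩
  refine Matrix.SpecialLinearGroup.diagonal_transvection_induction'
    (fun M => Matrix.SpecialLinearGroup.toGL M ∈ N) M (fun l m hlm b hb => ?_)
    (fun l m hlm b => hel hlm b) (fun A B hA hB => by rw [map_mul]; exact N.mul_mem hA hB)
  -- `SL` is generated by transvections and the matrices `diag(b, b⁻¹)` in two indices. On these
  -- indices `S` is the Weyl element with rows `(0, 1)` and `(-1, 0)`. With `D = diag(b, 1)` one has
  -- `diag(b, b⁻¹) S = D S D⁻¹`, so `diag(b, b⁻¹)` is a product of elements of `N`.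
  set S : Matrix.GeneralLinearGroup ι F := elem hlm 1 * elem hlm.symm (-1) * elem hlm 1 with hS
  have hSN : S ∈ N := N.mul_mem (N.mul_mem (hel _ _) (hel _ _)) (hel _ _)
  set D : Matrix.GeneralLinearGroup ι F := diagGL (Function.update 1 l (Units.mk0 b hb)) with hD
  set R := Matrix.SpecialLinearGroup.toGL (Matrix.SpecialLinearGroup.diag2n hlm b hb) with hR
  have hRS : R * S ∈ N := by
    refine mem_of_mul_eq hN (A := D) hSN (GL_ext_mulVec fun v => ?_)
    have hRv : ∀ (v : ι → F) x, R.1.mulVec v x =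
        (if x = l then b else if x = m then b⁻¹ else 1) * v x := fun v x =>
      Matrix.mulVec_diagonal _ _ _
    funext x
    simp only [hS, hD, GL_mul_mulVec, elem_mulVec, hRv, diagGL_mulVec, Pi.add_apply]
    rcases eq_or_ne x l with rfl | hxl
    · simp [hlm, hlm.symm]
    · rcases eq_or_ne x m with rfl | hxm
      · simp [hlm.symm]
        field_simp
      · simp [hxl, hxm]
  have h2 := N.mul_mem hRS (N.inv_mem hSN)
  rwa [mul_inv_cancel_right] at h2

variable {n : ℕ}

/-- The commutator of a translation with an elementary matrix. -/
theorem elem_mem_of_shear_mem (hn : 2 ≤ n)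
    {N : Subgroup (Matrix.GeneralLinearGroup (Fin (n + 1)) F)} (hN : N.Normal)
    {w : Fin (n + 1) → F} {hw : w 0 = 0} (hw0 : w ≠ 0) (h : shear w hw ∈ N) :
    ∃ (i : Fin (n + 1)) (hi : i ≠ 0) (c : F), c ≠ 0 ∧ elem hi c ∈ N := by
  obtain ⟨j, hj⟩ := Function.ne_iff.1 hw0
  have hj0 : j ≠ 0 := by
    rintro rfl
    exact hj hw
  -- An index different from `0` and `j` exists because there are at least three coordinates.
  obtain ⟨i, hi⟩ : ∃ i : Fin (n + 1), i ∉ ({0, j} : Finset (Fin (n + 1))) := by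
    by_contra! h1
    have h2 := Finset.card_le_card (fun x _ => h1 x : Finset.univ ⊆ {0, j})
    have h3 := Finset.card_le_two (a := (0 : Fin (n + 1))) (b := j)
    rw [Finset.card_univ, Fintype.card_fin] at h2
    omega
  simp only [Finset.mem_insert, Finset.mem_singleton, not_or] at hi
  refine ⟨i, hi.1, w j, hj, ?_⟩
  -- Conjugating by `1 + E_{ij}` replaces `w` by `w + w_j e_i`; the quotient of the two translations
  -- is the elementary matrix `1 + w_j E_{i0}`.
  have h1 : elem hi.1 (w j) * shear w hw ∈ N := by
    refine mem_of_mul_eq hN (A := elem hi.2 (1 : F)) h (GL_ext_mulVec fun v => ?_)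
    rw [GL_mul_mulVec, GL_mul_mulVec, GL_mul_mulVec, elem_mulVec, elem_mulVec, elem_mulVec,
      shear_mulVec, shear_mulVec]
    funext x
    simp only [Pi.add_apply, Pi.smul_apply, smul_eq_mul, hw, mul_zero, add_zero,
      Pi.single_eq_of_ne (Ne.symm hi.1)]
    rcases eq_or_ne x i with rfl | hx
    · simp only [Pi.single_eq_same]
      ring
    · simp only [Pi.single_eq_of_ne hx]
      ring
  have h2 := N.mul_mem h1 (N.inv_mem h)
  rwa [mul_inv_cancel_right] at h2

end LinearGroup

/-! ### The linear group inside a closed normal subgroup -/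

section Normal

variable {k : Type u} [Field k] {n : ℕ}

/-- The isomorphism between the two planes spanned by these pairs extends to an automorphism of the
whole space. -/
theorem exists_GL_mulVec_single {a : Fin (n + 1)} (ha : (0 : Fin (n + 1)) ≠ a)
    {q p : Fin (n + 1) → k} (h : LinearIndependent k ![q, p]) :
    ∃ g : Matrix.GeneralLinearGroup (Fin (n + 1)) k,
      g.1.mulVec (Pi.single 0 1) = q ∧ g.1.mulVec (Pi.single a 1) = p := by
  have he : LinearIndependent k ![(Pi.single 0 1 : Fin (n + 1) → k), Pi.single a 1] := by
    rw [LinearIndependent.pair_iff]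
    intro s t hst
    have h0 := congrFun hst 0
    have h1 := congrFun hst a
    simp [ha] at h0
    simp [ha.symm] at h1
    exact ⟨h0, h1⟩
  let f := he.linearCombinationEquiv.symm ≪≫ₗ h.linearCombinationEquiv
  have : FiniteDimensional k (Submodule.span k
      (Set.range ![(Pi.single 0 1 : Fin (n + 1) → k), Pi.single a 1])) :=
    FiniteDimensional.span_of_finite k (Set.finite_range _)
  obtain ⟨g, hg⟩ := Submodule.exists_linearEquiv_restrict_eq f
  refine ⟨⟨LinearMap.toMatrix' g.toLinearMap, LinearMap.toMatrix' g.symm.toLinearMap, ?_, ?_⟩,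
    ?_, ?_⟩
  · rw [← LinearMap.toMatrix'_comp, LinearEquiv.comp_symm, LinearMap.toMatrix'_id]
  · rw [← LinearMap.toMatrix'_comp, LinearEquiv.symm_comp, LinearMap.toMatrix'_id]
  · have h1 : (he.linearCombinationEquiv (Finsupp.single 0 1) : Fin (n + 1) → k) =
        Pi.single 0 1 := by simp
    rw [LinearMap.toMatrix'_mulVec, LinearEquiv.coe_coe]
    conv_lhs => rw [← h1]
    rw [← hg]
    simp [f]
  · have h1 : (he.linearCombinationEquiv (Finsupp.single 1 1) : Fin (n + 1) → k) =
        Pi.single a 1 := by simp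
    rw [LinearMap.toMatrix'_mulVec, LinearEquiv.coe_coe]
    conv_lhs => rw [← h1]
    rw [← hg]
    simp [f]

variable [Infinite k]

/-- A nontrivial birational transformation is conjugate under `PGL` to one whose inverse is defined
at `e_0` and sends it to `e_a`. -/
theorem exists_conj_inversePair (hn : 1 ≤ n) {θ : Cr n k} (hθ : θ ≠ 1) {a : Fin (n + 1)}
    (ha : (0 : Fin (n + 1)) ≠ a) : ∃ (g : Matrix.GeneralLinearGroup (Fin (n + 1)) k)
      (D : InversePair n k), Represents D.G ((lin n k g)⁻¹ * θ * lin n k g) ∧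
        Represents D.H ((lin n k g)⁻¹ * θ * lin n k g)⁻¹ ∧
        D.H.ev (Pi.single 0 1) = Pi.single a 1 ∧ eval (Pi.single 0 1) D.d ≠ 0 := by
  obtain ⟨d, G, dG, hG⟩ := exists_represents θ
  obtain ⟨d', H, dH, hH⟩ := exists_represents θ⁻¹
  obtain ⟨D, rfl, rfl, -, -⟩ := hG.exists_inversePair hn hH dG dH
  -- As `θ⁻¹ ≠ 1`, some minor of `H` against the variables is a nonzero polynomial. A general `q`
  -- has this minor nonzero, so that `H(q)` is not collinear with `q`, and also `d(q) ≠ 0`.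
  obtain ⟨i, j, hij⟩ : ∃ i j, D.H i * X j ≠ D.H j * X i := by
    by_contra! h
    exact hθ (inv_eq_one.1 (hH.unique Represents.one h))
  obtain ⟨q, hq⟩ := exists_eval_ne_zero_of_ne_zero
    (mul_ne_zero D.d_ne_zero (sub_ne_zero.2 hij))
  simp only [map_mul, map_sub, eval_X, mul_ne_zero_iff] at hq
  obtain ⟨hdq, hcross⟩ := hq
  have hli : LinearIndependent k ![q, D.H.ev q] := by
    rw [LinearIndependent.pair_iff]
    intro s t hst
    have h1 : ∀ l, s * q l + t * eval q (D.H l) = 0 := fun l => by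
      simpa [PolyVec.ev] using congrFun hst l
    constructor
    · refine (mul_eq_zero.1 ?_).resolve_right hcross
      linear_combination (eval q (D.H i)) * h1 j - (eval q (D.H j)) * h1 i
    · refine (mul_eq_zero.1 ?_).resolve_right hcross
      linear_combination (q j) * h1 i - (q i) * h1 j
  obtain ⟨g, hg0, hga⟩ := exists_GL_mulVec_single ha hli
  have hinv : ∀ v, g⁻¹.1.mulVec (g.1.mulVec v) = v := fun v => by
    rw [Matrix.mulVec_mulVec, ← Units.val_mul, inv_mul_cancel, Units.val_one, Matrix.one_mulVec]
  have hG' := ((represents_lin g⁻¹).mul hG).mul (represents_lin g)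
  have hH' := ((represents_lin g⁻¹).mul hH).mul (represents_lin g)
  rw [map_inv] at hG' hH'
  have hinv' : (lin n k g)⁻¹ * θ⁻¹ * lin n k g = ((lin n k g)⁻¹ * θ * lin n k g)⁻¹ := by group
  rw [hinv'] at hH'
  obtain ⟨D', hDG, hDH, -, -⟩ := hG'.exists_inversePair hn hH'
    (((linVec_homog _).comp dG).comp (linVec_homog _))
    (((linVec_homog _).comp dH).comp (linVec_homog _))
  have hHe : D'.H.ev (Pi.single 0 1) = Pi.single a 1 := by
    rw [hDH, PolyVec.ev_comp, PolyVec.ev_comp, ev_linVec, ev_linVec, hg0, ← hga, hinv]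
  refine ⟨g, D', hDG ▸ hG', hDH ▸ hH', hHe, ?_⟩
  -- Evaluating the composition of the conjugated vectors at `e_0` shows that the new `d` takes at
  -- `e_0` the value of the old one at `q = g e_0`.
  have h1 := D'.symm.H_ev_G (Pi.single 0 1)
  change D'.G.ev (D'.H.ev _) = eval _ D'.d • _ at h1
  have h2 := D.symm.H_ev_G q
  change D.G.ev (D.H.ev _) = eval _ D.d • _ at h2
  rw [hHe, hDG, PolyVec.ev_comp, PolyVec.ev_comp, ev_linVec, ev_linVec, hga, h2,
    Matrix.mulVec_smul, ← hg0, hinv] at h1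
  have h3 := congrFun h1 0
  simp only [Pi.smul_apply, Pi.single_eq_same, smul_eq_mul, mul_one] at h3
  rwa [← h3, hg0]

theorem exists_elem_mem (hn : 2 ≤ n) {N : Subgroup (Cr n k)} (hN : N.Normal) (hne : N ≠ ⊥)
    (hcl : IsClosed (N : Set (Cr n k))) : ∃ (i : Fin (n + 1)) (hi : i ≠ 0) (c : k), c ≠ 0 ∧
      lin n k (elem hi c) ∈ N := by
  obtain ⟨⟨θ, hθ⟩, hθ'⟩ := Subgroup.ne_bot_iff_exists_ne_one.1 hne
  have hθ1 : θ ≠ 1 := fun h => hθ' (Subtype.ext h)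
  have ha : (0 : Fin (n + 1)) ≠ Fin.last n := by
    intro h
    have h1 := congrArg Fin.val h
    simp at h1
    omega
  obtain ⟨g, D, hG, hH, hHe, hd⟩ := exists_conj_inversePair (by omega) hθ1 ha
  have hmem : (lin n k g)⁻¹ * θ * lin n k g ∈ N := by
    simpa using hN.conj_mem _ hθ (lin n k g)⁻¹
  obtain ⟨w, hw, hw0, h⟩ := D.exists_shear_mem (by omega) hG hH ha hHe hd hN hcl hmem
  exact elem_mem_of_shear_mem hn (hN.comap (lin n k)) hw0 h

theorem lin_toGL_mem (hn : 2 ≤ n) {N : Subgroup (Cr n k)} (hN : N.Normal) (hne : N ≠ ⊥)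
    (hcl : IsClosed (N : Set (Cr n k))) (M : Matrix.SpecialLinearGroup (Fin (n + 1)) k) :
    lin n k (Matrix.SpecialLinearGroup.toGL M) ∈ N := by
  obtain ⟨i, hi, c, hc, h⟩ := exists_elem_mem hn hN hne hcl
  exact toGL_mem_of_elem_mem (hN.comap (lin n k)) hi hc h M

theorem lin_scalar (a : kˣ) : lin n k (Matrix.GeneralLinearGroup.scalar _ a) = 1 :=
  lin_eq_one_iff.2 ⟨a, rfl⟩

/-- Determinants have `(n + 1)`-th roots in `k`, so every invertible matrix is a scalar times a
matrix of determinant one, and scalars act trivially. -/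
theorem lin_mem {k : Type u} [Field k] [IsAlgClosed k] (hn : 2 ≤ n) {N : Subgroup (Cr n k)}
    (hN : N.Normal) (hne : N ≠ ⊥) (hcl : IsClosed (N : Set (Cr n k)))
    (M : Matrix.GeneralLinearGroup (Fin (n + 1)) k) : lin n k M ∈ N := by
  obtain ⟨S, hS⟩ := Matrix.ProjectiveSpecialLinearGroup.toPGL_surj_of_roots
    (n := Fin (n + 1)) (R := k) (fun r => by
      obtain ⟨z, hz⟩ := IsAlgClosed.exists_pow_nat_eq (r : k) (n := Fintype.card (Fin (n + 1)))
        (by simp)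
      have hz0 : z ≠ 0 := by
        rintro rfl
        rw [zero_pow (by simp)] at hz
        exact r.ne_zero hz.symm
      exact ⟨Units.mk0 z hz0, Units.ext hz⟩) (Matrix.ProjGenLinGroup.mk M)
  obtain ⟨S, rfl⟩ := QuotientGroup.mk_surjective S
  obtain ⟨u, rfl⟩ := Matrix.ProjGenLinGroup.mk_eq_mk_iff.1 hS
  rw [map_mul, lin_scalar, mul_one]
  exact lin_toGL_mem hn hN hne hcl S

end Normal

end Cremona
end

noncomputable section

namespace Cremona

open MvPolynomial

/-! ### Factors of homogeneous polynomials -/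

section Homogeneous

variable {σ R : Type*} [CommRing R]

/-- The substitution `x ↦ t x`, with values in the polynomials in `t`. -/
def scaling (σ R : Type*) [CommRing R] :
    MvPolynomial σ R →ₐ[R] Polynomial (MvPolynomial σ R) :=
  aeval ((Polynomial.X : Polynomial (MvPolynomial σ R)) • fun i => Polynomial.C (X i))

theorem scaling_of_isHomogeneous {F : MvPolynomial σ R} {d : ℕ} (hF : F.IsHomogeneous d) :
    scaling σ R F = Polynomial.X ^ d * Polynomial.C F := by
  have h : aeval (fun i => Polynomial.C (X i) : σ → Polynomial (MvPolynomial σ R)) F =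
      Polynomial.C F := by
    have h1 : aeval (fun i => Polynomial.C (X i) : σ → Polynomial (MvPolynomial σ R)) =
        (Polynomial.CAlgHom (R := R) (A := MvPolynomial σ R)) := by
      ext i : 1
      simp
    rw [h1]
    rfl
  rw [scaling, aeval_smul_of_isHomogeneous hF, h]

theorem coeff_scaling (F : MvPolynomial σ R) (m : ℕ) :
    (scaling σ R F).coeff m = homogeneousComponent m F := by
  have h : scaling σ R F = ∑ i ∈ Finset.range (F.totalDegree + 1),
      Polynomial.X ^ i * Polynomial.C (homogeneousComponent i F) := by
    conv_lhs => rw [← sum_homogeneousComponent F]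
    rw [map_sum]
    exact Finset.sum_congr rfl fun i _ =>
      scaling_of_isHomogeneous (homogeneousComponent_isHomogeneous i F)
  rw [h, Polynomial.finsetSum_coeff]
  simp only [Polynomial.coeff_X_pow_mul', Polynomial.coeff_C]
  by_cases hm : m < F.totalDegree + 1
  · rw [Finset.sum_eq_single m]
    · simp
    · intro i _ hi
      split_ifs <;> first | rfl | omega
    · simp [hm]
  · rw [homogeneousComponent_eq_zero _ _ (by omega)]
    refine Finset.sum_eq_zero fun i hi => ?_
    rw [Finset.mem_range] at hi
    split_ifs <;> first | rfl | omega

theorem scaling_ne_zero {F : MvPolynomial σ R} (hF : F ≠ 0) : scaling σ R F ≠ 0 := by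
  intro h
  apply hF
  rw [← sum_homogeneousComponent F]
  refine Finset.sum_eq_zero fun i _ => ?_
  rw [← coeff_scaling, h, Polynomial.coeff_zero]

/-- The coefficients of `scaling` are the homogeneous components, so the hypothesis leaves a single
nonzero component. -/
theorem isHomogeneous_of_natDegree_scaling {F : MvPolynomial σ R}
    (h : (scaling σ R F).natDegree ≤ (scaling σ R F).natTrailingDegree) :
    F.IsHomogeneous (scaling σ R F).natDegree := by
  have h1 : ∀ i, i ≠ (scaling σ R F).natDegree → homogeneousComponent i F = 0 := by
    intro i hi
    rw [← coeff_scaling]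
    rcases lt_or_gt_of_ne hi with hi | hi
    · exact Polynomial.coeff_eq_zero_of_lt_natTrailingDegree (by omega)
    · exact Polynomial.coeff_eq_zero_of_natDegree_lt hi
  rw [← sum_homogeneousComponent F]
  refine IsHomogeneous.sum _ _ _ fun i _ => ?_
  rw [sum_homogeneousComponent F]
  by_cases hi : i = (scaling σ R F).natDegree
  · rw [← hi]
    exact homogeneousComponent_isHomogeneous i F
  · rw [h1 i hi]
    exact isHomogeneous_zero _ _ _

/-- The factors of a homogeneous polynomial over a domain are homogeneous. -/
theorem exists_isHomogeneous_of_mul [IsDomain R] {p q : MvPolynomial σ R} {d : ℕ}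
    (h : (p * q).IsHomogeneous d) (hp : p ≠ 0) (hq : q ≠ 0) :
    ∃ a b, a + b = d ∧ p.IsHomogeneous a ∧ q.IsHomogeneous b := by
  have h1 : scaling σ R p * scaling σ R q = Polynomial.X ^ d * Polynomial.C (p * q) := by
    rw [← map_mul, scaling_of_isHomogeneous h]
  have hpq : (Polynomial.C (p * q) : Polynomial (MvPolynomial σ R)) ≠ 0 :=
    Polynomial.C_ne_zero.2 (mul_ne_zero hp hq)
  have hp' := scaling_ne_zero hp
  have hq' := scaling_ne_zero hq
  -- Degree and trailing degree in `t` are additive and both equal `d` for the product. Hence they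
  -- coincide for each factor.
  have h2 := congrArg Polynomial.natDegree h1
  have h3 := congrArg Polynomial.natTrailingDegree h1
  rw [Polynomial.natDegree_mul hp' hq', Polynomial.natDegree_mul (by simp) hpq,
    Polynomial.natDegree_X_pow, Polynomial.natDegree_C] at h2
  rw [Polynomial.natTrailingDegree_mul hp' hq', Polynomial.natTrailingDegree_mul (by simp) hpq,
    Polynomial.natTrailingDegree_X_pow, Polynomial.natTrailingDegree_C] at h3
  have h4 := (scaling σ R p).natTrailingDegree_le_natDegree
  have h5 := (scaling σ R q).natTrailingDegree_le_natDegree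
  exact ⟨_, _, h2, isHomogeneous_of_natDegree_scaling (by omega),
    isHomogeneous_of_natDegree_scaling (by omega)⟩

theorem isHomogeneous_of_mul_left [IsDomain R] {p q : MvPolynomial σ R} {m d : ℕ}
    (h : (p * q).IsHomogeneous d) (hp : p ≠ 0) (hm : p.IsHomogeneous m) :
    q.IsHomogeneous (d - m) := by
  by_cases hq : q = 0
  · rw [hq]
    exact isHomogeneous_zero _ _ _
  · obtain ⟨a, b, hab, ha, hb⟩ := exists_isHomogeneous_of_mul h hp hq
    obtain rfl := ha.inj_right hm hp
    rwa [← hab, Nat.add_sub_cancel_left]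

theorem eval_ne_zero_of_isHomogeneous_zero {F : MvPolynomial σ R} (h : F.IsHomogeneous 0)
    (h0 : F ≠ 0) (v : σ → R) : eval v F ≠ 0 := by
  rw [← totalDegree_zero_iff_isHomogeneous, totalDegree_eq_zero_iff_eq_C] at h
  rw [h] at h0 ⊢
  rw [eval_C]
  rintro h1
  rw [h1, C_0] at h0
  exact h0 rfl

end Homogeneous

/-! ### Automorphisms of the projective space -/

section Automorphism

variable {k : Type u} [Field k] {n : ℕ}

/-- A representative of an everywhere defined transformation with a base point is not of minimal
degree. -/
theorem exists_represents_lt [Infinite k] {e : PartialIso (projectiveSpace k n)}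
    (he : e.source = univ) {d : ℕ} {G : PolyVec n k} (dG : G.Homog d)
    (hG : Represents G (Bir.mk e)) {v : Fin (n + 1) → k} (hv : v ≠ 0) (hGv : G.ev v = 0) :
    ∃ d' < d, ∃ G' : PolyVec n k, G'.Homog d' ∧ Represents G' (Bir.mk e) := by
  -- Being defined at `[v]`, the transformation also has a representative `A` with `A(v) ≠ 0`,
  -- proportional to `G`.
  obtain ⟨d', A, dA, hA⟩ := e.exists_local_homog (p := pt v hv) (he ▸ mem_univ _)
  obtain ⟨-, hw, -⟩ := hA.self_of_nhds
  obtain ⟨a, ha, hr⟩ := exists_rep_pt_eq_smul v hv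
  have hAv : A.ev v ≠ 0 := by
    intro h
    rw [hr, dA.ev_smul, h, smul_zero] at hw
    exact hw rfl
  obtain ⟨i, hi⟩ := Function.ne_iff.1 hAv
  replace hi : eval v (A i) ≠ 0 := hi
  have hcr := hG.cross (represents_of_eventually dA hA)
  have hAi : A i ≠ 0 := by
    rintro h
    simp [h] at hi
  have hGi : G i ≠ 0 := by
    intro h
    refine hG.ne_zero (funext fun j => ?_)
    have h1 := hcr i j
    rw [h, zero_mul, eq_comm, mul_eq_zero] at h1
    exact h1.resolve_right hAi
  -- Write `A i = c a'` and `G i = c b` with `a'` and `b` coprime. Then `c(v) ≠ 0` and `G i`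
  -- vanishes at `v`, so `b(v) = 0` and `b` has positive degree.
  obtain ⟨a', b, c, hrel, hca, hcb⟩ := UniqueFactorizationMonoid.exists_reduced_factors _ hAi (G i)
  have hc0 : c ≠ 0 := left_ne_zero_of_mul (hca ▸ hAi)
  have hb0 : b ≠ 0 := right_ne_zero_of_mul (hcb ▸ hGi)
  have hbv : eval v b = 0 := by
    have h1 : eval v (c * b) = 0 := by
      rw [hcb]
      exact congrFun hGv i
    rw [← hca, map_mul] at hi
    rw [map_mul] at h1
    exact (mul_eq_zero.1 h1).resolve_left (left_ne_zero_of_mul hi)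
  -- Cancelling `c` in `A i * G j = G i * A j` gives `a' G j = b A j`, and `b` is prime to `a'`.
  -- Dividing `G` by `b` lowers the degree.
  have hdvd : ∀ j, b ∣ G j := by
    intro j
    refine hrel.symm.dvd_of_dvd_mul_left ⟨A j, mul_left_cancel₀ hc0 ?_⟩
    rw [← mul_assoc, ← mul_assoc, hca, hcb, hcr i j, mul_comm]
  choose Q hQ using hdvd
  have hQi : Q i ≠ 0 := by
    intro h
    exact hGi (by rw [hQ, h, mul_zero])
  obtain ⟨m, m', hm, dm, -⟩ := exists_isHomogeneous_of_mul (hQ i ▸ dG i) hb0 hQi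
  have hm0 : m ≠ 0 := by
    rintro rfl
    exact eval_ne_zero_of_isHomogeneous_zero dm hb0 v hbv
  refine ⟨d - m, by omega, Q, fun j => isHomogeneous_of_mul_left (hQ j ▸ dG j) hb0 dm,
    hG.of_cross (d := d - m) (fun j => isHomogeneous_of_mul_left (hQ j ▸ dG j) hb0 dm)
      (fun h => hQi (congrFun h i)) fun j l => ?_⟩
  rw [hQ j, hQ l]
  ring

/-- A representative of minimal degree has no base point. -/
theorem exists_represents_ev_ne_zero [Infinite k] {e : PartialIso (projectiveSpace k n)}
    (he : e.source = univ) : ∃ (d : ℕ) (G : PolyVec n k), G.Homog d ∧ Represents G (Bir.mk e) ∧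
      ∀ v, v ≠ 0 → G.ev v ≠ 0 := by
  classical
  have hex := exists_represents (Bir.mk e)
  obtain ⟨G, dG, hG⟩ := Nat.find_spec hex
  refine ⟨_, G, dG, hG, fun v hv hGv => ?_⟩
  obtain ⟨d', hd', h⟩ := exists_represents_lt he dG hG hv hGv
  exact Nat.find_min hex hd' h

/-- If the degree were positive, `X 0` would vanish on the zero locus of `F`, contained in the
origin, and by the Nullstellensatz `F` would divide a power of `X 0`. Thus `F` would be associated
to some `X 0 ^ i`: for `i = 0` it is a unit, of degree `0`, and for `i > 0` it vanishes at the last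
coordinate vector. -/
theorem degree_eq_zero_of_eval_ne_zero [IsAlgClosed k] (hn : 1 ≤ n)
    {F : MvPolynomial (Fin (n + 1)) k} {d : ℕ} (hF : F.IsHomogeneous d)
    (h : ∀ v, v ≠ 0 → eval v F ≠ 0) : d = 0 := by
  by_contra hd
  have hdvd : ∃ N, F ∣ X 0 ^ N := by
    have h1 : (X 0 : MvPolynomial (Fin (n + 1)) k) ∈
        vanishingIdeal k (zeroLocus k (Ideal.span {F})) := by
      rw [mem_vanishingIdeal_iff]
      intro v hv
      rw [zeroLocus_span] at hv
      have hv0 : v = 0 := by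
        by_contra h0
        exact h v h0 (hv F rfl)
      simp [hv0]
    rw [vanishingIdeal_zeroLocus_eq_radical] at h1
    obtain ⟨N, hN⟩ := h1
    exact ⟨N, Ideal.mem_span_singleton.1 hN⟩
  obtain ⟨N, hN⟩ := hdvd
  obtain ⟨i, -, hi⟩ := (dvd_prime_pow (X_prime) N).1 hN
  have hlast : (Fin.last n) ≠ 0 := by
    intro h1
    have h2 := congrArg Fin.val h1
    simp at h2
    omega
  have hX : (X 0 ^ i : MvPolynomial (Fin (n + 1)) k).IsHomogeneous i := isHomogeneous_X_pow _ _
  obtain ⟨u, hu⟩ := hi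
  have hi0 : i ≠ 0 := by
    rintro rfl
    rw [pow_zero] at hu
    have hF0 : F ≠ 0 := left_ne_zero_of_mul_eq_one hu
    obtain ⟨a, b, hab, ha, -⟩ := exists_isHomogeneous_of_mul (hu ▸ isHomogeneous_one _ _) hF0
      u.ne_zero
    exact hd (by rw [hF.inj_right ha hF0]; omega)
  have h1 : eval (Pi.single (Fin.last n) 1 : Fin (n + 1) → k) (F * u) = 0 := by
    rw [hu, map_pow, eval_X, Pi.single_eq_of_ne hlast.symm, zero_pow hi0]
  rw [map_mul] at h1
  exact (mul_ne_zero (h _ (Pi.single_ne_zero_iff.2 one_ne_zero))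
    (u.isUnit.map (eval _)).ne_zero) h1

theorem exists_eq_linVec {G : PolyVec n k} (hG : G.Homog 1) : ∃ M, G = linVec M := by
  have h : ∀ i, ∃ a : Fin (n + 1) → k, ∑ j, a j • X j = G i := by
    intro i
    have h1 : G i ∈ homogeneousSubmodule (Fin (n + 1)) k 1 := hG i
    rw [homogeneousSubmodule_one_eq_span_X] at h1
    exact (Submodule.mem_span_range_iff_exists_fun k).1 h1
  choose M hM using h
  refine ⟨Matrix.of M, funext fun i => ?_⟩
  rw [← hM i]
  exact Finset.sum_congr rfl fun j _ => smul_eq_C_mul _ _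

/-- The automorphisms of the projective space are linear. -/
theorem exists_lin_eq [IsAlgClosed k] (hn : 1 ≤ n) {θ : Cr n k}
    (hθ : θ ∈ aut (projectiveSpace k n)) : ∃ M, lin n k M = θ := by
  obtain ⟨e, rfl, hs, ht⟩ := hθ
  obtain ⟨d, G, dG, hG, hG0⟩ := exists_represents_ev_ne_zero hs
  obtain ⟨d', H, dH, hH, hH0⟩ := exists_represents_ev_ne_zero (e := e.symm) ht
  obtain ⟨m, c, hc0, hc, hm, hcX⟩ := hG.exists_comp_eq hn hH dG dH
  -- `H(G(v)) = c(v) v` never vanishes for `v ≠ 0`, so `c` has no zero there and is constant. Then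
  -- `d * d' = 1`, and `G` is linear.
  have hm0 : m = 0 := by
    refine degree_eq_zero_of_eval_ne_zero hn hc fun v hv h => ?_
    have h1 := PolyVec.ev_eq_smul hcX v
    rw [h, zero_smul, PolyVec.ev_comp] at h1
    exact hH0 _ (hG0 v hv) h1
  subst hm0
  obtain rfl : d = 1 := Nat.eq_one_of_mul_eq_one_right hm
  obtain ⟨M, rfl⟩ := exists_eq_linVec dG
  have hdet : M.det ≠ 0 := by
    intro h
    obtain ⟨v, hv, h⟩ := Matrix.exists_mulVec_eq_zero_iff.2 h
    exact hG0 v hv (by rw [ev_linVec, h])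
  exact ⟨Matrix.GeneralLinearGroup.mkOfDetNeZero M hdet, (represents_lin _).eq hG⟩

/-- The group homomorphism from `PGL_{n+1}(k)` to the group of automorphisms. -/
def pglToAut (n : ℕ) (k : Type u) [Field k] [Infinite k] :
    Matrix.ProjGenLinGroup (Fin (n + 1)) k →* aut (projectiveSpace k n) :=
  Matrix.ProjGenLinGroup.lift ((lin n k).codRestrict _ lin_mem_aut)
    (MonoidHom.ext fun a => Subtype.ext (lin_scalar a))

theorem pglToAut_bijective [IsAlgClosed k] (hn : 1 ≤ n) : Function.Bijective (pglToAut n k) := by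
  constructor
  · rw [injective_iff_map_eq_one]
    intro g hg
    obtain ⟨M, rfl⟩ := Matrix.ProjGenLinGroup.mk_surjective g
    obtain ⟨a, rfl⟩ := lin_eq_one_iff.1 (congrArg Subtype.val hg)
    exact Matrix.ProjGenLinGroup.mk_scalar a
  · rintro ⟨θ, hθ⟩
    obtain ⟨M, rfl⟩ := exists_lin_eq hn hθ
    exact ⟨Matrix.ProjGenLinGroup.mk M, rfl⟩

theorem aut_le [IsAlgClosed k] (hn : 2 ≤ n) {N : Subgroup (Cr n k)} (hN : N.Normal) (hne : N ≠ ⊥)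
    (hcl : IsClosed (N : Set (Cr n k))) : aut (projectiveSpace k n) ≤ N := by
  intro θ hθ
  obtain ⟨M, rfl⟩ := exists_lin_eq (by omega) hθ
  exact lin_mem hn hN hne hcl M

end Automorphism

end Cremona
end

noncomputable section

namespace Cremona

open MvPolynomial

variable {k : Type u} [Field k] {n : ℕ}

/-! ### Homogenization on the chart `x_n = 1` -/

section Homogenize

/-- The coordinates `y_j = x_{j+1}`. -/
def chartIdx (j : Fin (n - 1)) : Fin (n + 1) := ⟨j + 1, by omega⟩

/-- The homogenization, in degree `D`, of a polynomial in `y`. -/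
def homogenize (D : ℕ) (P : MvPolynomial (Fin (n - 1)) k) : MvPolynomial (Fin (n + 1)) k :=
  ∑ i ∈ Finset.range (D + 1),
    rename chartIdx (homogeneousComponent i P) * X (Fin.last n) ^ (D - i)

theorem homogenize_isHomogeneous (D : ℕ) (P : MvPolynomial (Fin (n - 1)) k) :
    (homogenize (n := n) D P).IsHomogeneous D := by
  refine IsHomogeneous.sum _ _ _ fun i hi => ?_
  rw [Finset.mem_range] at hi
  have h := ((homogeneousComponent_isHomogeneous i P).rename_isHomogeneous
    (f := chartIdx (n := n))).mul
    (isHomogeneous_X_pow (R := k) (Fin.last n) (D - i))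
  rwa [show i + (D - i) = D by omega] at h

theorem eval_homogenize {D : ℕ} {P : MvPolynomial (Fin (n - 1)) k} (hD : P.totalDegree ≤ D)
    {v : Fin (n + 1) → k} (hv : v (Fin.last n) = 1) :
    eval v (homogenize D P) = eval (v ∘ chartIdx) P := by
  rw [homogenize, map_sum]
  simp only [map_mul, map_pow, eval_X, hv, one_pow, mul_one, eval_rename]
  rw [← map_sum]
  congr 1
  conv_rhs => rw [← sum_homogeneousComponent P]
  refine (Finset.sum_subset (Finset.range_mono (by omega)) fun i _ hi => ?_).symm
  rw [Finset.mem_range] at hi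
  exact homogeneousComponent_eq_zero _ _ (by omega)

/-- The point with coordinates `(x, y)` of the chart `x_n = 1`. -/
def chartVec (x : k) (y : Fin (n - 1) → k) : Fin (n + 1) → k := fun i =>
  if h0 : i.1 = 0 then x else if h : i.1 < n then y ⟨i.1 - 1, by omega⟩ else 1

theorem chartVec_zero (x : k) (y : Fin (n - 1) → k) : chartVec x y 0 = x := dif_pos rfl

theorem chartVec_last (hn : 1 ≤ n) (x : k) (y : Fin (n - 1) → k) :
    chartVec x y (Fin.last n) = 1 := by
  have h : n ≠ 0 := by omega
  simp [chartVec, h]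

theorem chartVec_comp (x : k) (y : Fin (n - 1) → k) : chartVec x y ∘ chartIdx = y := by
  funext j
  have h : j.1 + 1 < n := by omega
  simp [chartVec, chartIdx, h]

/-- A general vector is a scalar multiple of one with last coordinate `1`, and the common degree
makes `A` and `B` scale alike. -/
theorem eq_of_chart [Infinite k] {A B F : MvPolynomial (Fin (n + 1)) k} {d d' : ℕ}
    (hA : A.IsHomogeneous d) (hB : B.IsHomogeneous d) (hF : F.IsHomogeneous d') (hF0 : F ≠ 0)
    (h : ∀ v, v (Fin.last n) = 1 → eval v F ≠ 0 → eval v A = eval v B) : A = B := by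
  refine eq_of_generic (F := F * X (Fin.last n)) (mul_ne_zero hF0 (X_ne_zero _)) fun v _ hvF => ?_
  rw [map_mul, eval_X, mul_ne_zero_iff] at hvF
  obtain ⟨h1, h2⟩ := hvF
  have hv : v = v (Fin.last n) • ((v (Fin.last n))⁻¹ • v) := by
    rw [smul_smul, mul_inv_cancel₀ h2, one_smul]
  rw [hv, eval_smul_of_isHomogeneous hF] at h1
  rw [hv, eval_smul_of_isHomogeneous hA, eval_smul_of_isHomogeneous hB,
    h _ (by simp [h2]) (right_ne_zero_of_mul h1)]

end Homogenize

/-! ### Möbius transformations with polynomial coefficients -/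

section MoebiusPoly

/-- A bound for the degrees of the entries. -/
def matDeg (P : Matrix (Fin 2) (Fin 2) (MvPolynomial (Fin (n - 1)) k)) : ℕ :=
  ∑ i, ∑ j, (P i j).totalDegree

theorem totalDegree_le_matDeg (P : Matrix (Fin 2) (Fin 2) (MvPolynomial (Fin (n - 1)) k))
    (i j : Fin 2) : (P i j).totalDegree ≤ matDeg P :=
  (Finset.single_le_sum (f := fun j => (P i j).totalDegree) (fun _ _ => Nat.zero_le _)
    (Finset.mem_univ j)).trans
    (Finset.single_le_sum (f := fun i => ∑ j, (P i j).totalDegree) (fun _ _ => Nat.zero_le _)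
      (Finset.mem_univ i))

/-- The linear forms `a x_0 + b x_n` and `c x_0 + d x_n`, homogenized. -/
def rowForm (P : Matrix (Fin 2) (Fin 2) (MvPolynomial (Fin (n - 1)) k)) (i : Fin 2) :
    MvPolynomial (Fin (n + 1)) k :=
  homogenize (matDeg P) (P i 0) * X 0 + homogenize (matDeg P) (P i 1) * X (Fin.last n)

theorem rowForm_isHomogeneous (P : Matrix (Fin 2) (Fin 2) (MvPolynomial (Fin (n - 1)) k))
    (i : Fin 2) : (rowForm P i).IsHomogeneous (matDeg P + 1) :=
  ((homogenize_isHomogeneous _ _).mul (isHomogeneous_X _ _)).add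
    ((homogenize_isHomogeneous _ _).mul (isHomogeneous_X _ _))

theorem eval_rowForm (P : Matrix (Fin 2) (Fin 2) (MvPolynomial (Fin (n - 1)) k)) (i : Fin 2)
    {v : Fin (n + 1) → k} (hv : v (Fin.last n) = 1) :
    eval v (rowForm P i) = eval (v ∘ chartIdx) (P i 0) * v 0 + eval (v ∘ chartIdx) (P i 1) := by
  rw [rowForm, map_add, map_mul, map_mul, eval_X, eval_X, hv, mul_one,
    eval_homogenize (totalDegree_le_matDeg P i 0) hv,
    eval_homogenize (totalDegree_le_matDeg P i 1) hv]

/-- The homogeneous polynomials that define a Möbius transformation. -/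
def moebiusPoly (P : Matrix (Fin 2) (Fin 2) (MvPolynomial (Fin (n - 1)) k)) : PolyVec n k :=
  -- The new first coordinate is the ratio of the two row forms; multiplying by `row 1` and by `X
  -- (Fin.last n)` gives all components the same degree.
  fun i => if i = 0 then rowForm P 0 * X (Fin.last n) else rowForm P 1 * X i

theorem moebiusPoly_homog (P : Matrix (Fin 2) (Fin 2) (MvPolynomial (Fin (n - 1)) k)) :
    (moebiusPoly P).Homog (matDeg P + 1 + 1) := by
  intro i
  unfold moebiusPoly
  split_ifs
  · exact (rowForm_isHomogeneous P 0).mul (isHomogeneous_X _ _)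
  · exact (rowForm_isHomogeneous P 1).mul (isHomogeneous_X _ _)

theorem moebiusPoly_ev_of_ne_zero (P : Matrix (Fin 2) (Fin 2) (MvPolynomial (Fin (n - 1)) k))
    (v : Fin (n + 1) → k) {i : Fin (n + 1)} (hi : i ≠ 0) :
    (moebiusPoly P).ev v i = eval v (rowForm P 1) * v i := by
  simp [PolyVec.ev, moebiusPoly, hi]

theorem moebiusPoly_ev (P : Matrix (Fin 2) (Fin 2) (MvPolynomial (Fin (n - 1)) k))
    {v : Fin (n + 1) → k} (hv : v (Fin.last n) = 1) :
    (moebiusPoly P).ev v = moebiusVec P v := by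
  funext i
  have h : (fun j : Fin (n - 1) => v ⟨j + 1, by omega⟩) = v ∘ chartIdx := rfl
  by_cases hi : i = 0
  · subst hi
    simp only [PolyVec.ev, moebiusPoly, moebiusVec, if_true, map_mul, eval_X, hv, mul_one,
      eval_rowForm P 0 hv, h]
  · rw [moebiusPoly_ev_of_ne_zero P v hi, eval_rowForm P 1 hv]
    simp only [moebiusVec, if_neg hi, h]

theorem last_ne_zero (hn : 1 ≤ n) : Fin.last n ≠ 0 := by
  intro h
  have h1 := congrArg Fin.val h
  simp at h1
  omega

theorem rowForm_ne_zero [Infinite k] (hn : 1 ≤ n)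
    {P : Matrix (Fin 2) (Fin 2) (MvPolynomial (Fin (n - 1)) k)} (hP : P.det ≠ 0) (i : Fin 2) :
    rowForm P i ≠ 0 := by
  intro h
  have h1 : ∀ (x : k) (y : Fin (n - 1) → k), eval y (P i 0) * x + eval y (P i 1) = 0 := by
    intro x y
    have h2 := eval_rowForm P i (chartVec_last hn x y)
    rwa [h, map_zero, chartVec_zero, chartVec_comp, eq_comm] at h2
  have h2 : P i 1 = 0 := MvPolynomial.funext fun y => by simpa using h1 0 y
  have h3 : P i 0 = 0 := MvPolynomial.funext fun y => by simpa [h2] using h1 1 y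
  refine hP (Matrix.det_eq_zero_of_row_eq_zero i fun j => ?_)
  fin_cases j
  · exact h3
  · exact h2

theorem moebiusPoly_ne_zero [Infinite k] (hn : 1 ≤ n)
    {P : Matrix (Fin 2) (Fin 2) (MvPolynomial (Fin (n - 1)) k)} (hP : P.det ≠ 0) :
    moebiusPoly P ≠ 0 := by
  intro h
  have h1 := congrFun h (Fin.last n)
  simp only [moebiusPoly, if_neg (last_ne_zero hn)] at h1
  exact mul_ne_zero (rowForm_ne_zero hn hP 1) (X_ne_zero _) h1

/-- The matrices `P` and `Q` are proportional. -/
def Proportional {R : Type*} [Mul R] (P Q : Matrix (Fin 2) (Fin 2) R) : Prop :=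
  ∀ i j i' j', P i j * Q i' j' = P i' j' * Q i j

theorem cross_moebiusVec {P Q : Matrix (Fin 2) (Fin 2) (MvPolynomial (Fin (n - 1)) k)}
    (h : Proportional P Q) (v : Fin (n + 1) → k) (i j : Fin (n + 1)) :
    moebiusVec P v i * moebiusVec Q v j = moebiusVec P v j * moebiusVec Q v i := by
  have h' := fun i j i' j' => congrArg (eval fun j : Fin (n - 1) => v ⟨j + 1, by omega⟩)
    (h i j i' j')
  simp only [map_mul] at h'
  unfold moebiusVec
  by_cases hi : i = 0 <;> by_cases hj : j = 0
  · rw [hi, hj]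
  · simp only [if_pos hi, if_neg hj]
    -- Expanded in powers of `v 0`, the difference has the minors of the pair `P`, `Q` as
    -- coefficients.
    linear_combination v j * (v 0 ^ 2 * h' 0 0 1 0 + v 0 * h' 0 0 1 1 + v 0 * h' 0 1 1 0 +
      h' 0 1 1 1)
  · simp only [if_neg hi, if_pos hj]
    linear_combination -v i * (v 0 ^ 2 * h' 0 0 1 0 + v 0 * h' 0 0 1 1 + v 0 * h' 0 1 1 0 +
      h' 0 1 1 1)
  · simp only [if_neg hi, if_neg hj]
    linear_combination v i * v j * (v 0 * h' 1 0 1 1 + v 0 * h' 1 1 1 0)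

theorem cross_of_chart [Infinite k] {G H : PolyVec n k} {d d' e : ℕ} (hG : G.Homog d)
    (hH : H.Homog d') {F : MvPolynomial (Fin (n + 1)) k} (hF : F.IsHomogeneous e) (hF0 : F ≠ 0)
    (h : ∀ v, v (Fin.last n) = 1 → eval v F ≠ 0 → ∀ i j,
      G.ev v i * H.ev v j = G.ev v j * H.ev v i) (i j : Fin (n + 1)) :
    G i * H j = G j * H i := by
  refine eq_of_chart ((hG i).mul (hH j)) ((hG j).mul (hH i)) hF hF0 fun v hv hvF => ?_
  rw [map_mul, map_mul]
  exact h v hv hvF i j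

theorem cross_moebiusPoly [Infinite k]
    {P Q : Matrix (Fin 2) (Fin 2) (MvPolynomial (Fin (n - 1)) k)} (h : Proportional P Q)
    (i j : Fin (n + 1)) :
    moebiusPoly P i * moebiusPoly Q j = moebiusPoly P j * moebiusPoly Q i := by
  refine cross_of_chart (moebiusPoly_homog P) (moebiusPoly_homog Q) (isHomogeneous_one _ _)
    one_ne_zero (fun v hv _ i j => ?_) i j
  rw [moebiusPoly_ev P hv, moebiusPoly_ev Q hv]
  exact cross_moebiusVec h v i j

/-- Dividing the image under `Q` by its second row form brings it back to the chart with the same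
`y`, where composition is the product of matrices. Of the `matDeg P + 2` factors released by
homogeneity, one is absorbed in clearing the denominator of `moebiusVec (P * Q)`. -/
theorem moebiusPoly_ev_ev (hn : 1 ≤ n)
    (P Q : Matrix (Fin 2) (Fin 2) (MvPolynomial (Fin (n - 1)) k))
    {v : Fin (n + 1) → k} (hv : v (Fin.last n) = 1) (hQ : eval v (rowForm Q 1) ≠ 0) :
    (moebiusPoly P).ev ((moebiusPoly Q).ev v) =
      eval v (rowForm Q 1) ^ (matDeg P + 1) • moebiusVec (P * Q) v := by
  have hw : (moebiusPoly Q).ev v = eval v (rowForm Q 1) •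
      ((eval v (rowForm Q 1))⁻¹ • (moebiusPoly Q).ev v) := by
    rw [smul_smul, mul_inv_cancel₀ hQ, one_smul]
  set w := (eval v (rowForm Q 1))⁻¹ • (moebiusPoly Q).ev v with hwdef
  have hwi : ∀ i, i ≠ 0 → w i = v i := by
    intro i hi
    rw [hwdef, Pi.smul_apply, moebiusPoly_ev_of_ne_zero Q v hi, smul_eq_mul, ← mul_assoc,
      inv_mul_cancel₀ hQ, one_mul]
  have hwl : w (Fin.last n) = 1 := (hwi _ (last_ne_zero hn)).trans hv
  have hw0 : w 0 * eval v (rowForm Q 1) = eval v (rowForm Q 0) := by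
    rw [hwdef, Pi.smul_apply, smul_eq_mul]
    simp only [PolyVec.ev, moebiusPoly, if_true, map_mul, eval_X, hv, mul_one]
    field_simp
  have hwy : w ∘ chartIdx = v ∘ chartIdx := by
    funext j
    refine hwi _ fun h => ?_
    have h1 := congrArg Fin.val h
    simp [chartIdx] at h1
  rw [hw, (moebiusPoly_homog P).ev_smul, pow_succ, ← smul_smul, moebiusPoly_ev P hwl]
  congr 1
  rw [eval_rowForm Q 0 hv, eval_rowForm Q 1 hv] at hw0
  rw [eval_rowForm Q 1 hv]
  funext i
  have e1 : (fun j : Fin (n - 1) => v ⟨j + 1, by omega⟩) = v ∘ chartIdx := rfl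
  have e2 : (fun j : Fin (n - 1) => w ⟨j + 1, by omega⟩) = v ∘ chartIdx := hwy
  simp only [moebiusVec, Pi.smul_apply, smul_eq_mul, Matrix.mul_apply, Fin.sum_univ_two, e1, e2,
    map_add, map_mul]
  by_cases hi : i = 0
  · simp only [if_pos hi]
    linear_combination eval (v ∘ chartIdx) (P 0 0) * hw0
  · simp only [if_neg hi, hwi i hi]
    linear_combination eval (v ∘ chartIdx) (P 1 0) * v i * hw0

theorem cross_moebiusPoly_comp [Infinite k] (hn : 1 ≤ n)
    {P Q T : Matrix (Fin 2) (Fin 2) (MvPolynomial (Fin (n - 1)) k)} (hQ : Q.det ≠ 0)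
    (h : Proportional (P * Q) T) (i j : Fin (n + 1)) :
    (moebiusPoly P).comp (moebiusPoly Q) i * moebiusPoly T j =
      (moebiusPoly P).comp (moebiusPoly Q) j * moebiusPoly T i := by
  refine cross_of_chart ((moebiusPoly_homog P).comp (moebiusPoly_homog Q)) (moebiusPoly_homog T)
    (rowForm_isHomogeneous Q 1) (rowForm_ne_zero hn hQ 1) (fun v hv hvQ i j => ?_) i j
  rw [PolyVec.ev_comp, moebiusPoly_ev_ev hn P Q hv hvQ, moebiusPoly_ev T hv, Pi.smul_apply,
    Pi.smul_apply, smul_mul_assoc, smul_mul_assoc, cross_moebiusVec h v i j]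

theorem moebiusVec_scalar (a : MvPolynomial (Fin (n - 1)) k) {v : Fin (n + 1) → k} :
    moebiusVec (a • (1 : Matrix (Fin 2) (Fin 2) _)) v = eval (v ∘ chartIdx) a • v := by
  have e1 : (fun j : Fin (n - 1) => v ⟨j + 1, by omega⟩) = v ∘ chartIdx := rfl
  funext i
  by_cases hi : i = 0
  · simp [moebiusVec, hi, e1]
  · simp [moebiusVec, hi, e1]

theorem exists_moebiusPoly_comp_eq [Infinite k] (hn : 1 ≤ n)
    {P Q : Matrix (Fin 2) (Fin 2) (MvPolynomial (Fin (n - 1)) k)} (hQ : Q.det ≠ 0)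
    {a : MvPolynomial (Fin (n - 1)) k} (ha : a ≠ 0) (h : P * Q = a • 1) :
    ∃ (m : ℕ) (c : MvPolynomial (Fin (n + 1)) k), c ≠ 0 ∧ c.IsHomogeneous m ∧
      ∀ i, (moebiusPoly P).comp (moebiusPoly Q) i = c * X i := by
  have hev : ∀ v : Fin (n + 1) → k, v (Fin.last n) = 1 → eval v (rowForm Q 1) ≠ 0 →
      ((moebiusPoly P).comp (moebiusPoly Q)).ev v =
        (eval v (rowForm Q 1) ^ (matDeg P + 1) * eval (v ∘ chartIdx) a) • v := by
    intro v hv hvQ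
    rw [PolyVec.ev_comp, moebiusPoly_ev_ev hn P Q hv hvQ, h, moebiusVec_scalar, smul_smul]
  have hhom := (moebiusPoly_homog P).comp (moebiusPoly_homog Q)
  obtain ⟨c, hc⟩ := exists_eq_mul_X hn (P := (moebiusPoly P).comp (moebiusPoly Q)) fun i j => by
    rw [mul_comm, mul_comm (X j)]
    refine cross_of_chart (H := X) hhom (isHomogeneous_X k)
      (rowForm_isHomogeneous Q 1) (rowForm_ne_zero hn hQ 1) (fun v hv hvQ i j => ?_) j i
    rw [hev v hv hvQ]
    simp only [PolyVec.ev, eval_X, Pi.smul_apply, smul_eq_mul]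
    ring
  refine ⟨(matDeg Q + 1 + 1) * (matDeg P + 1 + 1) - 1, c, ?_, ?_, hc⟩
  · rintro rfl
    -- On the chart the composition multiplies `v` by a power of `rowForm Q 1` times `a`. If `c`
    -- vanished, the homogenization of `a` would vanish, and then `a` itself.
    have h1 : rowForm Q 1 * homogenize a.totalDegree a = 0 := by
      refine eq_of_chart ((rowForm_isHomogeneous Q 1).mul (homogenize_isHomogeneous _ a))
        (isHomogeneous_zero _ _ _) (rowForm_isHomogeneous Q 1) (rowForm_ne_zero hn hQ 1)
        fun v hv hvQ => ?_
      have h2 := congrFun (hev v hv hvQ) (Fin.last n)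
      simp only [PolyVec.ev, hc, zero_mul, map_zero, Pi.smul_apply, hv, smul_eq_mul, mul_one] at h2
      rw [map_mul, map_zero, eval_homogenize le_rfl hv]
      rw [eq_comm, mul_eq_zero] at h2
      rw [h2.resolve_left (pow_ne_zero _ hvQ), mul_zero]
    have h2 := (mul_eq_zero.1 h1).resolve_left (rowForm_ne_zero hn hQ 1)
    refine ha (MvPolynomial.funext fun y => ?_)
    have h3 := eval_homogenize (le_refl a.totalDegree) (chartVec_last hn 0 y)
    rw [h2, map_zero, chartVec_comp] at h3
    rw [← h3, map_zero]
  · refine isHomogeneous_of_mul_X (i := 0) ?_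
    rw [← hc, Nat.sub_add_cancel (Nat.mul_pos (by omega) (by omega))]
    exact hhom 0

/-- The adjugate is an inverse up to the scalar `det P`, so it provides the other half of an inverse
pair without leaving polynomial matrices. -/
theorem exists_represents_moebiusPoly [Infinite k] (hn : 1 ≤ n)
    {P : Matrix (Fin 2) (Fin 2) (MvPolynomial (Fin (n - 1)) k)} (hP : P.det ≠ 0) :
    ∃ θ : Cr n k, Represents (moebiusPoly P) θ := by
  have hadj : P.adjugate.det ≠ 0 := by
    rw [Matrix.det_adjugate]
    exact pow_ne_zero _ hP
  obtain ⟨m, c, hc0, hc, h⟩ := exists_moebiusPoly_comp_eq hn hP hP P.adjugate_mul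
  obtain ⟨m', c', hc0', hc', h'⟩ := exists_moebiusPoly_comp_eq hn hadj hP P.mul_adjugate
  exact ⟨_, (InversePair.mk (moebiusPoly P) (moebiusPoly P.adjugate) c c' _ _ m m'
    (moebiusPoly_homog _) (moebiusPoly_homog _) hc hc' hc0 hc0' (Nat.succ_ne_zero _)
    (Nat.succ_ne_zero _) h h').represents⟩

end MoebiusPoly

/-! ### Möbius transformations with coefficients in `K` -/

section Fractions

theorem exists_clear_denominators (M : Matrix (Fin 2) (Fin 2) (RatFun n k)) :
    ∃ (P : Matrix (Fin 2) (Fin 2) (MvPolynomial (Fin (n - 1)) k)) (r : RatFun n k), r ≠ 0 ∧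
      P.map (algebraMap _ (RatFun n k)) = r • M := by
  obtain ⟨b, hb⟩ := IsLocalization.exist_integer_multiples_of_finite
    (nonZeroDivisors (MvPolynomial (Fin (n - 1)) k)) fun p : Fin 2 × Fin 2 => M p.1 p.2
  choose P hP using hb
  refine ⟨Matrix.of fun i j => P (i, j), algebraMap _ _ b.1,
    IsFractionRing.to_map_ne_zero_of_mem_nonZeroDivisors b.2, ?_⟩
  ext i j
  simp [hP, Algebra.smul_def]

theorem det_ne_zero_of_map_eq {M : Matrix (Fin 2) (Fin 2) (RatFun n k)} (hM : M.det ≠ 0)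
    {P : Matrix (Fin 2) (Fin 2) (MvPolynomial (Fin (n - 1)) k)} {r : RatFun n k} (hr : r ≠ 0)
    (h : P.map (algebraMap _ (RatFun n k)) = r • M) : P.det ≠ 0 := by
  intro h0
  have h1 := RingHom.map_det (algebraMap (MvPolynomial (Fin (n - 1)) k) (RatFun n k)) P
  rw [h0, map_zero, RingHom.mapMatrix_apply, h, Matrix.det_smul] at h1
  exact mul_ne_zero (pow_ne_zero _ hr) hM h1.symm

theorem proportional_of_map_eq {M : Matrix (Fin 2) (Fin 2) (RatFun n k)}
    {P Q : Matrix (Fin 2) (Fin 2) (MvPolynomial (Fin (n - 1)) k)} {r s : RatFun n k}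
    (hP : P.map (algebraMap _ (RatFun n k)) = r • M)
    (hQ : Q.map (algebraMap _ (RatFun n k)) = s • M) : Proportional P Q := by
  intro i j i' j'
  have hP' : ∀ i j, algebraMap _ (RatFun n k) (P i j) = r * M i j := fun i j =>
    congrFun (congrFun hP i) j
  have hQ' : ∀ i j, algebraMap _ (RatFun n k) (Q i j) = s * M i j := fun i j =>
    congrFun (congrFun hQ i) j
  apply IsFractionRing.injective (MvPolynomial (Fin (n - 1)) k) (RatFun n k)
  rw [map_mul, map_mul, hP', hP', hQ', hQ']
  ring

/-- The condition on the chart is replaced by a homogeneous representative, to which composition and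
uniqueness of representatives apply. -/
theorem isMoebius_iff [Infinite k] {M : Matrix (Fin 2) (Fin 2) (RatFun n k)} {θ : Cr n k} :
    IsMoebius M θ ↔ ∃ (P : Matrix (Fin 2) (Fin 2) (MvPolynomial (Fin (n - 1)) k)) (r : RatFun n k),
      r ≠ 0 ∧ P.map (algebraMap _ (RatFun n k)) = r • M ∧ Represents (moebiusPoly P) θ := by
  constructor
  · rintro ⟨P, r, e, W, hr, hP, rfl, hW, hWd, hWs, h⟩
    have : Nonempty (projectiveSpace k n) := ⟨pt (fun _ => 1) fun h => one_ne_zero (congrFun h 0)⟩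
    refine ⟨P, r, hr, hP, Represents.of_chart (moebiusPoly_homog P) (Fin.last n) hW
      hWd.nonempty hWs fun v hv hvl hvW => ?_⟩
    rw [moebiusPoly_ev P hvl]
    exact h v hv hvl hvW
  · rintro ⟨P, r, hr, hP, e, rfl, d, F, hF, hF0, h⟩
    refine ⟨P, r, e, nonvanishing F, hr, hP, rfl, isOpen_nonvanishing hF,
      dense_nonvanishing hF hF0, fun p hp => ?_, fun v hv hvl hvW => ?_⟩
    · have h1 := (h (rep p) (rep_ne_zero p) hp).1
      rwa [pt_rep] at h1
    · rw [← moebiusPoly_ev P hvl]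
      exact (h v hv ((pt_mem_nonvanishing hF).1 hvW)).2

theorem IsMoebius.unique [Infinite k] {M : Matrix (Fin 2) (Fin 2) (RatFun n k)} {θ θ' : Cr n k}
    (h : IsMoebius M θ) (h' : IsMoebius M θ') : θ = θ' := by
  obtain ⟨P, r, hr, hP, h⟩ := isMoebius_iff.1 h
  obtain ⟨Q, s, hs, hQ, h'⟩ := isMoebius_iff.1 h'
  exact h.unique h' (cross_moebiusPoly (proportional_of_map_eq hP hQ))

theorem exists_isMoebius [Infinite k] (hn : 1 ≤ n) {M : Matrix (Fin 2) (Fin 2) (RatFun n k)}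
    (hM : M.det ≠ 0) : ∃ θ : Cr n k, IsMoebius M θ := by
  obtain ⟨P, r, hr, hP⟩ := exists_clear_denominators M
  obtain ⟨θ, hθ⟩ := exists_represents_moebiusPoly hn (det_ne_zero_of_map_eq hM hr hP)
  exact ⟨θ, isMoebius_iff.2 ⟨P, r, hr, hP, hθ⟩⟩

theorem IsMoebius.mul [Infinite k] (hn : 1 ≤ n) {M M' : Matrix (Fin 2) (Fin 2) (RatFun n k)}
    (hM : M.det ≠ 0) (hM' : M'.det ≠ 0) {θ θ' : Cr n k} (h : IsMoebius M θ)
    (h' : IsMoebius M' θ') : IsMoebius (M * M') (θ * θ') := by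
  obtain ⟨P, r, hr, hP, h⟩ := isMoebius_iff.1 h
  obtain ⟨Q, s, hs, hQ, h'⟩ := isMoebius_iff.1 h'
  have hPdet := det_ne_zero_of_map_eq hM hr hP
  have hQdet := det_ne_zero_of_map_eq hM' hs hQ
  have hc := cross_moebiusPoly_comp (P := P) hn hQdet
    (fun _ _ _ _ => mul_comm _ _ : Proportional (P * Q) (P * Q))
  refine isMoebius_iff.2 ⟨P * Q, r * s, mul_ne_zero hr hs, ?_, (h.mul h').of_cross
    (moebiusPoly_homog _) (moebiusPoly_ne_zero hn ?_) hc⟩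
  · rw [Matrix.map_mul, hP, hQ, Matrix.smul_mul, Matrix.mul_smul, smul_smul]
  · rw [Matrix.det_mul]
    exact mul_ne_zero hPdet hQdet

theorem IsMoebius.smul [Infinite k] {M : Matrix (Fin 2) (Fin 2) (RatFun n k)} {θ : Cr n k}
    (h : IsMoebius M θ) {s : RatFun n k} (hs : s ≠ 0) : IsMoebius (s • M) θ := by
  obtain ⟨P, r, hr, hP, h⟩ := isMoebius_iff.1 h
  refine isMoebius_iff.2 ⟨P, r * s⁻¹, mul_ne_zero hr (inv_ne_zero hs), ?_, h⟩
  rw [hP, smul_smul, mul_assoc, inv_mul_cancel₀ hs, mul_one]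

/-- A linear map that has the form of a Möbius transformation on the chart is the Möbius
transformation. -/
theorem isMoebius_of_represents_linVec [Infinite k] (hn : 1 ≤ n)
    {P : Matrix (Fin 2) (Fin 2) (MvPolynomial (Fin (n - 1)) k)} (hP : P.det ≠ 0)
    {L : Matrix (Fin (n + 1)) (Fin (n + 1)) k} {θ : Cr n k} (hL : Represents (linVec L) θ)
    (h : ∀ v : Fin (n + 1) → k, v (Fin.last n) = 1 → moebiusVec P v = L.mulVec v) :
    IsMoebius (P.map (algebraMap _ (RatFun n k))) θ := by
  refine isMoebius_iff.2 ⟨P, 1, one_ne_zero, (one_smul _ _).symm,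
    hL.of_cross (moebiusPoly_homog P) (moebiusPoly_ne_zero hn hP) fun i j => ?_⟩
  refine cross_of_chart (linVec_homog L) (moebiusPoly_homog P) (isHomogeneous_one _ _)
    one_ne_zero (fun v hv _ i j => ?_) i j
  rw [moebiusPoly_ev P hv, h v hv, ev_linVec, mul_comm]

theorem isMoebius_one [Infinite k] (hn : 1 ≤ n) : IsMoebius (n := n) 1 (1 : Cr n k) := by
  have h := isMoebius_of_represents_linVec (k := k) hn (P := 1) (by simp)
    (by rw [linVec_one]; exact Represents.one) fun v _ => by
      have h1 := moebiusVec_scalar (n := n) (1 : MvPolynomial (Fin (n - 1)) k) (v := v)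
      rw [one_smul, map_one, one_smul] at h1
      rw [h1, Matrix.one_mulVec]
  rwa [Matrix.map_one _ (map_zero _) (map_one _)] at h

/-- The identity `a x + b = (c x + d) x` for all `x` forces `b = c = 0` and `a = d`. -/
theorem IsMoebius.exists_eq_smul_one [Infinite k] (hn : 1 ≤ n)
    {M : Matrix (Fin 2) (Fin 2) (RatFun n k)} (h : IsMoebius M (1 : Cr n k)) :
    ∃ a : RatFun n k, M = a • 1 := by
  obtain ⟨P, r, hr, hP, h⟩ := isMoebius_iff.1 h
  have hcr := h.cross Represents.one
  have key : ∀ (x : k) (y : Fin (n - 1) → k), eval y (P 0 0) * x + eval y (P 0 1) =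
      (eval y (P 1 0) * x + eval y (P 1 1)) * x := by
    intro x y
    have h1 := congrArg (eval (chartVec x y)) (hcr 0 (Fin.last n))
    simp only [moebiusPoly, if_true, if_neg (last_ne_zero hn), map_mul, eval_X,
      chartVec_last hn, chartVec_zero, mul_one, eval_rowForm P _ (chartVec_last hn x y),
      chartVec_comp] at h1
    exact h1
  have h01 : P 0 1 = 0 := MvPolynomial.funext fun y => by simpa using key 0 y
  have h10 : P 1 0 = 0 := MvPolynomial.funext fun y => by
    classical
    -- Once `b = 0`, comparing the values at `1` and at some `x ≠ 0, 1` gives `c x (x - 1) = 0`.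
    obtain ⟨x, hx⟩ := Infinite.exists_notMem_finset ({0, 1} : Finset k)
    simp only [Finset.mem_insert, Finset.mem_singleton, not_or] at hx
    have h1 := key 1 y
    have h2 := key x y
    rw [h01, map_zero] at h1 h2
    have h3 : eval y (P 1 0) * (x * (x - 1)) = 0 := by linear_combination x * h1 - h2
    rw [map_zero]
    exact (mul_eq_zero.1 h3).resolve_right (mul_ne_zero hx.1 (sub_ne_zero.2 hx.2))
  have h11 : P 0 0 = P 1 1 := MvPolynomial.funext fun y => by
    simpa [h01, h10] using key 1 y
  have hM : M = r⁻¹ • P.map (algebraMap _ (RatFun n k)) := by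
    rw [hP, smul_smul, inv_mul_cancel₀ hr, one_smul]
  refine ⟨r⁻¹ * algebraMap _ _ (P 0 0), ?_⟩
  rw [hM]
  ext i j
  fin_cases i <;> fin_cases j <;> simp [h01, h10, h11]

theorem IsMoebius.mem_J0 [Infinite k] (hn : 1 ≤ n) {M : Matrix (Fin 2) (Fin 2) (RatFun n k)}
    (hM : M.det ≠ 0) {θ : Cr n k} (h : IsMoebius M θ) : θ ∈ J0 n k := by
  obtain ⟨P, r, hr, hP, e, rfl, d, F, hF, hF0, h⟩ := isMoebius_iff.1 h
  have hR := rowForm_ne_zero hn (det_ne_zero_of_map_eq hM hr hP) 1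
  have hFR := hF.mul (rowForm_isHomogeneous P 1)
  refine ⟨e, nonvanishing (F * rowForm P 1), rfl, isOpen_nonvanishing hFR,
    dense_nonvanishing hFR (mul_ne_zero hF0 hR), fun p hp => ?_, fun v hv hvW => ?_⟩
  · have hp' : eval (rep p) (F * rowForm P 1) ≠ 0 := hp
    rw [map_mul] at hp'
    have h1 := (h (rep p) (rep_ne_zero p) (left_ne_zero_of_mul hp')).1
    rwa [pt_rep] at h1
  · rw [pt_mem_nonvanishing hFR, map_mul, mul_ne_zero_iff] at hvW
    obtain ⟨-, hw, he⟩ := h v hv hvW.1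
    -- Dividing by the second row form restores the coordinates of index `i ≠ 0`, as required for
    -- preserving the fibres.
    refine ⟨(eval v (rowForm P 1))⁻¹ • (moebiusPoly P).ev v,
      smul_ne_zero (inv_ne_zero hvW.2) hw, fun i hi => ?_, ?_⟩
    · rw [Pi.smul_apply, moebiusPoly_ev_of_ne_zero P v hi, smul_eq_mul, ← mul_assoc,
        inv_mul_cancel₀ hvW.2, one_mul]
    · rw [he]
      exact pt_eq_pt_iff.2 ⟨_, hvW.2, by rw [smul_smul, mul_inv_cancel₀ hvW.2, one_smul]⟩

end Fractions

/-! ### The groups `PGL(2, K)` and `PSL(2, K)` in the Cremona group -/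

section MoebiusGroup

open Matrix

/-- The group homomorphism from `GL_2(K)` to the Cremona group. -/
def moebius [Infinite k] (hn : 1 ≤ n) : GeneralLinearGroup (Fin 2) (RatFun n k) →* Cr n k where
  toFun M := (exists_isMoebius hn M.det_ne_zero).choose
  map_one' := (exists_isMoebius hn (GeneralLinearGroup.det_ne_zero 1)).choose_spec.unique (by
    rw [Units.val_one]
    exact isMoebius_one hn)
  map_mul' M M' := (exists_isMoebius hn (M * M').det_ne_zero).choose_spec.unique
    ((exists_isMoebius hn M.det_ne_zero).choose_spec.mul hn M.det_ne_zero M'.det_ne_zero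
      (exists_isMoebius hn M'.det_ne_zero).choose_spec)

theorem isMoebius_moebius [Infinite k] (hn : 1 ≤ n)
    (M : GeneralLinearGroup (Fin 2) (RatFun n k)) : IsMoebius M.1 (moebius hn M) :=
  (exists_isMoebius hn M.det_ne_zero).choose_spec

theorem moebius_scalar [Infinite k] (hn : 1 ≤ n) (a : (RatFun n k)ˣ) :
    moebius hn (GeneralLinearGroup.scalar (Fin 2) a) = 1 := by
  refine (isMoebius_moebius hn _).unique ?_
  have h := (isMoebius_one (k := k) hn).smul a.ne_zero
  rwa [smul_one_eq_diagonal] at h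

/-- The group homomorphism from `PGL_2(K)` to the Cremona group. -/
def pglMoebius [Infinite k] (hn : 1 ≤ n) : ProjGenLinGroup (Fin 2) (RatFun n k) →* Cr n k :=
  ProjGenLinGroup.lift (moebius hn) (MonoidHom.ext fun a => moebius_scalar hn a)

theorem pglMoebius_injective [Infinite k] (hn : 1 ≤ n) :
    Function.Injective (pglMoebius (k := k) hn) := by
  rw [injective_iff_map_eq_one]
  intro g hg
  obtain ⟨M, rfl⟩ := ProjGenLinGroup.mk_surjective g
  have h := isMoebius_moebius hn M
  rw [show moebius hn M = 1 from hg] at h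
  obtain ⟨a, ha⟩ := h.exists_eq_smul_one hn
  have ha0 : a ≠ 0 := by
    rintro rfl
    rw [zero_smul] at ha
    exact M.ne_zero ha
  have hM : M = GeneralLinearGroup.scalar (Fin 2) (Units.mk0 a ha0) := by
    refine Units.ext ?_
    rw [ha, smul_one_eq_diagonal]
    rfl
  rw [hM]
  exact ProjGenLinGroup.mk_scalar _

/-- The group homomorphism from `PSL_2(K)` to the Cremona group. -/
def pslMoebius [Infinite k] (hn : 1 ≤ n) :
    ProjectiveSpecialLinearGroup (Fin 2) (RatFun n k) →* Cr n k :=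
  (pglMoebius hn).comp ProjectiveSpecialLinearGroup.toPGL

theorem pslMoebius_injective [Infinite k] (hn : 1 ≤ n) :
    Function.Injective (pslMoebius (k := k) hn) :=
  (pglMoebius_injective hn).comp ProjectiveSpecialLinearGroup.toPGL_injective

/-- When the determinant is `s * s`, dividing the matrix by `s` makes it special without changing
the transformation. -/
theorem exists_moebius_toGL_eq [Infinite k] (hn : 1 ≤ n) {θ : Cr n k} (hθ : θ ∈ J1 n k) :
    ∃ M : SpecialLinearGroup (Fin 2) (RatFun n k),
      moebius hn (SpecialLinearGroup.toGL M) = θ := by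
  obtain ⟨-, M, hM, s, hs⟩ := hθ
  have hs0 : s ≠ 0 := by
    rintro rfl
    exact M.det_ne_zero (by rw [hs, mul_zero])
  have hdet : (s⁻¹ • M.1).det = 1 := by
    rw [det_smul, hs, Fintype.card_fin]
    field_simp
  exact ⟨⟨s⁻¹ • M.1, hdet⟩, (isMoebius_moebius hn _).unique (hM.smul (inv_ne_zero hs0))⟩

theorem moebius_toGL_mem_J1 [Infinite k] (hn : 1 ≤ n)
    (M : SpecialLinearGroup (Fin 2) (RatFun n k)) :
    moebius hn (SpecialLinearGroup.toGL M) ∈ J1 n k := by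
  have h := isMoebius_moebius hn (SpecialLinearGroup.toGL M)
  exact ⟨h.mem_J0 hn (GeneralLinearGroup.det_ne_zero _), _, h, 1, by simp⟩

theorem range_pslMoebius [Infinite k] (hn : 1 ≤ n) : range (pslMoebius (k := k) hn) = J1 n k := by
  ext θ
  constructor
  · rintro ⟨g, rfl⟩
    obtain ⟨M, rfl⟩ := QuotientGroup.mk_surjective g
    exact moebius_toGL_mem_J1 hn M
  · intro hθ
    obtain ⟨M, rfl⟩ := exists_moebius_toGL_eq hn hθ
    exact ⟨QuotientGroup.mk M, rfl⟩

/-- The translation `x_0 ↦ x_0 + x_n` belongs to both groups; it links `Aut(ℙ^n)` to `J^1`. -/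
theorem moebius_elem [Infinite k] (hn : 1 ≤ n) :
    moebius hn (elem (zero_ne_one (α := Fin 2)) 1) = lin n k (elem (last_ne_zero hn).symm 1) := by
  refine (isMoebius_moebius hn _).unique ?_
  have h := isMoebius_of_represents_linVec hn (P := transvection (0 : Fin 2) 1 1)
    (by rw [det_transvection_of_ne _ _ zero_ne_one]; exact one_ne_zero)
    (represents_lin (n := n) (k := k) (elem (last_ne_zero hn).symm 1)) fun v hv => by
      rw [elem_val, transvection_mulVec]
      funext i
      by_cases hi : i = 0
      · simp [moebiusVec, transvection, single, hi, hv]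
      · simp [moebiusVec, transvection, single, hi]
  have h2 : (transvection (0 : Fin 2) 1 (1 : MvPolynomial (Fin (n - 1)) k)).map
      (algebraMap _ (RatFun n k)) = (elem (zero_ne_one (α := Fin 2)) (1 : RatFun n k)).1 := by
    ext i j
    fin_cases i <;> fin_cases j <;> simp [elem_val, transvection, single]
  rwa [h2] at h

/-- The preimage of `N` in `GL(2, K)` is normal and contains an elementary matrix, through the
linear translation already known to lie in `N`. It therefore contains `SL(2, K)`. -/
theorem J1_subset [IsAlgClosed k] (hn : 2 ≤ n) {N : Subgroup (Cr n k)} (hN : N.Normal)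
    (hne : N ≠ ⊥) (hcl : IsClosed (N : Set (Cr n k))) : J1 n k ⊆ (N : Set (Cr n k)) := by
  intro θ hθ
  have hn1 : 1 ≤ n := by omega
  obtain ⟨M, rfl⟩ := exists_moebius_toGL_eq hn1 hθ
  refine toGL_mem_of_elem_mem (hN.comap (moebius hn1)) (zero_ne_one (α := Fin 2)) one_ne_zero ?_ M
  rw [Subgroup.mem_comap, moebius_elem]
  exact lin_mem hn hN hne hcl _

end MoebiusGroup

end Cremona
end

theorem proposition4p1 {k : Type u} [Field k] [IsAlgClosed k] (n : ℕ) (hn : 2 ≤ n)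
    (N : Subgroup (Cremona.Cr n k)) (hnormal : N.Normal) (hnontrivial : N ≠ ⊥)
    (hclosed : IsClosed (N : Set (Cremona.Cr n k))) :
    (Cremona.aut (Cremona.projectiveSpace k n) ≤ N ∧
      Cremona.J1 n k ⊆ (N : Set (Cremona.Cr n k))) ∧
    (∃ φ : Matrix.ProjGenLinGroup (Fin (n + 1)) k ≃*
        Cremona.aut (Cremona.projectiveSpace k n),
      ∀ M : Matrix.GeneralLinearGroup (Fin (n + 1)) k,
        Cremona.IsLinear M.1 (φ (Matrix.ProjGenLinGroup.mk M)).1) ∧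
    (∃ ψ : Matrix.ProjectiveSpecialLinearGroup (Fin 2) (Cremona.RatFun n k) →* Cremona.Cr n k,
      Function.Injective ψ ∧ Set.range ψ = Cremona.J1 n k ∧
      ∀ M : Matrix.SpecialLinearGroup (Fin 2) (Cremona.RatFun n k),
        Cremona.IsMoebius M.1 (ψ (QuotientGroup.mk M))) := by
  have hn1 : 1 ≤ n := by omega
  refine ⟨⟨Cremona.aut_le hn hnormal hnontrivial hclosed,
    Cremona.J1_subset hn hnormal hnontrivial hclosed⟩,
    ⟨MulEquiv.ofBijective _ (Cremona.pglToAut_bijective hn1), Cremona.isLinear_lin⟩,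
    ⟨Cremona.pslMoebius hn1, Cremona.pslMoebius_injective hn1, Cremona.range_pslMoebius hn1,
      fun M => Cremona.isMoebius_moebius hn1 (Matrix.SpecialLinearGroup.toGL M)⟩⟩
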